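/- **Theorem 1.1.** Let $\omega>0$, $\nu\ge 0$, $\varepsilon>0$ with $\omega^2+\nu^2+\varepsilon^2=1$, let $g>0$, and put $$\alpha=\sqrt{\nu^4+4\omega^2},\quad \mu_2=\sqrt{1+\omega^2+\alpha},\quad \beta_2=\frac{2\omega\mu_2}{\alpha+2\omega^2+\nu^2},\quad \gamma_0=\frac{2\alpha}{\omega},$$ $$\kappa_1^2=(2\nu^2+\varepsilon^2)\Bigl(1+\frac{2\nu^2}{\alpha-\nu^2+2\omega^2}\Bigr),\quad g_1=g\,\frac{\alpha+2\omega^2+\nu^2}{2\alpha},\quad \kappa=\frac{\kappa_1}{\beta_2},\quad g_0=\frac{g_1\gamma_0^2}{4\beta_2}.$$ With $z=x_1+ix_2$ let $\Lambda_0=\{u\in L^2(\mathbb R^2): u=f(z)e^{-\pi|z|^2/2},\ f\text{ entire}\}$, let $$E(u)=\int_{\mathbb R^2}\tfrac12(\varepsilon^2x_1^2+\kappa^2x_2^2)|u|^2+\tfrac{g_0}{2}|u|^4\,dx\in[0,\infty],\qquad I(\varepsilon,\kappa)=\inf\{E(u):u\in\Lambda_0,\ \|u\|_{L^2}=1\},$$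 and let $(\Pi_0u)(x)=\int_{\mathbb R^2} e^{-\frac\pi2|x-y|^2+i\pi(x_2y_1-y_2x_1)}u(y)\,dy$. For $\tau=\tau_R+i\tau_I$ with $\tau_I>0$ let $$\Theta(z,\tau)=\frac1i\sum_{n\in\mathbb Z}(-1)^ne^{i\pi\tau(n+1/2)^2}e^{(2n+1)\pi iz},\qquad u_\tau(x)=e^{\frac\pi2(z^2-|z|^2)}\,\Theta(\sqrt{\tau_I}\,z,\tau).$$ The modulus $|u_\tau|$ is periodic with respect to the lattice $\tau_I^{-1/2}(\mathbb Z\oplus\tau\mathbb Z)$; let $\gamma(\tau)$ be the mean of $|u_\tau|^4$ over a period cell divided by the square of the mean of $|u_\tau|^2$ over that cell, and let $b=\gamma(e^{2i\pi/3})$. Then $b\approx1.1596$ (that is, $|b-1.1596|<5\cdot10^{-5}$). In the regime $(\varepsilon,\kappa\varepsilon^{-1/3})\to(0,0)$ one has $$\frac23\sqrt{\frac{g_0\,\varepsilon\kappa}{\pi}}\;<\;I(\varepsilon,\kappa)\;\le\;\frac23\sqrt{\frac{g_0\,b\,\varepsilon\kappa}{\pi}}+O\Bigl(\sqrt{\varepsilon\kappa}\,\bigl(\tfrac{\kappa^3}{\varepsilon}\bigr)^{1/8}\Bigr).$$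 Moreover, let $v=\Pi_0(u_\tau\rho)$ with $\tau=e^{2i\pi/3}$ and $\rho\ge0$ given by $$\rho(x)^2=\frac{2}{\pi\sqrt b\,R_1R_2}\Bigl(1-\frac{x_1^2}{\sqrt b\,R_1^2}-\frac{x_2^2}{\sqrt b\,R_2^2}\Bigr)_+,\quad R_1=\Bigl(\frac{4g_0\kappa}{\pi\varepsilon^3}\Bigr)^{1/4},\quad R_2=\Bigl(\frac{4g_0\varepsilon}{\pi\kappa^3}\Bigr)^{1/4}.$$ Then $v\in\Lambda_0$, $v\neq0$, and $v$ realizes the upper bound: $$E\Bigl(\frac{v}{\|v\|_{L^2}}\Bigr)=\frac23\sqrt{\frac{g_0\,b\,\varepsilon\kappa}{\pi}}+O\Bigl(\sqrt{\varepsilon\kappa}\,\bigl(\tfrac{\kappa^3}{\varepsilon}\bigr)^{1/8}\Bigr).$$ Precisely: for all $0<m\le M$ there are $C,\delta>0$ such that, for all $\omega,\nu,\varepsilon$ as above and all $g\in[m,M]$ with $\varepsilon<\delta$ and $\kappa\varepsilon^{-1/3}<\delta$, all these assertions hold, each $O(X)$ standing for a quantity of absolute value at most $CX$. -/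

import Mathlib

open scoped ENNReal
open MeasureTheory

noncomputable section

namespace LLL

/-! ### Parameters

`ω` is the rotation speed, `ν` the anisotropy of the trap, `ε` is defined by
`ω ^ 2 + ν ^ 2 + ε ^ 2 = 1`, and `g` is the coupling constant. -/

/-- `α = √(ν⁴ + 4ω²)`. -/
def alpha (ω ν : ℝ) : ℝ := √(ν ^ 4 + 4 * ω ^ 2)

/-- The larger symplectic frequency `μ₂` of the quadratic Hamiltonian, `μ₂² = 1 + ω² + α`. -/
def mu₂ (ω ν : ℝ) : ℝ := √(1 + ω ^ 2 + alpha ω ν)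

/-- `β₂ = 2ωμ₂ / (α + 2ω² + ν²)`. -/
def beta₂ (ω ν : ℝ) : ℝ := 2 * ω * mu₂ ω ν / (alpha ω ν + 2 * ω ^ 2 + ν ^ 2)

/-- The parameter `2α / ω`. -/
def gammaPar (ω ν : ℝ) : ℝ := 2 * alpha ω ν / ω

/-- `κ₁`, with `κ₁² = (2ν² + ε²) (1 + 2ν² / (α - ν² + 2ω²))`. -/
def kappa₁ (ω ν ε : ℝ) : ℝ :=
  √((2 * ν ^ 2 + ε ^ 2) * (1 + 2 * ν ^ 2 / (alpha ω ν - ν ^ 2 + 2 * ω ^ 2)))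

/-- `g₁ = g (α + 2ω² + ν²) / (2α)`. -/
def g₁ (ω ν g : ℝ) : ℝ := g * ((alpha ω ν + 2 * ω ^ 2 + ν ^ 2) / (2 * alpha ω ν))

/-- `κ = κ₁ / β₂`. -/
def kappa (ω ν ε : ℝ) : ℝ := kappa₁ ω ν ε / beta₂ ω ν

/-- `g₀ = g₁ (2α / ω)² / (4β₂)`. -/
def g₀ (ω ν g : ℝ) : ℝ := g₁ ω ν g * gammaPar ω ν ^ 2 / (4 * beta₂ ω ν)

/-! ### The lowest Landau level and the energy

The plane `ℝ²` is identified with `ℂ` through `z = x₁ + i x₂`; it carries Lebesgue measure. -/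

/-- The space `Λ₀` of square integrable functions `f(z) exp(-π|z|²/2)` with `f` entire (each element
is given by its continuous representative). -/
def Lambda₀ : Set (ℂ → ℂ) :=
  {u | MemLp u 2 volume ∧ ∃ f : ℂ → ℂ, Differentiable ℂ f ∧
    ∀ z : ℂ, u z = f z * Complex.exp (-(Real.pi / 2 * ‖z‖ ^ 2 : ℝ))}

/-- The energy `E(u) = ∫ ½ (ε² x₁² + κ² x₂²) |u|² + (g₀ / 2) |u|⁴`, as an element of `[0, ∞]`. -/
def energy (ε κ g0 : ℝ) (u : ℂ → ℂ) : ℝ≥0∞ :=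
  ∫⁻ z : ℂ, (ENNReal.ofReal (1 / 2 * (ε ^ 2 * z.re ^ 2 + κ ^ 2 * z.im ^ 2)) * ‖u z‖ₑ ^ 2
    + ENNReal.ofReal (g0 / 2) * ‖u z‖ₑ ^ 4)

/-- The infimum `I(ε, κ)` of the energy over the unit sphere of `Λ₀`. -/
def minEnergy (ε κ g0 : ℝ) : ℝ≥0∞ :=
  ⨅ u ∈ {u : ℂ → ℂ | u ∈ Lambda₀ ∧ eLpNorm u 2 volume = 1}, energy ε κ g0 u

/-- The projection `(Π₀ u)(x) = ∫ exp(-π/2 |x - y|² + iπ (x₂ y₁ - y₂ x₁)) u(y) dy`. -/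
def proj₀ (u : ℂ → ℂ) (x : ℂ) : ℂ :=
  ∫ y : ℂ, Complex.exp (-(Real.pi / 2 * ‖x - y‖ ^ 2 : ℝ)
    + Complex.I * (Real.pi * (x.im * y.re - y.im * x.re) : ℝ)) * u y

/-- `u / ‖u‖` in `L²`. -/
def normalize (u : ℂ → ℂ) (z : ℂ) : ℂ := u z / ((eLpNorm u 2 volume).toReal : ℂ)

/-! ### The theta function and the vortex lattice -/

/-- `Θ(z, τ) = (1/i) ∑ₙ (-1)ⁿ exp(iπτ(n + 1/2)²) exp((2n + 1)πiz)`. -/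
def Theta (z τ : ℂ) : ℂ :=
  1 / Complex.I * ∑' n : ℤ, (-1 : ℂ) ^ n
    * Complex.exp (Complex.I * Real.pi * τ * ((n : ℂ) + 1 / 2) ^ 2)
    * Complex.exp ((2 * (n : ℂ) + 1) * Real.pi * Complex.I * z)

/-- `u_τ(z) = exp(π/2 (z² - |z|²)) Θ(√(Im τ) z, τ)`. -/
def uTau (τ z : ℂ) : ℂ :=
  Complex.exp ((Real.pi : ℂ) / 2 * (z ^ 2 - ((‖z‖ ^ 2 : ℝ) : ℂ))) * Theta ((√τ.im : ℝ) * z) τ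

/-- A period cell of `|u_τ|`, whose period lattice is `(Im τ)^(-1/2) (ℤ ⊕ τℤ)`. -/
def cell (τ : ℂ) : Set ℂ :=
  {z | ∃ s ∈ Set.Ico (0 : ℝ) 1, ∃ t ∈ Set.Ico (0 : ℝ) 1, z = (s + t * τ) / (√τ.im : ℝ)}

/-- `γ(τ)`: the mean of `|u_τ|⁴` over a period cell divided by the square of that of `|u_τ|²`. -/
def gammaTau (τ : ℂ) : ℝ :=
  (⨍ z in cell τ, ‖uTau τ z‖ ^ 4) / (⨍ z in cell τ, ‖uTau τ z‖ ^ 2) ^ 2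

/-- `j = exp(2iπ/3)`, the parameter of the hexagonal lattice. -/
def hexTau : ℂ := Complex.exp (2 * Complex.I * Real.pi / 3)

/-- `b = γ(j)`. -/
def b : ℝ := gammaTau hexTau

/-! ### The trial function -/

/-- `R₁ = (4 g₀ κ / (π ε³))^(1/4)`. -/
def R₁ (ε κ g0 : ℝ) : ℝ := (4 * g0 * κ / (Real.pi * ε ^ 3)) ^ (1 / 4 : ℝ)

/-- `R₂ = (4 g₀ ε / (π κ³))^(1/4)`. -/
def R₂ (ε κ g0 : ℝ) : ℝ := (4 * g0 * ε / (Real.pi * κ ^ 3)) ^ (1 / 4 : ℝ)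

/-- The inverted parabola profile `ρ ≥ 0`,
`ρ² = 2 / (π √b R₁ R₂) (1 - x₁² / (√b R₁²) - x₂² / (√b R₂²))₊`. -/
def rho (ε κ g0 : ℝ) (z : ℂ) : ℝ :=
  √(2 / (Real.pi * √b * R₁ ε κ g0 * R₂ ε κ g0)
    * max (1 - z.re ^ 2 / (√b * R₁ ε κ g0 ^ 2) - z.im ^ 2 / (√b * R₂ ε κ g0 ^ 2)) 0)

/-- The trial function `v = Π₀ (u_τ ρ)` with `τ = exp(2iπ/3)`. -/
def trial (ε κ g0 : ℝ) : ℂ → ℂ := proj₀ fun z => uTau hexTau z * (rho ε κ g0 z : ℂ)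

end LLL

end

namespace LLL

/-! Lower bound. The radii satisfy `ε R₁ = κ R₂`, so in the scaled variable `D z` with axes `R₁, R₂`
the potential is `(Λ/2)|D z|²` with `Λ = (ε R₁)²`. Completing the square around the inverted
parabola `p` bounds the energy below by `Λ/3 + (g₀/2) ∫ (|u|² - p)²`, and `Λ/3` is the Thomas-Fermi
value (`thomasFermi_add_le_energy`). For the infimum to be strictly larger, the last integral needs
a positive lower bound uniform in `u`. Here `|u|² = |f|² exp(-π|z|²)` with `f` entire and `p` has
compact support: if `|u|²` were close to `p` in `L²`, then `f` would be small on an annulus outside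
the support, hence near `0` by the mean value property, although `p 0 > 0`
(`exists_le_integral_sub_sq`).

Upper bound. The function `u_τ` is bounded and fixed by `Π₀` (`proj₀_eq_self`), while the profile
varies on the length `S₂ = b^{1/4} R₂`. Thus `Π₀(u_τ ρ)` is close to `u_τ ρ`
(`exists_lintegral_proj₀_sub_le`), and in the integrals the periodic functions `|u_τ|²` and `|u_τ|⁴`
may be replaced by their means (`exists_abs_integral_mul_sub_le`). What remains is the Thomas-Fermi
problem with `g₀` replaced by `b g₀`. The profile is a square root, only Hölder `1/2` at its edge,
so relative errors have order `S₂^{-1/2}`, that is `(κ³/ε)^{1/8}`.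

Value of `b`. In lattice coordinates `u_τ` and its square have Fourier series with Gaussian
coefficients. Parseval and unfolding express `γ(τ)` by two theta constants (`gammaTau_eq`), and at
the hexagonal point a few terms suffice (`abs_b_sub_lt`).

Uniformity. In the regime considered `κ` is small, which keeps `ω` away from `0` and `g₀` between
multiples of `m` and `M` (`two_mul_le_g₀`, `g₀_le`). -/

/-! ### Radial averages of entire functions and the reproducing kernel. -/

/-- The change of variables `t ↦ e^{iθ} t`. -/
theorem integral_comp_circleMap_mul (g : ℂ → ℂ) (θ : ℝ) :
    ∫ t : ℂ, g (circleMap 0 1 θ * t) = ∫ t : ℂ, g t := by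
  have h := (rotation (Circle.exp θ)).measurePreserving.integral_comp
    (rotation (Circle.exp θ)).toHomeomorph.measurableEmbedding g
  simpa [rotation_apply, circleMap] using h

theorem integrable_comp_circleMap_mul {g : ℂ → ℂ} (hg : Integrable g) (θ : ℝ) :
    Integrable fun t : ℂ => g (circleMap 0 1 θ * t) := by
  have h := (rotation (Circle.exp θ)).measurePreserving.integrable_comp_of_integrable hg
  simpa [rotation_apply, circleMap, Function.comp_def] using h

/-- Mean value property of entire functions against a radial weight. -/
theorem integral_radial_mul_entire {χ : ℝ → ℝ} (hχ : Measurable χ) {F : ℂ → ℂ}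
    (hF : Differentiable ℂ F) (hint : Integrable fun t : ℂ => (χ ‖t‖ : ℂ) * F t) :
    ∫ t : ℂ, (χ ‖t‖ : ℂ) * F t = F 0 * ∫ t : ℂ, (χ ‖t‖ : ℂ) := by
  set g : ℂ → ℂ := fun t => (χ ‖t‖ : ℂ) * F t with hg
  have hnorm : ∀ θ : ℝ, ∀ t : ℂ, ‖circleMap 0 1 θ * t‖ = ‖t‖ := fun θ t => by simp
  have hmeas : Measurable fun p : ℝ × ℂ => g (circleMap 0 1 p.1 * p.2) := by
    have hc : Continuous fun p : ℝ × ℂ => circleMap 0 1 p.1 * p.2 := by fun_prop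
    have : Measurable g := by
      have := hF.continuous.measurable
      fun_prop
    exact this.comp hc.measurable
  set μ : Measure ℝ := volume.restrict (Set.Ioc 0 (2 * Real.pi)) with hμ
  have hprod : Integrable (fun p : ℝ × ℂ => g (circleMap 0 1 p.1 * p.2)) (μ.prod volume) := by
    rw [integrable_prod_iff hmeas.aestronglyMeasurable]
    refine ⟨Filter.Eventually.of_forall fun θ => integrable_comp_circleMap_mul hint θ, ?_⟩
    have : (fun θ : ℝ => ∫ t : ℂ, ‖g (circleMap 0 1 θ * t)‖) = fun _ => ∫ t : ℂ, ‖g t‖ := by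
      ext θ
      have := integral_comp_circleMap_mul (fun t => (‖g t‖ : ℂ)) θ
      rw [integral_complex_ofReal, integral_complex_ofReal] at this
      exact_mod_cast this
    simp only [this]
    exact integrable_const _
  have hswap := integral_integral_swap (f := fun (θ : ℝ) (t : ℂ) => g (circleMap 0 1 θ * t)) hprod
  have hmean : ∀ t : ℂ, ∫ θ, g (circleMap 0 1 θ * t) ∂μ
      = (2 * Real.pi : ℂ) * ((χ ‖t‖ : ℂ) * F 0) := by
    intro t
    have h1 : Real.circleAverage (fun w => F (w * t)) 0 1 = F 0 := by
      have := circleAverage_of_differentiable_on_off_countable (c := 0) (R := 1)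
        (f := fun w => F (w * t)) Set.countable_empty
        (by have := hF.continuous; fun_prop) (fun z _ => by
          exact (hF (z * t)).comp z (by fun_prop))
      simpa using this
    rw [Real.circleAverage_def] at h1
    have h2 : ∫ θ, g (circleMap 0 1 θ * t) ∂μ
        = (χ ‖t‖ : ℂ) * ∫ θ in (0 : ℝ)..(2 * Real.pi), F (circleMap 0 1 θ * t) := by
      rw [intervalIntegral.integral_of_le (by positivity), ← integral_const_mul]
      simp only [hg, hnorm, hμ]
    rw [h2, ← h1]
    generalize ∫ θ in (0 : ℝ)..(2 * Real.pi), F (circleMap 0 1 θ * t) = Y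
    simp only [Complex.real_smul]
    push_cast
    field_simp
  simp only [hmean, integral_comp_circleMap_mul g] at hswap
  rw [integral_const, integral_const_mul, integral_mul_const] at hswap
  have hvol : μ.real Set.univ = 2 * Real.pi := by
    simp [hμ, Measure.real, Real.pi_pos.le]
  rw [hvol, Complex.real_smul] at hswap
  push_cast at hswap
  have hpi : (2 * Real.pi : ℂ) ≠ 0 := by
    exact_mod_cast (by positivity : (2 * Real.pi : ℝ) ≠ 0)
  have := mul_left_cancel₀ hpi hswap
  rw [this, mul_comm]

theorem integral_gauss {a : ℝ} (ha : 0 < a) :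
    ∫ t : ℂ, Real.exp (-(a * ‖t‖ ^ 2)) = Real.pi / a := by
  have h := GaussianFourier.integral_rexp_neg_mul_sq_norm (V := ℂ) ha
  simpa [neg_mul] using h

theorem integrable_gauss {a : ℝ} (ha : 0 < a) :
    Integrable fun t : ℂ => Real.exp (-(a * ‖t‖ ^ 2)) := by
  refine Integrable.of_integral_ne_zero ?_
  rw [integral_gauss ha]
  positivity

/-- The kernel of `proj₀`. -/
noncomputable def kernel₀ (x y : ℂ) : ℂ :=
  Complex.exp (-(Real.pi / 2 * ‖x - y‖ ^ 2 : ℝ)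
    + Complex.I * (Real.pi * (x.im * y.re - y.im * x.re) : ℝ))

theorem proj₀_eq (u : ℂ → ℂ) (x : ℂ) : proj₀ u x = ∫ y : ℂ, kernel₀ x y * u y := rfl

theorem norm_kernel₀ (x y : ℂ) : ‖kernel₀ x y‖ = Real.exp (-(Real.pi / 2 * ‖x - y‖ ^ 2)) := by
  rw [kernel₀, Complex.norm_exp]
  congr 1
  simp [-Complex.ofReal_mul, -Complex.ofReal_sub]

/-- Apart from the weight in `x`, the kernel is holomorphic in `x`; this places projections in the
lowest Landau level. -/
theorem kernel₀_eq (x y : ℂ) : kernel₀ x y = Complex.exp (-(Real.pi / 2 * ‖x‖ ^ 2 : ℝ))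
    * Complex.exp (Real.pi * x * (starRingEnd ℂ) y - (Real.pi / 2 * ‖y‖ ^ 2 : ℝ)) := by
  rw [kernel₀, ← Complex.exp_add]
  congr 1
  simp only [← Complex.normSq_eq_norm_sq, Complex.normSq_apply]
  apply Complex.ext <;> simp <;> ring

/-- The projection reproduces the bounded elements of the lowest Landau level. -/
theorem proj₀_eq_self {u f : ℂ → ℂ} (hf : Differentiable ℂ f)
    (hu : ∀ z, u z = f z * Complex.exp (-(Real.pi / 2 * ‖z‖ ^ 2 : ℝ))) {B : ℝ}
    (hB : ∀ z, ‖u z‖ ≤ B) (x : ℂ) : proj₀ u x = u x := by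
  rw [proj₀_eq, ← integral_add_left_eq_self _ x]
  -- After the translation `y = x + t` the exponents combine into the radial weight `exp(-π|t|²)`,
  -- of total mass one, times the entire function `F`; the mean value property then evaluates at `t
  -- = 0`.
  set F : ℂ → ℂ := fun t => f (x + t) * Complex.exp (-(Real.pi * (starRingEnd ℂ) x * t)) with hF
  have key : ∀ t, kernel₀ x (x + t) * u (x + t) =
      Complex.exp (-(Real.pi / 2 * ‖x‖ ^ 2 : ℝ)) * ((Real.exp (-(Real.pi * ‖t‖ ^ 2)) : ℂ) * F t) := by
    intro t
    rw [hu, hF, kernel₀, Complex.ofReal_exp]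
    have : ∀ a b c d e : ℂ, ∀ g : ℂ, a + b = c + d + e → Complex.exp a * (g * Complex.exp b)
        = Complex.exp c * (Complex.exp d * (g * Complex.exp e)) := by
      intro a b c d e g h
      calc _ = g * Complex.exp (a + b) := by rw [Complex.exp_add]; ring
        _ = g * Complex.exp (c + d + e) := by rw [h]
        _ = _ := by rw [Complex.exp_add, Complex.exp_add]; ring
    apply this
    simp only [← Complex.normSq_eq_norm_sq, Complex.normSq_apply]
    apply Complex.ext <;> simp <;> ring
  have hFd : Differentiable ℂ F := by
    have : Differentiable ℂ fun t => f (x + t) := hf.comp (by fun_prop)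
    simp only [hF]
    fun_prop
  have hcont : Continuous u := by
    have : u = fun z => f z * Complex.exp (-(Real.pi / 2 * ‖z‖ ^ 2 : ℝ)) := funext hu
    rw [this]
    have := hf.continuous
    fun_prop
  have hint : Integrable fun t : ℂ => (Real.exp (-(Real.pi * ‖t‖ ^ 2)) : ℂ) * F t := by
    have h1 : Integrable fun t : ℂ => kernel₀ x (x + t) * u (x + t) := by
      refine ((integrable_gauss (a := Real.pi / 2) (by positivity)).mul_const B).mono' ?_ ?_
      · have h2 : Continuous fun t => kernel₀ x (x + t) := by
          unfold kernel₀
          fun_prop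
        exact (h2.mul (hcont.comp (by fun_prop))).aestronglyMeasurable
      · refine Filter.Eventually.of_forall fun t => ?_
        rw [norm_mul, norm_kernel₀]
        simp only [sub_add_cancel_left, norm_neg]
        gcongr
        exact hB _
    simp only [key] at h1
    exact (integrable_const_mul_iff (IsUnit.mk0 _ (Complex.exp_ne_zero _)) _).1 h1
  simp only [key]
  rw [integral_const_mul, integral_radial_mul_entire (χ := fun r => Real.exp (-(Real.pi * r ^ 2)))
    (by fun_prop) hFd hint, integral_complex_ofReal, integral_gauss Real.pi_pos,
    div_self Real.pi_ne_zero, hu]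
  simp only [hF]
  simp
  ring


/-! ### Absolutely convergent Fourier series and periodization. -/

theorem integral_exp_two_pi_int (k : ℤ) :
    ∫ s in (0 : ℝ)..1, Complex.exp (2 * Real.pi * Complex.I * k * s) = if k = 0 then 1 else 0 := by
  split_ifs with h
  · simp [h]
  · have hc : (2 * Real.pi * Complex.I * k : ℂ) ≠ 0 := by
      simp [Real.pi_ne_zero, h]
    rw [integral_exp_mul_complex hc]
    have : Complex.exp (2 * Real.pi * Complex.I * k * (1 : ℝ)) = 1 := by
      rw [Complex.exp_eq_one_iff]
      exact ⟨k, by push_cast; ring⟩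
    rw [this]
    simp

theorem norm_exp_two_pi_int (k : ℤ) (s : ℝ) :
    ‖Complex.exp (2 * Real.pi * Complex.I * k * s)‖ = 1 := by
  rw [Complex.norm_exp]
  simp

theorem summable_fourier {a : ℤ → ℂ} (ha : Summable fun n => ‖a n‖) (s : ℝ) :
    Summable fun n : ℤ => ‖a n * Complex.exp (2 * Real.pi * Complex.I * n * s)‖ := by
  simpa only [norm_mul, norm_exp_two_pi_int, mul_one] using ha

theorem continuous_fourier {a : ℤ → ℂ} (ha : Summable fun n => ‖a n‖) :
    Continuous fun s : ℝ => ∑' n : ℤ, a n * Complex.exp (2 * Real.pi * Complex.I * n * s) := by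
  refine continuous_tsum (fun n => by fun_prop) ha fun n s => ?_
  rw [norm_mul, norm_exp_two_pi_int, mul_one]

/-- Termwise integration of an absolutely convergent Fourier series against a bounded function. -/
theorem integral_fourier_mul {a : ℤ → ℂ} (ha : Summable fun n => ‖a n‖) {h : ℝ → ℂ}
    (hh : Continuous h) {B : ℝ} (hB : ∀ s, ‖h s‖ ≤ B) :
    HasSum (fun n : ℤ => a n * ∫ s in (0 : ℝ)..1, Complex.exp (2 * Real.pi * Complex.I * n * s) * h s)
      (∫ s in (0 : ℝ)..1, (∑' n : ℤ, a n * Complex.exp (2 * Real.pi * Complex.I * n * s)) * h s) := by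
  have := intervalIntegral.hasSum_integral_of_dominated_convergence (μ := volume) (a := 0) (b := 1)
    (F := fun (n : ℤ) (s : ℝ) => a n * Complex.exp (2 * Real.pi * Complex.I * n * s) * h s)
    (f := fun s : ℝ => (∑' n : ℤ, a n * Complex.exp (2 * Real.pi * Complex.I * n * s)) * h s)
    (fun n _ => ‖a n‖ * B) (fun n => by
      exact (by fun_prop : Continuous fun s : ℝ =>
        a n * Complex.exp (2 * Real.pi * Complex.I * n * s) * h s).aestronglyMeasurable)
    (fun n => Filter.Eventually.of_forall fun s _ => by
      rw [norm_mul, norm_mul, norm_exp_two_pi_int, mul_one]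
      gcongr
      exact hB s)
    (Filter.Eventually.of_forall fun s _ => ha.mul_right B)
    (by simp)
    (Filter.Eventually.of_forall fun s _ =>
      (summable_fourier ha s).of_norm.hasSum.mul_right (h s))
  simpa only [mul_assoc, intervalIntegral.integral_const_mul] using this

/-- Parseval's identity for an absolutely convergent Fourier series. -/
theorem integral_norm_sq_fourier {a : ℤ → ℂ} (ha : Summable fun n => ‖a n‖) :
    ∫ s in (0 : ℝ)..1, ‖∑' n : ℤ, a n * Complex.exp (2 * Real.pi * Complex.I * n * s)‖ ^ 2
      = ∑' n, ‖a n‖ ^ 2 := by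
  set v : ℝ → ℂ := fun s => ∑' n : ℤ, a n * Complex.exp (2 * Real.pi * Complex.I * n * s) with hv
  have hvc : Continuous v := continuous_fourier ha
  have hvB : ∀ s, ‖v s‖ ≤ ∑' n, ‖a n‖ := fun s => by
    refine (norm_tsum_le_tsum_norm (summable_fourier ha s)).trans (le_of_eq ?_)
    simp only [norm_mul, norm_exp_two_pi_int, mul_one]
  have hcoef : ∀ m : ℤ, ∫ s in (0 : ℝ)..1, Complex.exp (2 * Real.pi * Complex.I * m * s)
      * (starRingEnd ℂ) (v s) = (starRingEnd ℂ) (a m) := by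
    intro m
    have h1 := (integral_fourier_mul ha
      (h := fun s => Complex.exp (2 * Real.pi * Complex.I * (-m : ℤ) * s)) (by fun_prop) (B := 1)
      (fun s => (norm_exp_two_pi_int _ s).le)).tsum_eq
    have h2 : ∀ n : ℤ, a n * ∫ s in (0 : ℝ)..1, Complex.exp (2 * Real.pi * Complex.I * n * s)
        * Complex.exp (2 * Real.pi * Complex.I * (-m : ℤ) * s) = if n = m then a m else 0 := by
      intro n
      have : ∀ s : ℝ, Complex.exp (2 * Real.pi * Complex.I * n * s)
          * Complex.exp (2 * Real.pi * Complex.I * (-m : ℤ) * s)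
          = Complex.exp (2 * Real.pi * Complex.I * (n - m : ℤ) * s) := fun s => by
        rw [← Complex.exp_add]
        congr 1
        push_cast
        ring
      simp only [this]
      rw [integral_exp_two_pi_int]
      by_cases h : n = m
      · simp [h]
      · simp [h, sub_ne_zero.2 h]
    simp only [h2, tsum_ite_eq] at h1
    rw [h1, intervalIntegral.integral_of_le zero_le_one, intervalIntegral.integral_of_le zero_le_one,
      ← integral_conj]
    congr 1
    ext s
    rw [map_mul, mul_comm, ← Complex.exp_conj]
    simp only [hv]
    congr 2
    simp only [map_mul, Complex.conj_I, Complex.conj_ofReal, map_ofNat, map_intCast]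
    push_cast
    ring
  have h3 := (integral_fourier_mul ha (h := fun s => (starRingEnd ℂ) (v s)) (by fun_prop)
    (B := ∑' n, ‖a n‖) (fun s => by simpa using hvB s)).tsum_eq
  simp only [hcoef] at h3
  have h4 : ∀ s, v s * (starRingEnd ℂ) (v s) = ((‖v s‖ ^ 2 : ℝ) : ℂ) := fun s => by
    rw [Complex.mul_conj, Complex.normSq_eq_norm_sq]
  have h5 : ∀ n, a n * (starRingEnd ℂ) (a n) = ((‖a n‖ ^ 2 : ℝ) : ℂ) := fun s => by
    rw [Complex.mul_conj, Complex.normSq_eq_norm_sq]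
  change _ = ∫ s in (0 : ℝ)..1, v s * (starRingEnd ℂ) (v s) at h3
  simp only [h4, h5] at h3
  rw [intervalIntegral.integral_ofReal, ← Complex.ofReal_tsum] at h3
  exact Complex.ofReal_injective h3.symm

/-- Integrating the periodization of a function over a period. -/
theorem integral_tsum_comp_add_int {φ : ℝ → ℝ} (hφ : Integrable φ) :
    ∫ t in (0 : ℝ)..1, ∑' n : ℤ, φ (t + n) = ∫ t, φ t := by
  have h1 := hφ.norm.hasSum_intervalIntegral_comp_add_int
  have h2 := hφ.hasSum_intervalIntegral_comp_add_int
  simp only [intervalIntegral.integral_of_le zero_le_one] at h1 h2 ⊢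
  exact (hasSum_integral_of_summable_integral_norm
    (fun n : ℤ => (hφ.comp_add_right (n : ℝ)).restrict) h1.summable).unique h2


/-! ### The theta series: holomorphy, periodicity of the modulus, boundedness. -/

/-- The Fourier coefficients of `s ↦ u_τ` along the first period, up to a phase. -/
noncomputable def thetaCoeff (τ : ℂ) (t : ℝ) (n : ℤ) : ℂ :=
  (-1) ^ n * Complex.exp (Complex.I * Real.pi * τ * ((n : ℂ) + 1 / 2 + t) ^ 2)

/-- `u_τ` in lattice coordinates, up to a phase. -/
noncomputable def thetaSeries (τ : ℂ) (s t : ℝ) : ℂ :=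
  ∑' n : ℤ, thetaCoeff τ t n * Complex.exp (2 * Real.pi * Complex.I * n * s)

/-- Lattice coordinates. -/
noncomputable def cellMap (τ : ℂ) (s t : ℝ) : ℂ := (s + t * τ) / (√τ.im : ℝ)

theorem neg_one_zpow_eq_exp (n : ℤ) : (-1 : ℂ) ^ n = Complex.exp (n * (Real.pi * Complex.I)) := by
  rw [Complex.exp_int_mul, Complex.exp_pi_mul_I]

/-- Expanding the square in the exponent produces a term of the Jacobi theta series, whose
summability transfers. -/
theorem thetaCoeff_mul_exp (τ : ℂ) (s t : ℝ) (n : ℤ) :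
    thetaCoeff τ t n * Complex.exp (2 * Real.pi * Complex.I * n * s) =
      Complex.exp (Complex.I * Real.pi * τ * (1 / 2 + t) ^ 2)
        * jacobiTheta₂_term n (s + τ * (1 / 2 + t) + 1 / 2) τ := by
  rw [thetaCoeff, jacobiTheta₂_term, neg_one_zpow_eq_exp, ← Complex.exp_add, ← Complex.exp_add,
    ← Complex.exp_add]
  congr 1
  ring

theorem norm_thetaCoeff (τ : ℂ) (t : ℝ) (n : ℤ) :
    ‖thetaCoeff τ t n‖ = Real.exp (-(Real.pi * τ.im * (n + 1 / 2 + t) ^ 2)) := by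
  rw [thetaCoeff, norm_mul, norm_zpow, norm_neg, norm_one, one_zpow, one_mul, Complex.norm_exp]
  congr 1
  have : ((n : ℂ) + 1 / 2 + t) = ((n + 1 / 2 + t : ℝ) : ℂ) := by push_cast; rfl
  rw [this, ← Complex.ofReal_pow, Complex.re_mul_ofReal]
  simp

theorem summable_norm_thetaCoeff {τ : ℂ} (hτ : 0 < τ.im) (t : ℝ) :
    Summable fun n => ‖thetaCoeff τ t n‖ := by
  have h := ((summable_jacobiTheta₂_term_iff (((0 : ℝ) : ℂ) + τ * (1 / 2 + t) + 1 / 2) τ).2 hτ).mul_left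
    (Complex.exp (Complex.I * Real.pi * τ * (1 / 2 + t) ^ 2))
  simp only [← thetaCoeff_mul_exp] at h
  simpa using h.norm

theorem Theta_eq (z τ : ℂ) : Theta z τ = 1 / Complex.I *
    (Complex.exp (Complex.I * Real.pi * τ / 4 + Real.pi * Complex.I * z)
      * jacobiTheta₂ (z + τ / 2 + 1 / 2) τ) := by
  rw [Theta, jacobiTheta₂]
  simp only [← tsum_mul_left]
  refine tsum_congr fun n => congrArg (fun x => 1 / Complex.I * x) ?_
  rw [jacobiTheta₂_term, neg_one_zpow_eq_exp, ← Complex.exp_add, ← Complex.exp_add,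
    ← Complex.exp_add]
  congr 1
  ring

theorem differentiable_Theta {τ : ℂ} (hτ : 0 < τ.im) : Differentiable ℂ fun z => Theta z τ := by
  simp only [Theta_eq]
  have h : Differentiable ℂ fun z => jacobiTheta₂ z τ := fun z =>
    differentiableAt_jacobiTheta₂_fst z hτ
  have h2 : Differentiable ℂ fun z => jacobiTheta₂ (z + τ / 2 + 1 / 2) τ :=
    h.comp (by fun_prop : Differentiable ℂ fun z : ℂ => z + τ / 2 + 1 / 2)
  fun_prop

/-- The entire factor of `u_τ`. -/
noncomputable def uTauEntire (τ z : ℂ) : ℂ :=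
  Complex.exp ((Real.pi : ℂ) / 2 * z ^ 2) * Theta ((√τ.im : ℝ) * z) τ

theorem differentiable_uTauEntire {τ : ℂ} (hτ : 0 < τ.im) : Differentiable ℂ (uTauEntire τ) := by
  have h : Differentiable ℂ fun z => Theta ((√τ.im : ℝ) * z) τ :=
    (differentiable_Theta hτ).comp (by fun_prop : Differentiable ℂ fun z : ℂ => (√τ.im : ℝ) * z)
  unfold uTauEntire
  fun_prop

theorem uTau_eq (τ z : ℂ) :
    uTau τ z = uTauEntire τ z * Complex.exp (-(Real.pi / 2 * ‖z‖ ^ 2 : ℝ)) := by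
  rw [uTau, uTauEntire, mul_right_comm, ← Complex.exp_add]
  congr 2
  push_cast
  ring

theorem continuous_uTau {τ : ℂ} (hτ : 0 < τ.im) : Continuous (uTau τ) := by
  have h : uTau τ = fun z => uTauEntire τ z * Complex.exp (-(Real.pi / 2 * ‖z‖ ^ 2 : ℝ)) :=
    funext (uTau_eq τ)
  rw [h]
  have := (differentiable_uTauEntire hτ).continuous
  fun_prop

/-- Completing the square in the theta exponents leaves a factor of modulus `exp(π t² Im τ)`. The
prefactor of `u_τ` has modulus `exp(-π (Im z)²)` with `Im z = t √(Im τ)`, so the two cancel. -/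
theorem norm_uTau_cellMap {τ : ℂ} (hτ : 0 < τ.im) (s t : ℝ) :
    ‖uTau τ (cellMap τ s t)‖ = ‖thetaSeries τ s t‖ := by
  have hs : ((√τ.im : ℝ) : ℂ) ≠ 0 := by
    exact_mod_cast (Real.sqrt_pos.2 hτ).ne'
  have h1 : Theta ((√τ.im : ℝ) * cellMap τ s t) τ = 1 / Complex.I *
      (Complex.exp (Real.pi * Complex.I * s - Complex.I * Real.pi * τ * (t : ℂ) ^ 2)
        * thetaSeries τ s t) := by
    rw [cellMap, mul_div_cancel₀ _ hs, Theta, thetaSeries]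
    simp only [← tsum_mul_left]
    refine tsum_congr fun n => congrArg (fun x => 1 / Complex.I * x) ?_
    rw [thetaCoeff, neg_one_zpow_eq_exp, ← Complex.exp_add, ← Complex.exp_add,
      ← Complex.exp_add, ← Complex.exp_add, ← Complex.exp_add]
    congr 1
    ring
  rw [uTau, h1]
  simp only [norm_mul, Complex.norm_exp, norm_div, norm_one, Complex.norm_I, div_one, one_mul]
  rw [← mul_assoc, ← Real.exp_add]
  have h2 : cellMap τ s t ^ 2 = (s + t * τ) ^ 2 / (τ.im : ℝ) := by
    rw [cellMap, div_pow, ← Complex.ofReal_pow, Real.sq_sqrt hτ.le]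
  have h3 : ‖cellMap τ s t‖ ^ 2 = ((s + t * τ.re) ^ 2 + (t * τ.im) ^ 2) / τ.im := by
    rw [cellMap, norm_div, div_pow, Complex.norm_real, Real.norm_of_nonneg (Real.sqrt_nonneg _),
      Real.sq_sqrt hτ.le, ← Complex.normSq_eq_norm_sq, Complex.normSq_apply]
    simp
    ring
  have h4 : ((Real.pi : ℂ) / 2 * (cellMap τ s t ^ 2 - ((‖cellMap τ s t‖ ^ 2 : ℝ) : ℂ))).re
      + (Real.pi * Complex.I * s - Complex.I * Real.pi * τ * (t : ℂ) ^ 2).re = 0 := by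
    rw [h2, h3]
    have e1 : ((Real.pi : ℂ) / 2) = ((Real.pi / 2 : ℝ) : ℂ) := by push_cast; rfl
    rw [e1, Complex.re_ofReal_mul, Complex.sub_re, Complex.div_ofReal_re, Complex.ofReal_re,
      ← Complex.ofReal_pow]
    simp [pow_two]
    field_simp
    ring
  rw [h4]
  simp

theorem thetaSeries_add_left (τ : ℂ) (s t : ℝ) : thetaSeries τ (s + 1) t = thetaSeries τ s t := by
  unfold thetaSeries
  congr 1
  ext n
  congr 1
  rw [Complex.exp_eq_exp_iff_exists_int]
  exact ⟨n, by push_cast; ring⟩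

/-- Raising `t` by one amounts to a shift of the summation index, at the price of a phase. -/
theorem norm_thetaSeries_add_right (τ : ℂ) (s t : ℝ) :
    ‖thetaSeries τ s (t + 1)‖ = ‖thetaSeries τ s t‖ := by
  have h : thetaSeries τ s t
      = -Complex.exp (2 * Real.pi * Complex.I * s) * thetaSeries τ s (t + 1) := by
    unfold thetaSeries
    rw [← tsum_mul_left, ← (Equiv.addRight (1 : ℤ)).tsum_eq]
    congr 1
    ext n
    simp only [thetaCoeff, Equiv.coe_addRight]
    rw [zpow_add₀ (by norm_num), zpow_one]
    have : Complex.exp (2 * Real.pi * Complex.I * ((n + 1 : ℤ) : ℂ) * s)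
        = Complex.exp (2 * Real.pi * Complex.I * s) * Complex.exp (2 * Real.pi * Complex.I * n * s) := by
      rw [← Complex.exp_add]
      congr 1
      push_cast
      ring
    rw [this]
    push_cast
    have e : ((n : ℂ) + 1 + 1 / 2 + t) = ((n : ℂ) + 1 / 2 + (t + 1)) := by ring
    rw [e]
    ring
  rw [h, norm_mul, norm_neg, Complex.norm_exp]
  simp

theorem continuous_cellMap (τ : ℂ) : Continuous fun p : ℝ × ℝ => cellMap τ p.1 p.2 := by
  unfold cellMap
  fun_prop

theorem cellMap_surjective {τ : ℂ} (hτ : 0 < τ.im) (z : ℂ) : ∃ s t : ℝ, z = cellMap τ s t := by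
  have hs : ((√τ.im : ℝ) : ℂ) ≠ 0 := by
    exact_mod_cast (Real.sqrt_pos.2 hτ).ne'
  refine ⟨√τ.im * z.re - √τ.im * z.im / τ.im * τ.re, √τ.im * z.im / τ.im, ?_⟩
  rw [cellMap, eq_div_iff hs]
  apply Complex.ext <;> simp <;> field_simp

/-- `|u_τ|` is bounded. -/
theorem exists_norm_uTau_le {τ : ℂ} (hτ : 0 < τ.im) : ∃ B : ℝ, 0 < B ∧ ∀ z, ‖uTau τ z‖ ≤ B := by
  have hc : Continuous fun p : ℝ × ℝ => ‖thetaSeries τ p.1 p.2‖ := by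
    simp only [← norm_uTau_cellMap hτ]
    exact ((continuous_uTau hτ).comp (continuous_cellMap τ)).norm
  obtain ⟨B, hB⟩ := (isCompact_Icc (a := (0 : ℝ × ℝ)) (b := 1)).bddAbove_image hc.continuousOn
  refine ⟨max B 1, by positivity, fun z => ?_⟩
  obtain ⟨s, t, rfl⟩ := cellMap_surjective hτ z
  rw [norm_uTau_cellMap hτ]
  have p1 : Function.Periodic (fun s => thetaSeries τ s t) 1 := fun s => thetaSeries_add_left τ s t
  have p2 : Function.Periodic (fun t => ‖thetaSeries τ (Int.fract s) t‖) 1 := fun t =>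
    norm_thetaSeries_add_right τ _ t
  have e1 : thetaSeries τ s t = thetaSeries τ (Int.fract s) t := by
    have := (p1.int_mul ⌊s⌋).sub_eq s
    rw [mul_one] at this
    exact this.symm
  have e2 : ‖thetaSeries τ (Int.fract s) t‖ = ‖thetaSeries τ (Int.fract s) (Int.fract t)‖ := by
    have := (p2.int_mul ⌊t⌋).sub_eq t
    rw [mul_one] at this
    exact this.symm
  rw [e1, e2]
  refine le_max_of_le_left (hB ⟨(Int.fract s, Int.fract t), ⟨⟨?_, ?_⟩, ?_, ?_⟩, rfl⟩)
  · exact Int.fract_nonneg s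
  · exact Int.fract_nonneg t
  · exact (Int.fract_lt_one s).le
  · exact (Int.fract_lt_one t).le


/-! ### Linear changes of variables and means over a period cell. -/

/-- The real linear map of the plane with columns `a` and `c`. -/
noncomputable def realLin (a c : ℂ) : ℂ →ₗ[ℝ] ℂ where
  toFun z := z.re * a + z.im * c
  map_add' z w := by push_cast [Complex.add_re, Complex.add_im]; ring
  map_smul' r z := by simp; ring

theorem realLin_apply (a c z : ℂ) : realLin a c z = z.re * a + z.im * c := rfl

theorem continuous_realLin (a c : ℂ) : Continuous (realLin a c) :=
  (realLin a c).continuous_of_finiteDimensional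

theorem det_realLin (a c : ℂ) : LinearMap.det (realLin a c) = a.re * c.im - c.re * a.im := by
  rw [← LinearMap.det_toMatrix Complex.basisOneI, Matrix.det_fin_two]
  simp [LinearMap.toMatrix_apply, realLin_apply]

theorem map_realLin {a c : ℂ} (h : a.re * c.im - c.re * a.im ≠ 0) :
    Measure.map (realLin a c) volume
      = ENNReal.ofReal |(a.re * c.im - c.re * a.im)⁻¹| • (volume : Measure ℂ) := by
  rw [Measure.map_linearMap_addHaar_eq_smul_addHaar _ (by rwa [det_realLin]), det_realLin]

/-- The division by `√(Im τ)` is exactly what gives the period cell area one. -/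
theorem measurePreserving_cellMap {τ : ℂ} (hτ : 0 < τ.im) :
    MeasurePreserving (fun p : ℝ × ℝ => cellMap τ p.1 p.2) := by
  have hs : √τ.im ≠ 0 := (Real.sqrt_pos.2 hτ).ne'
  have hd : ((1 / (√τ.im : ℝ) : ℂ).re * (τ / (√τ.im : ℝ) : ℂ).im
      - (τ / (√τ.im : ℝ) : ℂ).re * (1 / (√τ.im : ℝ) : ℂ).im) = 1 := by
    have e : (1 / (√τ.im : ℝ) : ℂ) = ((1 / √τ.im : ℝ) : ℂ) := by push_cast; rfl
    rw [e, Complex.ofReal_re, Complex.ofReal_im, Complex.div_ofReal_im, mul_zero, sub_zero,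
      div_mul_div_comm, Real.mul_self_sqrt hτ.le, one_mul, div_self hτ.ne']
  have h1 : MeasurePreserving (realLin (1 / (√τ.im : ℝ)) (τ / (√τ.im : ℝ))) := by
    refine ⟨(continuous_realLin _ _).measurable, ?_⟩
    rw [map_realLin (by rw [hd]; norm_num), hd]
    simp
  have h2 := h1.comp Complex.volume_preserving_equiv_real_prod.symm
  convert h2 using 1
  ext p
  simp only [Function.comp, realLin_apply, Complex.measurableEquivRealProd_symm_apply, cellMap]
  ring

theorem cellMap_injective {τ : ℂ} (hτ : 0 < τ.im) :
    Function.Injective (fun p : ℝ × ℝ => cellMap τ p.1 p.2) := by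
  have hs : ((√τ.im : ℝ) : ℂ) ≠ 0 := by
    exact_mod_cast (Real.sqrt_pos.2 hτ).ne'
  rintro ⟨s, t⟩ ⟨s', t'⟩ h
  simp only [cellMap] at h
  rw [div_left_inj' hs] at h
  have him := congrArg Complex.im h
  have hre := congrArg Complex.re h
  simp at him hre
  have ht : t = t' := by
    rcases him with h | h
    · exact h
    · exact absurd h hτ.ne'
  subst ht
  simp at hre
  simp [hre]

theorem cell_eq_image (τ : ℂ) :
    cell τ = (fun p : ℝ × ℝ => cellMap τ p.1 p.2) '' (Set.Ico 0 1 ×ˢ Set.Ico 0 1) := by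
  ext z
  simp only [cell, cellMap, Set.mem_ofPred_eq, Set.mem_image, Set.mem_prod, Prod.exists]
  constructor
  · rintro ⟨s, hs, t, ht, rfl⟩
    exact ⟨s, t, ⟨hs, ht⟩, rfl⟩
  · rintro ⟨s, t, ⟨hs, ht⟩, rfl⟩
    exact ⟨s, hs, t, ht, rfl⟩

theorem measurableEmbedding_cellMap {τ : ℂ} (hτ : 0 < τ.im) :
    MeasurableEmbedding (fun p : ℝ × ℝ => cellMap τ p.1 p.2) :=
  (continuous_cellMap τ).measurableEmbedding (cellMap_injective hτ)

theorem volume_cell {τ : ℂ} (hτ : 0 < τ.im) : volume (cell τ) = 1 := by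
  rw [cell_eq_image, ← (measurePreserving_cellMap hτ).measure_preimage_emb
    (measurableEmbedding_cellMap hτ), Set.preimage_image_eq _ (cellMap_injective hτ),
    Measure.volume_eq_prod, Measure.prod_prod]
  simp

/-- Means over a period cell in lattice coordinates. -/
theorem setAverage_cell {τ : ℂ} (hτ : 0 < τ.im) {F : ℂ → ℝ} (hF : Continuous F) :
    ⨍ z in cell τ, F z = ∫ t in (0 : ℝ)..1, ∫ s in (0 : ℝ)..1, F (cellMap τ s t) := by
  rw [setAverage_eq, Measure.real, volume_cell hτ]
  simp only [ENNReal.toReal_one, inv_one, one_smul]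
  rw [cell_eq_image, (measurePreserving_cellMap hτ).setIntegral_image_emb
    (measurableEmbedding_cellMap hτ), Measure.volume_eq_prod, ← Measure.prod_restrict,
    integral_prod_symm]
  · simp only [intervalIntegral.integral_of_le zero_le_one, integral_Ico_eq_integral_Ioc]
  · rw [Measure.prod_restrict]
    have h : Continuous fun p : ℝ × ℝ => F (cellMap τ p.1 p.2) := hF.comp (continuous_cellMap τ)
    exact (h.continuousOn.integrableOn_compact (isCompact_Icc.prod isCompact_Icc)).mono_set
      (Set.prod_mono Set.Ico_subset_Icc_self Set.Ico_subset_Icc_self)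

/-! ### The ratio `γ(τ)` in terms of theta constants. -/

theorem integrable_gaussian_shift {a : ℝ} (ha : 0 < a) (c : ℝ) :
    Integrable fun x : ℝ => Real.exp (-(a * (x + c) ^ 2)) := by
  have := (integrable_exp_neg_mul_sq ha).comp_add_right c
  simpa only [neg_mul] using this

theorem integral_gaussian_shift (a c : ℝ) :
    ∫ x : ℝ, Real.exp (-(a * (x + c) ^ 2)) = √(Real.pi / a) := by
  rw [← integral_gaussian a, ← integral_add_right_eq_self (fun x : ℝ => Real.exp (-a * x ^ 2)) c]
  simp only [neg_mul]

/-- Parseval in `s` leaves a sum of integer translates of one Gaussian in `t`; integrating over a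
period unfolds it to a Gaussian integral on the line. -/
theorem integral_norm_thetaSeries_sq {τ : ℂ} (hτ : 0 < τ.im) :
    ∫ t in (0 : ℝ)..1, ∫ s in (0 : ℝ)..1, ‖thetaSeries τ s t‖ ^ 2 = √(1 / (2 * τ.im)) := by
  have h : ∀ t : ℝ, ∫ s in (0 : ℝ)..1, ‖thetaSeries τ s t‖ ^ 2
      = ∑' n : ℤ, Real.exp (-(2 * Real.pi * τ.im * ((t + n) + 1 / 2) ^ 2)) := by
    intro t
    unfold thetaSeries
    rw [integral_norm_sq_fourier (summable_norm_thetaCoeff hτ t)]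
    refine tsum_congr fun n => ?_
    rw [norm_thetaCoeff, ← Real.exp_nat_mul]
    congr 1
    push_cast
    ring
  simp only [h]
  rw [integral_tsum_comp_add_int (φ := fun x => Real.exp (-(2 * Real.pi * τ.im * (x + 1 / 2) ^ 2)))
    (integrable_gaussian_shift (by positivity) _), integral_gaussian_shift]
  congr 1
  have := Real.pi_ne_zero
  field_simp

/-- The constant `∑ₙ exp(2πiτ(n + r/2)²)`. -/
noncomputable def thetaConst (τ : ℂ) (r : ℤ) : ℂ :=
  ∑' n : ℤ, Complex.exp (Complex.I * Real.pi * τ * (2 * n - r) ^ 2 / 2)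

theorem thetaConst_add_two (τ : ℂ) (r : ℤ) : thetaConst τ (r + 2) = thetaConst τ r := by
  unfold thetaConst
  rw [← (Equiv.addRight (1 : ℤ)).tsum_eq]
  refine tsum_congr fun n => ?_
  simp only [Equiv.coe_addRight]
  congr 2
  push_cast
  ring

/-- The Fourier coefficients of `u_τ²`. -/
noncomputable def thetaSqCoeff (τ : ℂ) (t : ℝ) (k : ℤ) : ℂ :=
  ∑' n : ℤ, thetaCoeff τ t n * thetaCoeff τ t (k - n)

/-- By `x² + y² = (x + y)²/2 + (x - y)²/2`, with `x + y = 2t + k + 1` and `x - y = 2n - k`, the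
dependence on `t` factors out of the sum over `n`. The remaining sum depends only on the parity of
`k`. -/
theorem norm_thetaSqCoeff (τ : ℂ) (t : ℝ) (k : ℤ) : ‖thetaSqCoeff τ t k‖ =
    Real.exp (-(Real.pi * τ.im / 2 * (2 * t + (k + 1)) ^ 2)) * ‖thetaConst τ k‖ := by
  have h : thetaSqCoeff τ t k = ((-1) ^ k *
      Complex.exp (Complex.I * Real.pi * τ / 2 * (2 * t + (k + 1)) ^ 2)) * thetaConst τ k := by
    unfold thetaSqCoeff thetaConst
    rw [← tsum_mul_left]
    refine tsum_congr fun n => ?_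
    simp only [thetaCoeff]
    have e : (-1 : ℂ) ^ k = (-1) ^ n * (-1) ^ (k - n) := by
      rw [← zpow_add₀ (by norm_num)]
      congr 1
      ring
    rw [e, mul_mul_mul_comm, ← Complex.exp_add, mul_assoc _ (Complex.exp _), ← Complex.exp_add]
    congr 2
    push_cast
    ring
  have e : (2 * (t : ℂ) + (k + 1)) = ((2 * t + (k + 1) : ℝ) : ℂ) := by push_cast; rfl
  rw [h, norm_mul, norm_mul, norm_zpow, norm_neg, norm_one, one_zpow, one_mul, Complex.norm_exp, e,
    ← Complex.ofReal_pow, Complex.re_mul_ofReal]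
  congr 2
  have e2 : Complex.I * Real.pi * τ / 2 = ((Real.pi / 2 : ℝ) : ℂ) * (Complex.I * τ) := by
    push_cast
    ring
  have e3 : (Complex.I * τ).re = -τ.im := by simp
  rw [e2, Complex.re_ofReal_mul, e3]
  ring

theorem summable_thetaCoeff_mul {τ : ℂ} (hτ : 0 < τ.im) (t : ℝ) :
    Summable fun p : ℤ × ℤ => ‖thetaCoeff τ t p.2 * thetaCoeff τ t (p.1 - p.2)‖ := by
  have h := (summable_norm_thetaCoeff hτ t).mul_norm (summable_norm_thetaCoeff hτ t)
  let e : ℤ × ℤ ≃ ℤ × ℤ :=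
    { toFun := fun p => (p.2, p.1 - p.2)
      invFun := fun q => (q.1 + q.2, q.1)
      left_inv := fun p => by simp
      right_inv := fun q => by simp }
  exact (e.summable_iff (f := fun q : ℤ × ℤ => ‖thetaCoeff τ t q.1 * thetaCoeff τ t q.2‖)).2 h

theorem summable_norm_thetaSqCoeff {τ : ℂ} (hτ : 0 < τ.im) (t : ℝ) :
    Summable fun k => ‖thetaSqCoeff τ t k‖ := by
  have h := summable_thetaCoeff_mul hτ t
  refine Summable.of_nonneg_of_le (fun k => norm_nonneg _) (fun k => ?_) h.prod
  exact norm_tsum_le_tsum_norm (h.prod_factor k)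

theorem thetaSeries_sq {τ : ℂ} (hτ : 0 < τ.im) (s t : ℝ) : thetaSeries τ s t ^ 2 =
    ∑' k : ℤ, thetaSqCoeff τ t k * Complex.exp (2 * Real.pi * Complex.I * k * s) := by
  have ha := summable_fourier (summable_norm_thetaCoeff hτ t) s
  let e : ℤ × ℤ ≃ ℤ × ℤ :=
    { toFun := fun p => (p.2, p.1 - p.2)
      invFun := fun q => (q.1 + q.2, q.1)
      left_inv := fun p => by simp
      right_inv := fun q => by simp }
  have hsum := (e.summable_iff).2 (ha.mul_norm ha).of_norm
  rw [pow_two, thetaSeries, tsum_mul_tsum_of_summable_norm ha ha, ← e.tsum_eq]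
  refine (Summable.tsum_prod hsum).trans ?_
  refine tsum_congr fun k => ?_
  rw [thetaSqCoeff, ← tsum_mul_right]
  refine tsum_congr fun n => ?_
  simp only [e, Equiv.coe_fn_mk, Function.comp]
  rw [mul_mul_mul_comm, ← Complex.exp_add]
  congr 2
  push_cast
  ring

theorem integral_norm_thetaSeries_pow_four {τ : ℂ} (hτ : 0 < τ.im) :
    ∫ t in (0 : ℝ)..1, ∫ s in (0 : ℝ)..1, ‖thetaSeries τ s t‖ ^ 4
      = √(1 / (4 * τ.im)) * (‖thetaConst τ 0‖ ^ 2 + ‖thetaConst τ 1‖ ^ 2) := by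
  -- The two terms collect the even and the odd frequencies `k` in Parseval's identity for the
  -- square of the series; the factor `4` comes from `2t + k + 1 = 2 (t + (k + 1)/2)`.
  set φ : ℝ → ℝ := fun x => Real.exp (-(4 * Real.pi * τ.im * (x + 1 / 2) ^ 2))
    * ‖thetaConst τ 0‖ ^ 2 + Real.exp (-(4 * Real.pi * τ.im * (x + 1) ^ 2)) * ‖thetaConst τ 1‖ ^ 2
    with hφ
  have hpar : ∀ j : ℤ, thetaConst τ (2 * j) = thetaConst τ 0 ∧
      thetaConst τ (2 * j + 1) = thetaConst τ 1 := by
    have hper : Function.Periodic (thetaConst τ) 2 := thetaConst_add_two τ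
    intro j
    constructor
    · have := hper.int_mul j 0
      rw [mul_comm, ← this]
      simp
    · have := hper.int_mul j 1
      rw [mul_comm, ← this]
      simp [add_comm]
  have h : ∀ t : ℝ, ∫ s in (0 : ℝ)..1, ‖thetaSeries τ s t‖ ^ 4 = ∑' n : ℤ, φ (t + n) := by
    intro t
    have h1 : ∀ s, ‖thetaSeries τ s t‖ ^ 4 = ‖thetaSeries τ s t ^ 2‖ ^ 2 := fun s => by
      rw [norm_pow, ← pow_mul]
    have hs := summable_norm_thetaSqCoeff hτ t
    have hs2 : Summable fun k => ‖thetaSqCoeff τ t k‖ ^ 2 := by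
      have := (hs.mul_norm hs)
      have h2 := this.comp_injective (i := fun k : ℤ => (k, k)) (fun a c hac => (Prod.ext_iff.1 hac).1)
      simpa [Function.comp_def, pow_two] using h2
    simp only [h1, thetaSeries_sq hτ]
    rw [integral_norm_sq_fourier hs, ← (Int.divModEquiv 2).symm.tsum_eq, Summable.tsum_prod]
    · refine tsum_congr fun j => ?_
      rw [tsum_fintype, Fin.sum_univ_two]
      simp only [hφ]
      have e0 : (Int.divModEquiv 2).symm (j, (0 : Fin 2)) = 2 * j := by
        simp [Int.divModEquiv, mul_comm]
      have e1 : (Int.divModEquiv 2).symm (j, (1 : Fin 2)) = 2 * j + 1 := by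
        simp [Int.divModEquiv, mul_comm]
      rw [e0, e1, norm_thetaSqCoeff, norm_thetaSqCoeff, (hpar j).1, (hpar j).2, mul_pow, mul_pow,
        ← Real.exp_nat_mul, ← Real.exp_nat_mul]
      congr 3 <;> push_cast <;> ring
    · exact ((Int.divModEquiv 2).symm.summable_iff).2 hs2
  have hi : ∀ c, Integrable fun x : ℝ => Real.exp (-(4 * Real.pi * τ.im * (x + c) ^ 2)) := fun c =>
    integrable_gaussian_shift (by positivity) c
  simp only [h]
  have hφi : Integrable φ := ((hi _).mul_const _).add ((hi _).mul_const _)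
  rw [integral_tsum_comp_add_int hφi, hφ,
    integral_add ((hi _).mul_const _) ((hi _).mul_const _), integral_mul_const, integral_mul_const,
    integral_gaussian_shift, integral_gaussian_shift]
  have e : Real.pi / (4 * Real.pi * τ.im) = 1 / (4 * τ.im) := by
    have := Real.pi_ne_zero
    field_simp
  rw [e]
  ring

/-- The mean of `|u_τ|²` over a period cell. -/
theorem setAverage_norm_uTau_sq {τ : ℂ} (hτ : 0 < τ.im) :
    ⨍ z in cell τ, ‖uTau τ z‖ ^ 2 = √(1 / (2 * τ.im)) := by
  rw [setAverage_cell hτ (F := fun z => ‖uTau τ z‖ ^ 2) ((continuous_uTau hτ).norm.pow 2)]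
  simp only [norm_uTau_cellMap hτ]
  exact integral_norm_thetaSeries_sq hτ

theorem gammaTau_eq {τ : ℂ} (hτ : 0 < τ.im) :
    gammaTau τ = √τ.im * (‖thetaConst τ 0‖ ^ 2 + ‖thetaConst τ 1‖ ^ 2) := by
  rw [gammaTau, setAverage_norm_uTau_sq hτ, setAverage_cell hτ (F := fun z => ‖uTau τ z‖ ^ 4) ((continuous_uTau hτ).norm.pow 4)]
  simp only [norm_uTau_cellMap hτ]
  rw [integral_norm_thetaSeries_pow_four hτ, Real.sq_sqrt (by positivity)]
  have h4 : √(4 : ℝ) = 2 := by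
    rw [show (4 : ℝ) = 2 ^ 2 by norm_num, Real.sqrt_sq (by norm_num)]
  rw [Real.sqrt_div zero_le_one, Real.sqrt_mul (by norm_num), h4, Real.sqrt_one]
  have hp := Real.sqrt_pos.2 hτ
  have hsq := Real.mul_self_sqrt hτ.le
  set y := √τ.im
  rw [← hsq]
  field_simp


/-! ### Numerical evaluation of `b`. -/

/-- Truncation to `|n| ≤ 1`: each of the two tails is dominated by a geometric series. -/
theorem norm_tsum_int_sub_le {f : ℤ → ℂ} {K r : ℝ} (hr0 : 0 ≤ r) (hr1 : r < 1)
    (hp : ∀ n : ℕ, ‖f (n + 2)‖ ≤ K * r ^ n) (hm : ∀ n : ℕ, ‖f (-(n + 2))‖ ≤ K * r ^ n) :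
    ‖∑' n, f n - (f 0 + f 1 + f (-1))‖ ≤ 2 * K / (1 - r) := by
  have hg : HasSum (fun n : ℕ => K * r ^ n) (K * (1 - r)⁻¹) :=
    (hasSum_geometric_of_lt_one hr0 hr1).mul_left K
  have sp : Summable fun n : ℕ => f (n + 2) := Summable.of_norm_bounded hg.summable hp
  have sm : Summable fun n : ℕ => f (-(n + 2)) := Summable.of_norm_bounded hg.summable hm
  have bp := tsum_of_norm_bounded hg hp
  have bm := tsum_of_norm_bounded hg hm
  have h1 : HasSum (fun n : ℕ => f n) (∑' n : ℕ, f (n + 2) + (f 0 + f 1)) := by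
    have := (hasSum_nat_add_iff (f := fun n : ℕ => f n) 2).1 (by simpa using sp.hasSum)
    simpa [Finset.sum_range_succ] using this
  have h2 : HasSum (fun n : ℕ => f (-(n + 1))) (∑' n : ℕ, f (-(n + 2)) + f (-1)) := by
    have := (hasSum_nat_add_iff (f := fun n : ℕ => f (-(n + 1))) (g := ∑' n : ℕ, f (-(n + 2))) 1).1 (by
      have e : ∀ n : ℕ, -(((n + 1 : ℕ) : ℤ) + 1) = -((n : ℤ) + 2) := fun n => by push_cast; ring
      simpa only [e] using sm.hasSum)
    simpa [Finset.sum_range_succ] using this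
  rw [(h1.of_nat_of_neg_add_one h2).tsum_eq]
  have e : ∑' n : ℕ, f (n + 2) + (f 0 + f 1) + (∑' n : ℕ, f (-(n + 2)) + f (-1))
      - (f 0 + f 1 + f (-1)) = ∑' n : ℕ, f (n + 2) + ∑' n : ℕ, f (-(n + 2)) := by ring
  rw [e]
  refine (norm_add_le _ _).trans ?_
  calc _ ≤ K * (1 - r)⁻¹ + K * (1 - r)⁻¹ := add_le_add bp bm
    _ = _ := by rw [div_eq_mul_inv]; ring

theorem hexTau_eq : hexTau = ((-1 / 2 : ℝ) : ℂ) + ((√3 / 2 : ℝ) : ℂ) * Complex.I := by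
  have h : (2 * Complex.I * Real.pi / 3 : ℂ) = ((Real.pi - Real.pi / 3 : ℝ) : ℂ) * Complex.I := by
    push_cast
    ring
  rw [hexTau, h, Complex.exp_mul_I, ← Complex.ofReal_cos, ← Complex.ofReal_sin, Real.cos_pi_sub,
    Real.sin_pi_sub, Real.cos_pi_div_three, Real.sin_pi_div_three]
  norm_num

theorem hexTau_im : hexTau.im = √3 / 2 := by
  rw [hexTau_eq]
  simp

theorem hexTau_im_pos : 0 < hexTau.im := by
  rw [hexTau_im]
  positivity

/-- The square root of the modulus of the nome `exp(2πiτ)` at `τ = exp(2πi/3)`. -/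
noncomputable def hexNome : ℝ := Real.exp (-(Real.pi * √3 / 2))

/-- Because `Re τ = -1/2`, the number `exp(2πiτ)` is real and negative, so the theta constants
become, up to one factor, real series in powers of `-h²`. -/
theorem exp_hexTau : Complex.exp (2 * Real.pi * Complex.I * hexTau) = ((-(hexNome ^ 2) : ℝ) : ℂ) := by
  have h : (2 * Real.pi * Complex.I * hexTau : ℂ)
      = ((-(Real.pi * √3) : ℝ) : ℂ) - Real.pi * Complex.I := by
    rw [hexTau_eq]
    push_cast
    linear_combination (Real.pi : ℂ) * (√3 : ℝ) * Complex.I_mul_I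
  rw [h, Complex.exp_sub, Complex.exp_pi_mul_I, ← Complex.ofReal_exp, hexNome, ← Real.exp_nat_mul]
  push_cast
  rw [div_neg, div_one]
  congr 3
  ring

theorem hexNome_bounds : 0.065826 ≤ hexNome ∧ hexNome ≤ 0.065831 := by
  have h3 : 1.7320508 ≤ √3 ∧ √3 ≤ 1.7320509 := by
    constructor
    · exact Real.le_sqrt_of_sq_le (by norm_num)
    · exact Real.sqrt_le_iff.2 ⟨by norm_num, by norm_num⟩
  have hp1 := Real.pi_gt_d6
  have hp2 := Real.pi_lt_d6
  have hx1 : 2.72069 ≤ Real.pi * √3 / 2 := by nlinarith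
  have hx2 : Real.pi * √3 / 2 ≤ 2.72071 := by nlinarith
  have he1 := Real.exp_one_gt_d9
  have he2 := Real.exp_one_lt_d9
  -- Adding `3` brings the exponent `≈ -2.7207` into `[0, 1]`, where Taylor bounds apply; the cube
  -- of `e` is then divided out.
  have hsplit : ∀ y : ℝ, Real.exp y = Real.exp (y + 3) / Real.exp 1 ^ 3 := fun y => by
    rw [← Real.exp_nat_mul, ← Real.exp_sub]
    congr 1
    push_cast
    ring
  have hpos := Real.exp_pos 1
  constructor
  · have h1 : Real.exp (-2.72071) ≤ hexNome := Real.exp_le_exp.2 (by linarith)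
    refine le_trans ?_ h1
    rw [hsplit, le_div_iff₀ (by positivity)]
    have h2 := Real.sum_le_exp_of_nonneg (x := -2.72071 + 3) (by norm_num) 8
    have h4 : Real.exp 1 ^ 3 ≤ 2.7182818286 ^ 3 := by gcongr
    norm_num [Finset.sum_range_succ, Nat.factorial] at h2 h4 ⊢
    linarith
  · have h1 : hexNome ≤ Real.exp (-2.72069) := Real.exp_le_exp.2 (by linarith)
    refine le_trans h1 ?_
    rw [hsplit, div_le_iff₀ (by positivity)]
    have h2 := Real.exp_bound' (x := -2.72069 + 3) (by norm_num) (by norm_num) (n := 8) (by norm_num)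
    have h4 : 2.7182818283 ^ 3 ≤ Real.exp 1 ^ 3 := by gcongr
    norm_num [Finset.sum_range_succ, Nat.factorial] at h2 h4 ⊢
    linarith

theorem natCast_natAbs_of_nonneg {m : ℤ} (hm : 0 ≤ m) : ((m.natAbs : ℕ) : ℂ) = (m : ℂ) := by
  rw [← Int.cast_natCast, Int.natAbs_of_nonneg hm]

/-- The series is `∑ q^(n²)` with `q = -h²`: the terms `|n| ≤ 1` give `1 + 2q`, and the tail starts
at `q⁴`, of modulus `h⁸`. -/
theorem abs_norm_thetaConst_zero_sub :
    |‖thetaConst hexTau 0‖ - (1 - 2 * hexNome ^ 2)| ≤ 0.000001 := by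
  obtain ⟨hl, hu⟩ := hexNome_bounds
  set h := hexNome with hh
  have h0 : 0 ≤ h := by linarith
  set q : ℂ := ((-(h ^ 2) : ℝ) : ℂ) with hq
  have hqn : ‖q‖ = h ^ 2 := by
    rw [hq, Complex.norm_real, norm_neg, Real.norm_of_nonneg (by positivity)]
  have hterm : ∀ n : ℤ, Complex.exp (Complex.I * Real.pi * hexTau * (2 * n - (0 : ℤ)) ^ 2 / 2)
      = q ^ (n.natAbs ^ 2) := by
    intro n
    rw [hq, ← exp_hexTau, ← Complex.exp_nat_mul]
    congr 1
    have : ((n.natAbs ^ 2 : ℕ) : ℂ) = (n : ℂ) ^ 2 := by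
      rw [← Int.natAbs_pow, natCast_natAbs_of_nonneg (sq_nonneg n)]
      push_cast
      rfl
    rw [this]
    push_cast
    ring
  have hr1 : h ^ 2 < 1 := by nlinarith
  have hb : ∀ n : ℕ, ‖q ^ ((n + 2) ^ 2)‖ ≤ h ^ 8 * (h ^ 2) ^ n := by
    intro n
    rw [norm_pow, hqn, ← pow_mul, ← pow_mul, ← pow_add]
    exact pow_le_pow_of_le_one h0 (by linarith) (by nlinarith)
  have key := norm_tsum_int_sub_le (f := fun n : ℤ => q ^ (n.natAbs ^ 2)) (K := h ^ 8) (r := h ^ 2)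
    (by positivity) hr1 (fun n => by
      simpa [show ((n : ℤ) + 2).natAbs = n + 2 by omega] using hb n)
    (fun n => by simpa [show (-2 + -(n : ℤ)).natAbs = n + 2 by omega] using hb n)
  have e1 : thetaConst hexTau 0 = ∑' n : ℤ, q ^ (n.natAbs ^ 2) := tsum_congr hterm
  rw [← e1] at key
  have e2 : q ^ ((0 : ℤ).natAbs ^ 2) + q ^ ((1 : ℤ).natAbs ^ 2) + q ^ ((-1 : ℤ).natAbs ^ 2)
      = ((1 - 2 * h ^ 2 : ℝ) : ℂ) := by
    simp [hq]
    ring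
  rw [e2] at key
  have e3 : ‖((1 - 2 * h ^ 2 : ℝ) : ℂ)‖ = 1 - 2 * h ^ 2 := by
    rw [Complex.norm_real, Real.norm_of_nonneg (by nlinarith)]
  have h8 : h ^ 8 ≤ 0.065831 ^ 8 := by gcongr
  have h2' : h ^ 2 ≤ 0.065831 ^ 2 := by gcongr
  calc _ = |‖thetaConst hexTau 0‖ - ‖((1 - 2 * h ^ 2 : ℝ) : ℂ)‖| := by rw [e3]
    _ ≤ _ := (abs_norm_sub_norm_le _ _).trans key
    _ ≤ _ := by
      rw [div_le_iff₀ (by linarith)]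
      norm_num at h8 h2' ⊢
      linarith

/-- The series is `exp(iπτ/2) ∑ q^(n(n-1))` with `q = -h²`. The prefactor has squared modulus
`hexNome`, the terms `n = 0, 1` give the main value `2`, and `n = -1` gives `h⁴`, which is absorbed
in the error. -/
theorem abs_norm_thetaConst_one_sub :
    ∃ x : ℝ, ‖thetaConst hexTau 1‖ ^ 2 = hexNome * x ^ 2 ∧ |x - 2| ≤ 0.00007 := by
  obtain ⟨hl, hu⟩ := hexNome_bounds
  set h := hexNome with hh
  have h0 : 0 ≤ h := by linarith
  set q : ℂ := ((-(h ^ 2) : ℝ) : ℂ) with hq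
  have hqn : ‖q‖ = h ^ 2 := by
    rw [hq, Complex.norm_real, norm_neg, Real.norm_of_nonneg (by positivity)]
  have hterm : ∀ n : ℤ, Complex.exp (Complex.I * Real.pi * hexTau * (2 * n - (1 : ℤ)) ^ 2 / 2)
      = Complex.exp (Complex.I * Real.pi * hexTau / 2) * q ^ ((n * (n - 1)).natAbs) := by
    intro n
    rw [hq, ← exp_hexTau, ← Complex.exp_nat_mul, ← Complex.exp_add]
    congr 1
    have hn : 0 ≤ n * (n - 1) := by
      rcases le_or_gt n 0 with h | h
      · nlinarith
      · nlinarith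
    have : (((n * (n - 1)).natAbs : ℕ) : ℂ) = (n : ℂ) * (n - 1) := by
      rw [natCast_natAbs_of_nonneg hn]
      push_cast
      rfl
    rw [this]
    push_cast
    ring
  have hr1 : h ^ 2 < 1 := by nlinarith
  have hb : ∀ n k : ℕ, n + 2 ≤ k → ‖q ^ k‖ ≤ h ^ 4 * (h ^ 2) ^ n := by
    intro n k hk
    rw [norm_pow, hqn, ← pow_mul, ← pow_mul, ← pow_add]
    exact pow_le_pow_of_le_one h0 (by linarith) (by nlinarith)
  have key := norm_tsum_int_sub_le (f := fun n : ℤ => q ^ ((n * (n - 1)).natAbs)) (K := h ^ 4)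
    (r := h ^ 2) (by positivity) hr1 (fun n => hb n _ (by
      have : 0 ≤ ((n : ℤ) + 2) * ((n : ℤ) + 2 - 1) := by nlinarith
      zify
      rw [abs_of_nonneg this]
      nlinarith))
    (fun n => hb n _ (by
      have : 0 ≤ (-((n : ℤ) + 2)) * (-((n : ℤ) + 2) - 1) := by nlinarith
      zify
      rw [abs_of_nonneg this]
      nlinarith))
  have e1 : thetaConst hexTau 1 = Complex.exp (Complex.I * Real.pi * hexTau / 2)
      * ∑' n : ℤ, q ^ ((n * (n - 1)).natAbs) := by
    rw [← tsum_mul_left]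
    exact tsum_congr hterm
  have e2 : q ^ (((0 : ℤ) * (0 - 1)).natAbs) + q ^ (((1 : ℤ) * (1 - 1)).natAbs)
      + q ^ (((-1 : ℤ) * (-1 - 1)).natAbs) = ((2 + h ^ 4 : ℝ) : ℂ) := by
    norm_num [hq]
    ring
  rw [e2] at key
  have e3 : ‖((2 + h ^ 4 : ℝ) : ℂ)‖ = 2 + h ^ 4 := by
    rw [Complex.norm_real, Real.norm_of_nonneg (by positivity)]
  have h4 : h ^ 4 ≤ 0.065831 ^ 4 := by gcongr
  have h2' : h ^ 2 ≤ 0.065831 ^ 2 := by gcongr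
  refine ⟨‖∑' n : ℤ, q ^ ((n * (n - 1)).natAbs)‖, ?_, ?_⟩
  · rw [e1, norm_mul, mul_pow, Complex.norm_exp, ← Real.exp_nat_mul]
    congr 1
    rw [hh, hexNome]
    congr 1
    have e : (Complex.I * Real.pi * hexTau / 2) = ((Real.pi / 2 : ℝ) : ℂ) * (Complex.I * hexTau) := by
      push_cast
      ring
    rw [e, Complex.re_ofReal_mul]
    simp [hexTau_im]
    ring
  · have h5 := (abs_norm_sub_norm_le _ _).trans key
    rw [e3] at h5
    have h6 : 2 * h ^ 4 / (1 - h ^ 2) ≤ 0.00004 := by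
      rw [div_le_iff₀ (by linarith)]
      norm_num at h4 h2' ⊢
      linarith
    have h7 : 0 ≤ h ^ 4 := by positivity
    rw [abs_le] at h5 ⊢
    norm_num at h4 h6 ⊢
    constructor <;> linarith [h5.1, h5.2]

theorem b_eq : b = √(√3 / 2) * (‖thetaConst hexTau 0‖ ^ 2 + ‖thetaConst hexTau 1‖ ^ 2) := by
  rw [b, gammaTau_eq hexTau_im_pos, hexTau_im]

theorem abs_b_sub_lt : |b - 1.1596| < 0.00005 := by
  obtain ⟨hl, hu⟩ := hexNome_bounds
  have h0 := abs_norm_thetaConst_zero_sub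
  obtain ⟨x, h1, hx⟩ := abs_norm_thetaConst_one_sub
  rw [b_eq, h1]
  set h := hexNome
  set p := ‖thetaConst hexTau 0‖
  have hy1 : 0.930604 ≤ √(√3 / 2) := by
    apply Real.le_sqrt_of_sq_le
    have : 1.7320508 ≤ √3 := Real.le_sqrt_of_sq_le (by norm_num)
    norm_num at this ⊢
    linarith
  have hy2 : √(√3 / 2) ≤ 0.930606 := by
    apply Real.sqrt_le_iff.2 ⟨by norm_num, ?_⟩
    have : √3 ≤ 1.7320509 := Real.sqrt_le_iff.2 ⟨by norm_num, by norm_num⟩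
    norm_num at this ⊢
    linarith
  set y := √(√3 / 2)
  have hsq1 : 0.065826 ^ 2 ≤ h ^ 2 := by gcongr
  have hsq2 : h ^ 2 ≤ 0.065831 ^ 2 := by gcongr
  rw [abs_le] at h0 hx
  have hp1 : 0.99133 ≤ p := by norm_num at h0 hsq1 hsq2 ⊢; linarith [h0.1]
  have hp2 : p ≤ 0.991336 := by norm_num at h0 hsq1 hsq2 ⊢; linarith [h0.2]
  have hx1 : 1.99993 ≤ x := by norm_num at hx ⊢; linarith [hx.1]
  have hx2 : x ≤ 2.00007 := by norm_num at hx ⊢; linarith [hx.2]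
  have A1 : 0.99133 ^ 2 + 0.065826 * 1.99993 ^ 2 ≤ p ^ 2 + h * x ^ 2 := by gcongr
  have A2 : p ^ 2 + h * x ^ 2 ≤ 0.991336 ^ 2 + 0.065831 * 2.00007 ^ 2 := by
    gcongr
  -- This lower bound evaluates to about `1.159552`, barely above the required `1.15955`; hence the
  -- number of digits kept in the inputs.
  have B1 : 0.930604 * (0.99133 ^ 2 + 0.065826 * 1.99993 ^ 2) ≤ y * (p ^ 2 + h * x ^ 2) := by
    gcongr
  have B2 : y * (p ^ 2 + h * x ^ 2) ≤ 0.930606 * (0.991336 ^ 2 + 0.065831 * 2.00007 ^ 2) := by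
    gcongr
  rw [abs_lt]
  norm_num at B1 B2 ⊢
  constructor <;> linarith


/-! ### Anisotropic scaling and translation estimates for Hölder profiles. -/

/-- The anisotropic scaling `x₁ + i x₂ ↦ x₁ / S₁ + i x₂ / S₂`. -/
noncomputable def scaleMap (S₁ S₂ : ℝ) : ℂ →ₗ[ℝ] ℂ :=
  realLin ((1 / S₁ : ℝ) : ℂ) (((1 / S₂ : ℝ) : ℂ) * Complex.I)

theorem scaleMap_re (S₁ S₂ : ℝ) (z : ℂ) : (scaleMap S₁ S₂ z).re = z.re / S₁ := by
  simp only [scaleMap, realLin_apply, Complex.add_re, Complex.re_ofReal_mul, Complex.ofReal_re,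
    Complex.I_re]
  ring

theorem scaleMap_im (S₁ S₂ : ℝ) (z : ℂ) : (scaleMap S₁ S₂ z).im = z.im / S₂ := by
  simp only [scaleMap, realLin_apply, Complex.add_im, Complex.im_ofReal_mul, Complex.ofReal_im,
    Complex.I_im]
  ring

theorem norm_scaleMap_sq (S₁ S₂ : ℝ) (z : ℂ) :
    ‖scaleMap S₁ S₂ z‖ ^ 2 = z.re ^ 2 / S₁ ^ 2 + z.im ^ 2 / S₂ ^ 2 := by
  rw [← Complex.normSq_eq_norm_sq, Complex.normSq_apply, scaleMap_re, scaleMap_im]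
  ring

theorem continuous_scaleMap (S₁ S₂ : ℝ) : Continuous (scaleMap S₁ S₂) := continuous_realLin _ _

theorem norm_scaleMap_le {S₁ S₂ : ℝ} (h2 : 0 < S₂) (h12 : S₂ ≤ S₁) (z : ℂ) :
    ‖scaleMap S₁ S₂ z‖ ≤ ‖z‖ / S₂ := by
  refine le_of_sq_le_sq ?_ (by positivity)
  rw [norm_scaleMap_sq, div_pow, ← Complex.normSq_eq_norm_sq z, Complex.normSq_apply, add_div]
  have : z.re ^ 2 / S₁ ^ 2 ≤ z.re ^ 2 / S₂ ^ 2 := by gcongr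
  simp only [← pow_two]
  linarith

theorem map_scaleMap {S₁ S₂ : ℝ} (h1 : 0 < S₁) (h2 : 0 < S₂) :
    Measure.map (scaleMap S₁ S₂) volume = ENNReal.ofReal (S₁ * S₂) • (volume : Measure ℂ) := by
  have hd : (((1 / S₁ : ℝ) : ℂ).re * (((1 / S₂ : ℝ) : ℂ) * Complex.I).im
      - (((1 / S₂ : ℝ) : ℂ) * Complex.I).re * ((1 / S₁ : ℝ) : ℂ).im) = (S₁ * S₂)⁻¹ := by
    simp [mul_comm]
  have hp : 0 < (S₁ * S₂)⁻¹ := by positivity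
  rw [scaleMap, map_realLin (by rw [hd]; exact hp.ne'), hd, inv_inv, abs_of_pos (by positivity)]

theorem lintegral_comp_scaleMap {S₁ S₂ : ℝ} (h1 : 0 < S₁) (h2 : 0 < S₂) {f : ℂ → ℝ≥0∞}
    (hf : Measurable f) :
    ∫⁻ z, f (scaleMap S₁ S₂ z) = ENNReal.ofReal (S₁ * S₂) * ∫⁻ z, f z := by
  rw [← lintegral_map hf (continuous_scaleMap S₁ S₂).measurable, map_scaleMap h1 h2,
    lintegral_smul_measure, smul_eq_mul]

theorem integral_comp_scaleMap {S₁ S₂ : ℝ} (h1 : 0 < S₁) (h2 : 0 < S₂) {f : ℂ → ℝ}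
    (hf : Continuous f) :
    ∫ z, f (scaleMap S₁ S₂ z) = S₁ * S₂ * ∫ z, f z := by
  rw [← integral_map (continuous_scaleMap S₁ S₂).measurable.aemeasurable
    hf.aestronglyMeasurable, map_scaleMap h1 h2,
    integral_smul_measure, smul_eq_mul, ENNReal.toReal_ofReal (by positivity)]

/-- Continuous functions supported in the unit disc and Hölder continuous of exponent `1/2`. -/
structure IsBump (ψ : ℂ → ℝ) (K : ℝ) : Prop where
  continuous : Continuous ψ
  eq_zero : ∀ ζ, 1 ≤ ‖ζ‖ → ψ ζ = 0
  holder : ∀ ζ ξ, |ψ ζ - ψ ξ| ≤ K * √‖ζ - ξ‖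

theorem IsBump.nonneg {ψ : ℂ → ℝ} {K : ℝ} (h : IsBump ψ K) : 0 ≤ K := by
  have := (abs_nonneg _).trans (h.holder 1 0)
  simpa using this

theorem IsBump.hasCompactSupport {ψ : ℂ → ℝ} {K : ℝ} (h : IsBump ψ K) : HasCompactSupport ψ := by
  refine HasCompactSupport.of_support_subset_isCompact (isCompact_closedBall (0 : ℂ) 1) fun ζ hζ => ?_
  by_contra hc
  simp only [Metric.mem_closedBall, dist_zero_right, not_le] at hc
  exact hζ (h.eq_zero ζ hc.le)

theorem IsBump.integrable {ψ : ℂ → ℝ} {K : ℝ} (h : IsBump ψ K) : Integrable ψ :=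
  h.continuous.integrable_of_hasCompactSupport h.hasCompactSupport

theorem IsBump.integrable_comp_scaleMap {ψ : ℂ → ℝ} {K : ℝ} (h : IsBump ψ K) {S₁ S₂ : ℝ}
    (h1 : 0 < S₁) (h2 : 0 < S₂) : Integrable fun z => ψ (scaleMap S₁ S₂ z) := by
  have := h.integrable.smul_measure (c := ENNReal.ofReal (S₁ * S₂)) ENNReal.ofReal_ne_top
  rw [← map_scaleMap h1 h2] at this
  exact this.comp_measurable (continuous_scaleMap S₁ S₂).measurable

/-- The difference vanishes unless `ζ` or `ζ + η` lies in the unit disc, and then `|ζ| ≤ 1 + |η|`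
controls the weight. The weight serves the potential energy; the indicators keep the bound
integrable in `ζ`. -/
theorem IsBump.weighted_sub_le {ψ : ℂ → ℝ} {K : ℝ} (h : IsBump ψ K) (ζ η : ℂ) :
    (1 + ‖ζ‖ ^ 2) * |ψ ζ - ψ (ζ + η)| ≤ 2 * K * √‖η‖ * (1 + ‖η‖) ^ 2 *
      ((Metric.closedBall (0 : ℂ) 1).indicator 1 ζ + (Metric.closedBall (0 : ℂ) 1).indicator 1 (ζ + η)) := by
  have hK := h.nonneg
  have hη := norm_nonneg η
  have hold : |ψ ζ - ψ (ζ + η)| ≤ K * √‖η‖ := by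
    have := h.holder ζ (ζ + η)
    rwa [sub_add_cancel_left, norm_neg] at this
  have ind0 : ∀ x : ℂ, 0 ≤ (Metric.closedBall (0 : ℂ) 1).indicator (1 : ℂ → ℝ) x := fun x =>
    Set.indicator_nonneg (fun _ _ => zero_le_one) x
  have main : ‖ζ‖ ≤ 1 + ‖η‖ → (1 : ℝ) ≤ (Metric.closedBall (0 : ℂ) 1).indicator 1 ζ
      + (Metric.closedBall (0 : ℂ) 1).indicator 1 (ζ + η) →
      (1 + ‖ζ‖ ^ 2) * |ψ ζ - ψ (ζ + η)| ≤ 2 * K * √‖η‖ * (1 + ‖η‖) ^ 2 *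
      ((Metric.closedBall (0 : ℂ) 1).indicator 1 ζ
        + (Metric.closedBall (0 : ℂ) 1).indicator 1 (ζ + η)) := by
    intro h1 h2
    have h3 : 1 + ‖ζ‖ ^ 2 ≤ 2 * (1 + ‖η‖) ^ 2 := by
      have : ‖ζ‖ ^ 2 ≤ (1 + ‖η‖) ^ 2 := by gcongr
      nlinarith
    calc _ ≤ (2 * (1 + ‖η‖) ^ 2) * (K * √‖η‖) := by gcongr
      _ = 2 * K * √‖η‖ * (1 + ‖η‖) ^ 2 * 1 := by ring
      _ ≤ _ := by gcongr
  by_cases hζ : ‖ζ‖ ≤ 1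
  · refine main (by linarith) ?_
    rw [Set.indicator_of_mem (by simpa using hζ)]
    have := ind0 (ζ + η)
    simp only [Pi.one_apply]
    linarith
  · by_cases hζη : ‖ζ + η‖ ≤ 1
    · refine main ?_ ?_
      · have := norm_sub_le (ζ + η) η
        rw [add_sub_cancel_right] at this
        linarith
      · rw [Set.indicator_of_mem (s := Metric.closedBall (0 : ℂ) 1) (a := ζ + η) (by simpa using hζη)]
        have := ind0 ζ
        simp only [Pi.one_apply]
        linarith
    · rw [h.eq_zero _ (not_le.1 hζ).le, h.eq_zero _ (not_le.1 hζη).le]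
      simp only [sub_zero, abs_zero, mul_zero]
      have := ind0 ζ
      have := ind0 (ζ + η)
      positivity

theorem lintegral_indicator_closedBall (η : ℂ) :
    ∫⁻ ζ : ℂ, ENNReal.ofReal ((Metric.closedBall (0 : ℂ) 1).indicator 1 (ζ + η))
      = ENNReal.ofReal Real.pi := by
  rw [lintegral_add_right_eq_self (fun ζ : ℂ =>
    ENNReal.ofReal ((Metric.closedBall (0 : ℂ) 1).indicator 1 ζ)) η]
  have : ∀ ζ : ℂ, ENNReal.ofReal ((Metric.closedBall (0 : ℂ) 1).indicator 1 ζ)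
      = (Metric.closedBall (0 : ℂ) 1).indicator 1 ζ := fun ζ => by
    by_cases h : ζ ∈ Metric.closedBall (0 : ℂ) 1 <;> simp [h]
  simp only [this]
  rw [lintegral_indicator_one Metric.isClosed_closedBall.measurableSet, Complex.volume_closedBall]
  simp [ENNReal.ofReal, NNReal.pi, Real.toNNReal_of_nonneg Real.pi_pos.le]
  rfl

theorem IsBump.lintegral_sub_le {ψ : ℂ → ℝ} {K : ℝ} (h : IsBump ψ K) (η : ℂ) :
    ∫⁻ ζ : ℂ, ENNReal.ofReal ((1 + ‖ζ‖ ^ 2) * |ψ ζ - ψ (ζ + η)|)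
      ≤ ENNReal.ofReal (4 * Real.pi * K * √‖η‖ * (1 + ‖η‖) ^ 2) := by
  have hK := h.nonneg
  have hη := norm_nonneg η
  have hm : Measurable fun ζ : ℂ => (Metric.closedBall (0 : ℂ) 1).indicator (1 : ℂ → ℝ) ζ :=
    measurable_one.indicator Metric.isClosed_closedBall.measurableSet
  have ind0 : ∀ x : ℂ, 0 ≤ (Metric.closedBall (0 : ℂ) 1).indicator (1 : ℂ → ℝ) x := fun x =>
    Set.indicator_nonneg (fun _ _ => zero_le_one) x
  calc _ ≤ ∫⁻ ζ : ℂ, ENNReal.ofReal (2 * K * √‖η‖ * (1 + ‖η‖) ^ 2) *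
      (ENNReal.ofReal ((Metric.closedBall (0 : ℂ) 1).indicator 1 (ζ + 0))
        + ENNReal.ofReal ((Metric.closedBall (0 : ℂ) 1).indicator 1 (ζ + η))) := by
        refine lintegral_mono fun ζ => ?_
        rw [add_zero, ← ENNReal.ofReal_add (ind0 _) (ind0 _), ← ENNReal.ofReal_mul (by positivity)]
        exact ENNReal.ofReal_le_ofReal (h.weighted_sub_le ζ η)
    _ = ENNReal.ofReal (2 * K * √‖η‖ * (1 + ‖η‖) ^ 2) *
        (ENNReal.ofReal Real.pi + ENNReal.ofReal Real.pi) := by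
        rw [lintegral_const_mul, lintegral_add_left, lintegral_indicator_closedBall,
          lintegral_indicator_closedBall]
        · exact (hm.comp (measurable_add_const _)).ennreal_ofReal
        · exact (hm.comp (measurable_add_const _)).ennreal_ofReal.add
            (hm.comp (measurable_add_const _)).ennreal_ofReal
    _ = _ := by
        rw [← ENNReal.ofReal_add Real.pi_pos.le Real.pi_pos.le, ← ENNReal.ofReal_mul (by positivity)]
        congr 1
        ring

/-- A shift by `t` becomes a shift of length at most `|t| / S₂` in the scaled variable, and Hölder
continuity turns this into the gain `1/√S₂`. The other powers only need `S₂ ≥ 1`. -/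
theorem IsBump.lintegral_scale_sub_le {ψ : ℂ → ℝ} {K : ℝ} (h : IsBump ψ K) {S₁ S₂ : ℝ}
    (h2 : 1 ≤ S₂) (h12 : S₂ ≤ S₁) (t : ℂ) :
    ∫⁻ z : ℂ, ENNReal.ofReal ((1 + ‖scaleMap S₁ S₂ z‖ ^ 2)
        * |ψ (scaleMap S₁ S₂ z) - ψ (scaleMap S₁ S₂ (z + t))|)
      ≤ ENNReal.ofReal (4 * Real.pi * K * (S₁ * S₂ / √S₂) * (1 + ‖t‖) ^ 3) := by
  have hK := h.nonneg
  have p2 : 0 < S₂ := by linarith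
  have p1 : 0 < S₁ := by linarith
  simp only [map_add]
  have hc := h.continuous
  rw [lintegral_comp_scaleMap p1 p2 (f := fun ζ => ENNReal.ofReal ((1 + ‖ζ‖ ^ 2)
        * |ψ ζ - ψ (ζ + scaleMap S₁ S₂ t)|)) (by fun_prop)]
  calc _ ≤ ENNReal.ofReal (S₁ * S₂) * ENNReal.ofReal (4 * Real.pi * K * √‖scaleMap S₁ S₂ t‖
        * (1 + ‖scaleMap S₁ S₂ t‖) ^ 2) := by gcongr; exact h.lintegral_sub_le _
    _ ≤ _ := by
      rw [← ENNReal.ofReal_mul (by positivity)]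
      apply ENNReal.ofReal_le_ofReal
      have n1 := norm_scaleMap_le p2 h12 t
      have n2 : ‖scaleMap S₁ S₂ t‖ ≤ ‖t‖ := n1.trans (div_le_self (norm_nonneg _) h2)
      have n3 : √‖scaleMap S₁ S₂ t‖ ≤ (1 + ‖t‖) / √S₂ := by
        refine (Real.sqrt_le_sqrt n1).trans ?_
        rw [Real.sqrt_div (norm_nonneg _)]
        gcongr
        rw [Real.sqrt_le_left (by positivity)]
        nlinarith [norm_nonneg t]
      calc _ ≤ S₁ * S₂ * (4 * Real.pi * K * ((1 + ‖t‖) / √S₂) * (1 + ‖t‖) ^ 2) := by gcongr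
        _ = _ := by ring


/-! ### Homogenization of lattice-periodic functions. -/

/-- The uniform measure on the unit square. -/
noncomputable def squareMeasure : Measure (ℝ × ℝ) :=
  (volume.restrict (Set.Ioc 0 1)).prod (volume.restrict (Set.Ioc 0 1))

instance : IsProbabilityMeasure (volume.restrict (Set.Ioc (0 : ℝ) 1)) :=
  ⟨by simp⟩

instance : IsProbabilityMeasure squareMeasure := by
  unfold squareMeasure
  infer_instance

theorem ae_squareMeasure : ∀ᵐ p ∂squareMeasure, p ∈ Set.Ioc (0 : ℝ) 1 ×ˢ Set.Ioc (0 : ℝ) 1 := by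
  rw [squareMeasure, Measure.prod_restrict]
  exact ae_restrict_mem (measurableSet_Ioc.prod measurableSet_Ioc)

theorem integral_squareMeasure {H : ℝ × ℝ → ℝ} (hH : Continuous H) :
    ∫ p, H p ∂squareMeasure = ∫ t in (0 : ℝ)..1, ∫ s in (0 : ℝ)..1, H (s, t) := by
  rw [squareMeasure, integral_prod_symm]
  · simp only [intervalIntegral.integral_of_le zero_le_one]
  · rw [Measure.prod_restrict, ← Measure.volume_eq_prod]
    exact (hH.continuousOn.integrableOn_compact (isCompact_Icc.prod isCompact_Icc)).mono_set
      (Set.prod_mono Set.Ioc_subset_Icc_self Set.Ioc_subset_Icc_self)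

/-- Functions that are periodic for the lattice of the cell of `τ`. -/
structure IsCellPeriodic (τ : ℂ) (F : ℂ → ℝ) (B : ℝ) : Prop where
  continuous : Continuous F
  add_left : ∀ s t, F (cellMap τ (s + 1) t) = F (cellMap τ s t)
  add_right : ∀ s t, F (cellMap τ s (t + 1)) = F (cellMap τ s t)
  le : ∀ z, |F z| ≤ B

theorem isCellPeriodic_norm_uTau_pow {τ : ℂ} (hτ : 0 < τ.im) {B : ℝ} (hB : ∀ z, ‖uTau τ z‖ ≤ B)
    (n : ℕ) : IsCellPeriodic τ (fun z => ‖uTau τ z‖ ^ n) (B ^ n) where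
  continuous := (continuous_uTau hτ).norm.pow n
  add_left s t := by simp only [norm_uTau_cellMap hτ, thetaSeries_add_left]
  add_right s t := by simp only [norm_uTau_cellMap hτ, norm_thetaSeries_add_right]
  le z := by
    rw [abs_of_nonneg (by positivity)]
    exact pow_le_pow_left₀ (norm_nonneg _) (hB z) n

theorem intervalIntegral_comp_sub_left_of_periodic {f : ℝ → ℝ} (hf : Function.Periodic f 1)
    (d : ℝ) : ∫ s in (0 : ℝ)..1, f (d - s) = ∫ s in (0 : ℝ)..1, f s := by
  rw [intervalIntegral.integral_comp_sub_left]
  have := hf.intervalIntegral_add_eq (d - 1) 0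
  simpa using this

/-- The mean over a cell does not depend on the position of the cell. -/
theorem IsCellPeriodic.integral_sub {τ : ℂ} (hτ : 0 < τ.im) {F : ℂ → ℝ} {B : ℝ}
    (hF : IsCellPeriodic τ F B) (z : ℂ) :
    ∫ p, F (z - cellMap τ p.1 p.2) ∂squareMeasure = ⨍ z in cell τ, F z := by
  have hc := hF.continuous
  have hT := continuous_cellMap τ
  obtain ⟨s₀, t₀, rfl⟩ := cellMap_surjective hτ z
  rw [integral_squareMeasure (H := fun p => F (cellMap τ s₀ t₀ - cellMap τ p.1 p.2)) (by fun_prop),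
    setAverage_cell hτ hc]
  have e : ∀ s t : ℝ, cellMap τ s₀ t₀ - cellMap τ s t = cellMap τ (s₀ - s) (t₀ - t) := fun s t => by
    simp only [cellMap]
    push_cast
    ring
  simp only [e]
  have h1 : ∀ t, ∫ s in (0 : ℝ)..1, F (cellMap τ (s₀ - s) (t₀ - t))
      = ∫ s in (0 : ℝ)..1, F (cellMap τ s (t₀ - t)) := fun t =>
    intervalIntegral_comp_sub_left_of_periodic (f := fun s => F (cellMap τ s (t₀ - t)))
      (fun s => hF.add_left s _) s₀
  simp only [h1]
  exact intervalIntegral_comp_sub_left_of_periodic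
    (f := fun t => ∫ s in (0 : ℝ)..1, F (cellMap τ s t)) (fun t => by simp only [hF.add_right]) t₀

theorem IsBump.integral_abs_sub_le {ψ : ℂ → ℝ} {K : ℝ} (h : IsBump ψ K) {S₁ S₂ : ℝ}
    (h2 : 1 ≤ S₂) (h12 : S₂ ≤ S₁) (t : ℂ) :
    ∫ z : ℂ, |ψ (scaleMap S₁ S₂ z) - ψ (scaleMap S₁ S₂ (z + t))|
      ≤ 4 * Real.pi * K * (S₁ * S₂ / √S₂) * (1 + ‖t‖) ^ 3 := by
  have hK := h.nonneg
  have p2 : 0 < S₂ := by linarith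
  have p1 : 0 < S₁ := by linarith
  have hc := h.continuous
  have hD := continuous_scaleMap S₁ S₂
  rw [integral_eq_lintegral_of_nonneg_ae (Filter.Eventually.of_forall fun z => abs_nonneg _)
    (by fun_prop : Continuous fun z : ℂ =>
      |ψ (scaleMap S₁ S₂ z) - ψ (scaleMap S₁ S₂ (z + t))|).aestronglyMeasurable]
  refine ENNReal.toReal_le_of_le_ofReal (by positivity) (le_trans ?_ (h.lintegral_scale_sub_le h2 h12 t))
  refine lintegral_mono fun z => ENNReal.ofReal_le_ofReal ?_
  exact le_mul_of_one_le_left (abs_nonneg _) (by nlinarith [sq_nonneg ‖scaleMap S₁ S₂ z‖])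

/-- Homogenization of a periodic function against a slowly varying profile. -/
theorem exists_abs_integral_mul_sub_le {τ : ℂ} (hτ : 0 < τ.im) {F : ℂ → ℝ} {B : ℝ}
    (hF : IsCellPeriodic τ F B) {ψ : ℂ → ℝ} {K : ℝ} (h : IsBump ψ K) :
    ∃ C : ℝ, 0 ≤ C ∧ ∀ S₁ S₂ : ℝ, 1 ≤ S₂ → S₂ ≤ S₁ →
      |(∫ z, F z * ψ (scaleMap S₁ S₂ z)) - (⨍ z in cell τ, F z) * (S₁ * S₂ * ∫ z, ψ z)|
        ≤ C * (S₁ * S₂ / √S₂) := by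
  have hK := h.nonneg
  have hB : 0 ≤ B := (abs_nonneg _).trans (hF.le 0)
  have hT := continuous_cellMap τ
  obtain ⟨L, hL⟩ := (isCompact_Icc (a := (0 : ℝ × ℝ)) (b := 1)).bddAbove_image
    (f := fun p : ℝ × ℝ => ‖cellMap τ p.1 p.2‖) (by fun_prop)
  have hL' : ∀ᵐ p ∂squareMeasure, ‖cellMap τ p.1 p.2‖ ≤ L := by
    filter_upwards [ae_squareMeasure] with p hp
    exact hL ⟨p, ⟨⟨hp.1.1.le, hp.2.1.le⟩, hp.1.2, hp.2.2⟩, rfl⟩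
  have hL0 : 0 ≤ L := by
    obtain ⟨p, hp⟩ := hL'.exists
    exact (norm_nonneg _).trans hp
  refine ⟨B * (4 * Real.pi * K * (1 + L) ^ 3), by positivity, fun S₁ S₂ h2 h12 => ?_⟩
  have p2 : 0 < S₂ := by linarith
  have p1 : 0 < S₁ := by linarith
  have hFc := hF.continuous
  have hψc := h.continuous
  have hD := continuous_scaleMap S₁ S₂
  set φ : ℂ → ℝ := fun z => ψ (scaleMap S₁ S₂ z) with hφ
  have hφc : Continuous φ := by fun_prop
  have hφi : Integrable φ := h.integrable_comp_scaleMap p1 p2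
  have hbd : ∀ {g : ℂ → ℝ}, Continuous g → Integrable g → ∀ w : ℂ,
      Integrable fun z => F (z - w) * g z := fun hg hgi w =>
    hgi.bdd_mul (c := B) (by fun_prop : Continuous fun z => F (z - w)).aestronglyMeasurable
      (Filter.Eventually.of_forall fun z => hF.le _)
  have hprod : Integrable (fun q : (ℝ × ℝ) × ℂ => F (q.2 - cellMap τ q.1.1 q.1.2) * φ q.2)
      (squareMeasure.prod volume) := by
    have hcont : Continuous fun q : (ℝ × ℝ) × ℂ => F (q.2 - cellMap τ q.1.1 q.1.2) := by
      have : Continuous fun q : (ℝ × ℝ) × ℂ => cellMap τ q.1.1 q.1.2 := hT.comp continuous_fst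
      fun_prop
    refine (hφi.comp_snd squareMeasure).bdd_mul (c := B) hcont.aestronglyMeasurable
      (Filter.Eventually.of_forall fun q => hF.le _)
  -- The mean of `F` is written as the average of its translates over a cell, which is the same at
  -- every `z`.
  have hmean : (⨍ z in cell τ, F z) * (S₁ * S₂ * ∫ z, ψ z)
      = ∫ p, (∫ z, F (z - cellMap τ p.1 p.2) * φ z) ∂squareMeasure := by
    rw [integral_integral_swap hprod, ← integral_comp_scaleMap p1 p2 hψc, ← integral_const_mul]
    congr 1
    ext z
    rw [integral_mul_const, hF.integral_sub hτ z]
  have hone : ∫ z, F z * φ z = ∫ _p, (∫ z, F z * φ z) ∂squareMeasure := by simp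
  change |(∫ z, F z * φ z) - _| ≤ _
  rw [hmean, hone, ← integral_sub (integrable_const _) hprod.integral_prod_left, ← Real.norm_eq_abs]
  have hpt : ∀ᵐ p ∂squareMeasure, ‖(∫ z, F z * φ z) - ∫ z, F (z - cellMap τ p.1 p.2) * φ z‖
      ≤ B * (4 * Real.pi * K * (1 + L) ^ 3) * (S₁ * S₂ / √S₂) := by
    filter_upwards [hL'] with p hp
    set w := cellMap τ p.1 p.2
    -- Translation invariance moves the shift from the rapidly oscillating `F` to the slowly varying
    -- profile.
    have e1 : ∫ z, F (z - w) * φ z = ∫ z, F z * φ (z + w) := by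
      rw [← integral_add_right_eq_self _ w]
      simp only [add_sub_cancel_right]
    have i1 : Integrable fun z => F z * φ z := by simpa using hbd hφc hφi 0
    have i2 : Integrable fun z => F z * φ (z + w) := by
      simpa using hbd (g := fun z => φ (z + w)) (by fun_prop) (hφi.comp_add_right w) 0
    rw [e1, ← integral_sub i1 i2]
    calc _ ≤ ∫ z, ‖F z * φ z - F z * φ (z + w)‖ := norm_integral_le_integral_norm _
      _ ≤ ∫ z, B * |φ z - φ (z + w)| := by
        refine integral_mono (i1.sub i2).norm ((hφi.sub (hφi.comp_add_right w)).abs.const_mul B) fun z => ?_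
        dsimp only
        rw [← mul_sub, norm_mul]
        exact mul_le_mul_of_nonneg_right (hF.le z) (norm_nonneg _)
      _ = B * ∫ z, |φ z - φ (z + w)| := integral_const_mul _ _
      _ ≤ B * (4 * Real.pi * K * (S₁ * S₂ / √S₂) * (1 + ‖w‖) ^ 3) := by
        gcongr
        exact h.integral_abs_sub_le h2 h12 w
      _ ≤ B * (4 * Real.pi * K * (S₁ * S₂ / √S₂) * (1 + L) ^ 3) := by gcongr
      _ = _ := by ring
  simpa using norm_integral_le_of_norm_le_const hpt


/-! ### The projection acts almost as the identity on `u_τ` times a slow profile. -/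

theorem integrable_gauss_mul_cube :
    Integrable fun t : ℂ => Real.exp (-(Real.pi / 2 * ‖t‖ ^ 2)) * (1 + ‖t‖) ^ 3 := by
  have ha : 0 < Real.pi / 2 - 1 := by linarith [Real.pi_gt_three]
  -- The constant comes from `(1 + r)³ ≤ exp(3r)` and `3r ≤ r² + 9/4`; the remaining Gaussian decays
  -- since `π/2 > 1`.
  refine ((integrable_gauss ha).const_mul (Real.exp (9 / 4))).mono'
    (by fun_prop : Continuous fun t : ℂ =>
      Real.exp (-(Real.pi / 2 * ‖t‖ ^ 2)) * (1 + ‖t‖) ^ 3).aestronglyMeasurable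
    (Filter.Eventually.of_forall fun t => ?_)
  rw [Real.norm_of_nonneg (by positivity), ← Real.exp_add]
  have h1 : (1 + ‖t‖) ^ 3 ≤ Real.exp (3 * ‖t‖) := by
    rw [show 3 * ‖t‖ = ((3 : ℕ) : ℝ) * ‖t‖ by norm_num, Real.exp_nat_mul]
    gcongr
    linarith [Real.add_one_le_exp ‖t‖]
  calc _ ≤ Real.exp (-(Real.pi / 2 * ‖t‖ ^ 2)) * Real.exp (3 * ‖t‖) := by gcongr
    _ = Real.exp (-(Real.pi / 2 * ‖t‖ ^ 2) + 3 * ‖t‖) := (Real.exp_add _ _).symm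
    _ ≤ _ := by
      apply Real.exp_le_exp.2
      nlinarith [sq_nonneg (‖t‖ - 3 / 2)]

theorem continuous_kernel₀_right (x : ℂ) : Continuous fun y => kernel₀ x y := by
  unfold kernel₀
  fun_prop

theorem integrable_gauss_sub (x : ℂ) :
    Integrable fun y : ℂ => Real.exp (-(Real.pi / 2 * ‖x - y‖ ^ 2)) := by
  have := (integrable_gauss (a := Real.pi / 2) (by positivity)).comp_sub_left x
  exact this

theorem integrable_kernel₀_mul (x : ℂ) {u : ℂ → ℂ} (hu : Continuous u) {B : ℝ}
    (hB : ∀ z, ‖u z‖ ≤ B) : Integrable fun y => kernel₀ x y * u y := by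
  refine ((integrable_gauss_sub x).mul_const B).mono'
    ((continuous_kernel₀_right x).mul hu).aestronglyMeasurable (Filter.Eventually.of_forall fun y => ?_)
  rw [norm_mul, norm_kernel₀]
  gcongr
  exact hB y

/-- The factor `2` is the integral of `exp(-π|t|²/2)`, the modulus of the kernel. -/
theorem norm_proj₀_le {u : ℂ → ℂ} {B : ℝ} (hB : ∀ z, ‖u z‖ ≤ B) (x : ℂ) :
    ‖proj₀ u x‖ ≤ 2 * B := by
  have h := norm_integral_le_of_norm_le ((integrable_gauss_sub x).mul_const B)
    (f := fun y => kernel₀ x y * u y) (Filter.Eventually.of_forall fun y => by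
      rw [norm_mul, norm_kernel₀]
      gcongr
      exact hB y)
  rw [proj₀_eq]
  refine h.trans (le_of_eq ?_)
  rw [integral_mul_const, integral_sub_left_eq_self
    (fun t : ℂ => Real.exp (-(Real.pi / 2 * ‖t‖ ^ 2))) volume x, integral_gauss (by positivity)]
  have := Real.pi_ne_zero
  field_simp

/-- Projecting `u_τ` times a profile is nearly the identity, in a weighted `L¹` norm. -/
theorem exists_lintegral_proj₀_sub_le {τ : ℂ} (hτ : 0 < τ.im) {ψ : ℂ → ℝ} {K : ℝ}
    (h : IsBump ψ K) :
    ∃ C : ℝ, 0 ≤ C ∧ ∀ S₁ S₂ : ℝ, 1 ≤ S₂ → S₂ ≤ S₁ →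
      ∫⁻ z, ENNReal.ofReal (1 + ‖scaleMap S₁ S₂ z‖ ^ 2)
        * ‖proj₀ (fun z => uTau τ z * (ψ (scaleMap S₁ S₂ z) : ℂ)) z
          - uTau τ z * (ψ (scaleMap S₁ S₂ z) : ℂ)‖ₑ
        ≤ ENNReal.ofReal (C * (S₁ * S₂ / √S₂)) := by
  have hK := h.nonneg
  obtain ⟨B, hB0, hB⟩ := exists_norm_uTau_le hτ
  set G : ℝ := ∫ t : ℂ, Real.exp (-(Real.pi / 2 * ‖t‖ ^ 2)) * (1 + ‖t‖) ^ 3 with hG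
  have hG0 : 0 ≤ G := integral_nonneg fun t => by positivity
  refine ⟨B * (4 * Real.pi * K) * G, by positivity, fun S₁ S₂ h2 h12 => ?_⟩
  have p2 : 0 < S₂ := by linarith
  have p1 : 0 < S₁ := by linarith
  have hψc := h.continuous
  have hD := continuous_scaleMap S₁ S₂
  have huc := continuous_uTau hτ
  set φ : ℂ → ℝ := fun z => ψ (scaleMap S₁ S₂ z) with hφ
  have hφc : Continuous φ := by fun_prop
  obtain ⟨A, hA⟩ : ∃ A, ∀ ζ, |ψ ζ| ≤ A := by
    obtain ⟨A, hA⟩ := h.hasCompactSupport.exists_bound_of_continuous hψc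
    exact ⟨A, hA⟩
  have hpt : ∀ x, ‖proj₀ (fun z => uTau τ z * (φ z : ℂ)) x - uTau τ x * (φ x : ℂ)‖ₑ
      ≤ ∫⁻ t : ℂ, ENNReal.ofReal (B * Real.exp (-(Real.pi / 2 * ‖t‖ ^ 2)) * |φ x - φ (x + t)|) := by
    intro x
    -- Since `u_τ` is its own projection, only the increment of the profile under the kernel
    -- survives.
    have e1 : proj₀ (fun z => uTau τ z * (φ z : ℂ)) x - uTau τ x * (φ x : ℂ)
        = ∫ y, kernel₀ x y * uTau τ y * ((φ y - φ x : ℝ) : ℂ) := by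
      rw [← proj₀_eq_self (differentiable_uTauEntire hτ) (uTau_eq τ) hB x, proj₀_eq, proj₀_eq,
        ← integral_mul_const, ← integral_sub]
      · congr 1
        ext y
        push_cast
        ring
      · refine integrable_kernel₀_mul x (by fun_prop) (B := B * A) fun z => ?_
        rw [norm_mul, Complex.norm_real]
        exact mul_le_mul (hB z) (hA _) (norm_nonneg _) hB0.le
      · exact (integrable_kernel₀_mul x huc hB).mul_const _
    rw [e1]
    refine (enorm_integral_le_lintegral_enorm _).trans ?_
    rw [← lintegral_add_left_eq_self _ x]
    refine lintegral_mono fun t => ?_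
    rw [← ofReal_norm]
    apply ENNReal.ofReal_le_ofReal
    rw [norm_mul, norm_mul, norm_kernel₀, Complex.norm_real, sub_add_cancel_left, norm_neg,
      Real.norm_eq_abs, abs_sub_comm, mul_comm B]
    gcongr
    exact hB _
  calc _ ≤ ∫⁻ z, ∫⁻ t : ℂ, ENNReal.ofReal (B * Real.exp (-(Real.pi / 2 * ‖t‖ ^ 2)))
          * ENNReal.ofReal ((1 + ‖scaleMap S₁ S₂ z‖ ^ 2) * |φ z - φ (z + t)|) := by
        refine lintegral_mono fun z => ?_
        refine (mul_le_mul_right (hpt z) _).trans (le_of_eq ?_)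
        rw [← lintegral_const_mul _ (by fun_prop)]
        refine lintegral_congr fun t => ?_
        rw [← ENNReal.ofReal_mul (by positivity), ← ENNReal.ofReal_mul (by positivity)]
        congr 1
        ring
    -- Exchanging the integrals reduces the claim to the translation estimate at fixed shift `t`;
    -- its cubic growth in `t` is absorbed by the Gaussian.
    _ = ∫⁻ t : ℂ, ∫⁻ z, ENNReal.ofReal (B * Real.exp (-(Real.pi / 2 * ‖t‖ ^ 2)))
          * ENNReal.ofReal ((1 + ‖scaleMap S₁ S₂ z‖ ^ 2) * |φ z - φ (z + t)|) := by
        refine lintegral_lintegral_swap (Measurable.aemeasurable ?_)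
        have c1 : Continuous fun p : ℂ × ℂ => B * Real.exp (-(Real.pi / 2 * ‖p.2‖ ^ 2)) := by fun_prop
        have c2 : Continuous fun p : ℂ × ℂ =>
          (1 + ‖scaleMap S₁ S₂ p.1‖ ^ 2) * |φ p.1 - φ (p.1 + p.2)| := by fun_prop
        exact c1.measurable.ennreal_ofReal.mul c2.measurable.ennreal_ofReal
    _ ≤ ∫⁻ t : ℂ, ENNReal.ofReal (B * (4 * Real.pi * K * (S₁ * S₂ / √S₂))
          * (Real.exp (-(Real.pi / 2 * ‖t‖ ^ 2)) * (1 + ‖t‖) ^ 3)) := by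
        refine lintegral_mono fun t => ?_
        rw [lintegral_const_mul _ (by fun_prop)]
        refine (mul_le_mul_right (h.lintegral_scale_sub_le h2 h12 t) _).trans (le_of_eq ?_)
        rw [← ENNReal.ofReal_mul (by positivity)]
        congr 1
        ring
    _ = _ := by
        rw [← ofReal_integral_eq_lintegral_ofReal (integrable_gauss_mul_cube.const_mul _)
          (Filter.Eventually.of_forall fun t => by positivity), integral_const_mul]
        congr 1
        ring


/-! ### The inverted parabola: regularity and moments. -/

/-- The normalized inverted parabola. -/
noncomputable def parab (ζ : ℂ) : ℝ := max (1 - ‖ζ‖ ^ 2) 0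

theorem parab_nonneg (ζ : ℂ) : 0 ≤ parab ζ := le_max_right _ _

theorem parab_le_one (ζ : ℂ) : parab ζ ≤ 1 := max_le (by nlinarith [sq_nonneg ‖ζ‖]) zero_le_one

theorem continuous_parab : Continuous parab := by
  unfold parab
  fun_prop

theorem parab_eq_zero {ζ : ℂ} (h : 1 ≤ ‖ζ‖) : parab ζ = 0 := max_eq_right (by nlinarith)

theorem parab_eq_of_norm_le {ζ : ℂ} (h : ‖ζ‖ ≤ 1) : parab ζ = 1 - ‖ζ‖ ^ 2 :=
  max_eq_left (by nlinarith [norm_nonneg ζ])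

theorem parab_eq_min (ζ : ℂ) : parab ζ = 1 - (min ‖ζ‖ 1) ^ 2 := by
  rcases le_total ‖ζ‖ 1 with h | h
  · rw [min_eq_left h, parab_eq_of_norm_le h]
  · rw [min_eq_right h, parab_eq_zero h]
    norm_num

theorem abs_parab_sub_le (ζ ξ : ℂ) : |parab ζ - parab ξ| ≤ 2 * ‖ζ - ξ‖ := by
  rw [parab_eq_min, parab_eq_min]
  have h1 : |min ‖ξ‖ 1 - min ‖ζ‖ 1| ≤ ‖ζ - ξ‖ := by
    have := abs_min_sub_min_le_max ‖ξ‖ 1 ‖ζ‖ 1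
    rw [sub_self, abs_zero, max_eq_left (abs_nonneg _)] at this
    refine this.trans ?_
    rw [norm_sub_rev]
    exact abs_norm_sub_norm_le _ _
  have e : 1 - min ‖ζ‖ 1 ^ 2 - (1 - min ‖ξ‖ 1 ^ 2)
      = (min ‖ξ‖ 1 + min ‖ζ‖ 1) * (min ‖ξ‖ 1 - min ‖ζ‖ 1) := by ring
  have h2 : |min ‖ξ‖ 1 + min ‖ζ‖ 1| ≤ 2 := by
    rw [abs_of_nonneg (by positivity)]
    linarith [min_le_right ‖ξ‖ 1, min_le_right ‖ζ‖ 1]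
  rw [e, abs_mul]
  exact mul_le_mul h2 h1 (abs_nonneg _) zero_le_two

theorem abs_sqrt_sub_sqrt_le {a c : ℝ} (ha : 0 ≤ a) (hc : 0 ≤ c) : |√a - √c| ≤ √|a - c| := by
  apply Real.le_sqrt_of_sq_le
  rw [sq_abs]
  have h1 := Real.sq_sqrt ha
  have h2 := Real.sq_sqrt hc
  have p1 := Real.sqrt_nonneg a
  have p2 := Real.sqrt_nonneg c
  rcases le_total c a with h | h
  · have := Real.sqrt_le_sqrt h
    rw [abs_of_nonneg (by linarith)]
    nlinarith
  · have := Real.sqrt_le_sqrt h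
    rw [abs_of_nonpos (by linarith)]
    nlinarith

theorem sqrt_abs_parab_sub_le (ζ ξ : ℂ) : √|parab ζ - parab ξ| ≤ √2 * √‖ζ - ξ‖ := by
  rw [← Real.sqrt_mul zero_le_two]
  exact Real.sqrt_le_sqrt (abs_parab_sub_le ζ ξ)

/-- The square root has unbounded slope at the unit circle, so no better Hölder exponent than `1/2`
is available. This fixes the rate of the error term. -/
theorem isBump_sqrt_parab : IsBump (fun ζ => √(parab ζ)) √2 where
  continuous := continuous_parab.sqrt
  eq_zero ζ h := by rw [parab_eq_zero h, Real.sqrt_zero]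
  holder ζ ξ :=
    (abs_sqrt_sub_sqrt_le (parab_nonneg _) (parab_nonneg _)).trans (sqrt_abs_parab_sub_le ζ ξ)

theorem isBump_parab : IsBump parab √2 where
  continuous := continuous_parab
  eq_zero ζ h := parab_eq_zero h
  holder ζ ξ := by
    refine le_trans ?_ (sqrt_abs_parab_sub_le ζ ξ)
    apply Real.le_sqrt_of_sq_le
    -- On `[0, 1]` one has `x² ≤ x`, so the Lipschitz bound also gives the Hölder bound.
    have h : |parab ζ - parab ξ| ≤ 1 := abs_le.2
      ⟨by linarith [parab_nonneg ζ, parab_le_one ξ], by linarith [parab_nonneg ξ, parab_le_one ζ]⟩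
    nlinarith [abs_nonneg (parab ζ - parab ξ)]

theorem isBump_parab_sq : IsBump (fun ζ => parab ζ ^ 2) (2 * √2) where
  continuous := continuous_parab.pow 2
  eq_zero ζ h := by rw [parab_eq_zero h]; norm_num
  holder ζ ξ := by
    have h := isBump_parab.holder ζ ξ
    rw [sq_sub_sq, abs_mul, mul_assoc]
    refine mul_le_mul ?_ h (abs_nonneg _) zero_le_two
    rw [abs_of_nonneg (add_nonneg (parab_nonneg _) (parab_nonneg _))]
    linarith [parab_le_one ζ, parab_le_one ξ]

/-- On the disc `|ζ|²` is one minus the parabola, so the second moment reduces to the integrals of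
the parabola and its square. -/
theorem norm_sq_mul_parab (ζ : ℂ) : ‖ζ‖ ^ 2 * parab ζ = parab ζ - parab ζ ^ 2 := by
  rcases le_total ‖ζ‖ 1 with h | h
  · rw [parab_eq_of_norm_le h]
    ring
  · rw [parab_eq_zero h]
    ring

theorem isBump_norm_sq_mul_parab : IsBump (fun ζ => ‖ζ‖ ^ 2 * parab ζ) (3 * √2) where
  continuous := (continuous_norm.pow 2).mul continuous_parab
  eq_zero ζ h := by rw [parab_eq_zero h, mul_zero]
  holder ζ ξ := by
    have h1 := isBump_parab.holder ζ ξ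
    have h2 := isBump_parab_sq.holder ζ ξ
    simp only [norm_sq_mul_parab]
    have e : parab ζ - parab ζ ^ 2 - (parab ξ - parab ξ ^ 2)
      = (parab ζ - parab ξ) - (parab ζ ^ 2 - parab ξ ^ 2) := by ring
    rw [e]
    refine (abs_sub _ _).trans ?_
    linarith

theorem integral_parab_pow (k : ℕ) (hk : k ≠ 0) :
    ∫ ζ, parab ζ ^ k = 2 * Real.pi * ∫ r in (0 : ℝ)..1, r * (1 - r ^ 2) ^ k := by
  have h := integral_fun_norm_addHaar (volume : Measure ℂ) (fun r => (max (1 - r ^ 2) 0) ^ k)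
  change ∫ ζ, parab ζ ^ k = _ at h
  rw [h]
  have hball : volume.real (Metric.ball (0 : ℂ) 1) = Real.pi := by
    simp [Measure.real, NNReal.pi]
    rfl
  have hint : ∫ r in Set.Ioi (0 : ℝ), r ^ (Module.finrank ℝ ℂ - 1) • (max (1 - r ^ 2) 0) ^ k
      = ∫ r in (0 : ℝ)..1, r * (1 - r ^ 2) ^ k := by
    rw [intervalIntegral.integral_of_le zero_le_one]
    have h2 : ∫ r in Set.Ioi (0 : ℝ), r ^ (Module.finrank ℝ ℂ - 1) • (max (1 - r ^ 2) 0) ^ k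
        = ∫ r in Set.Ioc (0 : ℝ) 1, r ^ (Module.finrank ℝ ℂ - 1) • (max (1 - r ^ 2) 0) ^ k := by
      refine (setIntegral_eq_of_subset_of_forall_sdiff_eq_zero measurableSet_Ioi
        Set.Ioc_subset_Ioi_self fun r hr => ?_)
      have : 1 < r := by
        by_contra hc
        exact hr.2 ⟨hr.1, not_lt.1 hc⟩
      rw [max_eq_right (by nlinarith), zero_pow hk, smul_zero]
    rw [h2]
    refine setIntegral_congr_fun measurableSet_Ioc fun r hr => ?_
    have : 0 ≤ 1 - r ^ 2 := by nlinarith [hr.1, hr.2]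
    simp [max_eq_left this]
  rw [hint, hball, Complex.finrank_real_complex]
  simp
  ring

theorem integral_parab : ∫ ζ, parab ζ = Real.pi / 2 := by
  have h := integral_parab_pow 1 one_ne_zero
  simp only [pow_one] at h
  have e : ∫ r in (0 : ℝ)..1, r * (1 - r ^ 2) = 1 / 4 := by
    have : ∀ r : ℝ, r * (1 - r ^ 2) = r - r ^ 3 := fun r => by ring
    simp only [this]
    rw [intervalIntegral.integral_sub (Continuous.intervalIntegrable (by fun_prop) _ _)
      (Continuous.intervalIntegrable (by fun_prop) _ _), integral_id, integral_pow]
    norm_num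
  rw [h, e]
  ring

theorem integral_parab_sq : ∫ ζ, parab ζ ^ 2 = Real.pi / 3 := by
  have h := integral_parab_pow 2 two_ne_zero
  have e : ∫ r in (0 : ℝ)..1, r * (1 - r ^ 2) ^ 2 = 1 / 6 := by
    have : ∀ r : ℝ, r * (1 - r ^ 2) ^ 2 = r - 2 * r ^ 3 + r ^ 5 := fun r => by ring
    simp only [this]
    rw [intervalIntegral.integral_add (Continuous.intervalIntegrable (by fun_prop) _ _)
      (Continuous.intervalIntegrable (by fun_prop) _ _),
      intervalIntegral.integral_sub (Continuous.intervalIntegrable (by fun_prop) _ _)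
      (Continuous.intervalIntegrable (by fun_prop) _ _),
      intervalIntegral.integral_const_mul, integral_id, integral_pow, integral_pow]
    norm_num
  rw [h, e]
  ring

theorem integral_norm_sq_mul_parab : ∫ ζ, ‖ζ‖ ^ 2 * parab ζ = Real.pi / 6 := by
  simp only [norm_sq_mul_parab]
  rw [integral_sub isBump_parab.integrable isBump_parab_sq.integrable, integral_parab,
    integral_parab_sq]
  ring


/-! ### Mass, potential energy and interaction energy of the trial function. -/

/-- The projection of a compactly supported function lies in the lowest Landau level. -/
theorem exists_entire_proj₀ {w : ℂ → ℂ} (hw : Continuous w) (hs : HasCompactSupport w) :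
    ∃ f : ℂ → ℂ, Differentiable ℂ f ∧
      ∀ z, proj₀ w z = f z * Complex.exp (-(Real.pi / 2 * ‖z‖ ^ 2 : ℝ)) := by
  set F : ℂ → ℂ → ℂ := fun z y =>
    Complex.exp (Real.pi * z * (starRingEnd ℂ) y - (Real.pi / 2 * ‖y‖ ^ 2 : ℝ)) * w y with hF
  refine ⟨fun z => ∫ y, F z y, fun z₀ => ?_, fun z => ?_⟩
  · have hc : ∀ z, Continuous (F z) := fun z => by fun_prop
    set F' : ℂ → ℂ → ℂ := fun z y => Real.pi * (starRingEnd ℂ) y * F z y with hF'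
    -- Dominates the derivative uniformly for `|z - z₀| < 1`: the factor `exp(-π|y|²/2)` is dropped,
    -- since compact support of `w` already ensures integrability.
    set bound : ℂ → ℝ := fun y =>
      Real.pi * ‖y‖ * (Real.exp (Real.pi * (‖z₀‖ + 1) * ‖y‖) * ‖w y‖) with hb
    have hbc : Continuous bound := by fun_prop
    have hbs : HasCompactSupport bound := hs.norm.mul_left.mul_left
    have h := hasDerivAt_integral_of_dominated_loc_of_deriv_le (μ := volume) (F := F) (F' := F')
      (x₀ := z₀) (s := Metric.ball z₀ 1) (bound := bound) (Metric.ball_mem_nhds z₀ one_pos)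
      (Filter.Eventually.of_forall fun z => (hc z).aestronglyMeasurable)
      ((hc z₀).integrable_of_hasCompactSupport hs.mul_left)
      (by fun_prop : Continuous (F' z₀)).aestronglyMeasurable
      (Filter.Eventually.of_forall fun y z hz => by
        have hz' : ‖z‖ ≤ ‖z₀‖ + 1 := by
          have h1 : ‖z - z₀‖ < 1 := by simpa [dist_eq_norm] using hz
          have h2 := norm_add_le z₀ (z - z₀)
          rw [add_sub_cancel] at h2
          linarith
        simp only [hF', hF, hb, norm_mul, Complex.norm_real, RCLike.norm_conj, Complex.norm_exp,
          Real.norm_of_nonneg Real.pi_pos.le]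
        gcongr
        have h3 : (Real.pi * z * (starRingEnd ℂ) y).re ≤ Real.pi * (‖z₀‖ + 1) * ‖y‖ := by
          refine (Complex.re_le_norm _).trans ?_
          rw [norm_mul, norm_mul, Complex.norm_real, RCLike.norm_conj,
            Real.norm_of_nonneg Real.pi_pos.le]
          gcongr
        rw [Complex.sub_re, Complex.ofReal_re]
        have : 0 ≤ Real.pi / 2 * ‖y‖ ^ 2 := by positivity
        linarith)
      (hbc.integrable_of_hasCompactSupport hbs)
      (Filter.Eventually.of_forall fun y z _ => by
        have h1 : HasDerivAt (fun z : ℂ => Real.pi * z * (starRingEnd ℂ) y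
            - (Real.pi / 2 * ‖y‖ ^ 2 : ℝ)) (Real.pi * 1 * (starRingEnd ℂ) y) z :=
          (((hasDerivAt_id z).const_mul (Real.pi : ℂ)).mul_const _).sub_const _
        have h2 := (h1.cexp).mul_const (w y)
        refine h2.congr_deriv ?_
        change _ = (Real.pi : ℂ) * (starRingEnd ℂ) y * (_ * w y)
        ring)
    exact h.2.differentiableAt
  · rw [proj₀_eq, mul_comm, ← integral_const_mul]
    congr 1
    ext y
    rw [kernel₀_eq, mul_assoc]

/-- The projected function need not have compact support, so integrability of `f` is itself deduced
from the comparison with `g`. -/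
theorem abs_integral_sub_le_of_abs_sub_le {f g E : ℂ → ℝ} (hf : Continuous f) (hg : Continuous g)
    (hgi : Integrable g) (hE : Integrable E) {c X : ℝ} (hc : 0 ≤ c) (hX : ∫ z, E z ≤ X)
    (h : ∀ z, |f z - g z| ≤ c * E z) :
    Integrable f ∧ |(∫ z, f z) - ∫ z, g z| ≤ c * X := by
  have hd : Integrable fun z => f z - g z :=
    (hE.const_mul c).mono' (hf.sub hg).aestronglyMeasurable (Filter.Eventually.of_forall h)
  have hfi : Integrable f := by
    have := hd.add hgi
    simpa [Pi.add_def] using this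
  refine ⟨hfi, ?_⟩
  rw [← integral_sub hfi hgi, ← Real.norm_eq_abs]
  calc _ ≤ ∫ z, c * E z :=
        norm_integral_le_of_norm_le (hE.const_mul c) (Filter.Eventually.of_forall h)
    _ = c * ∫ z, E z := integral_const_mul _ _
    _ ≤ _ := by gcongr

/-- The unnormalized trial profile `u_τ √(1 - |Dz|²)₊`. -/
noncomputable def profile (S₁ S₂ : ℝ) (z : ℂ) : ℂ :=
  uTau hexTau z * (√(parab (scaleMap S₁ S₂ z)) : ℝ)

theorem continuous_profile (S₁ S₂ : ℝ) : Continuous (profile S₁ S₂) := by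
  have h1 := continuous_uTau hexTau_im_pos
  have h2 := continuous_parab
  have h3 := continuous_scaleMap S₁ S₂
  unfold profile
  fun_prop

theorem hasCompactSupport_parab_comp_scaleMap {S₁ S₂ : ℝ} (h1 : 0 < S₁) (h2 : 0 < S₂) :
    HasCompactSupport fun z => parab (scaleMap S₁ S₂ z) := by
  refine HasCompactSupport.of_support_subset_isCompact
    (isCompact_closedBall (0 : ℂ) (S₁ + S₂)) fun z hz => ?_
  by_contra hc
  simp only [Metric.mem_closedBall, dist_zero_right, not_le] at hc
  refine hz (parab_eq_zero ?_)
  have h3 : ‖z‖ ≤ |z.re| + |z.im| := Complex.norm_le_abs_re_add_abs_im z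
  have h4 : |z.re| ≤ S₁ * ‖scaleMap S₁ S₂ z‖ := by
    have := Complex.abs_re_le_norm (scaleMap S₁ S₂ z)
    rw [scaleMap_re, abs_div, abs_of_pos h1, div_le_iff₀ h1] at this
    linarith
  have h5 : |z.im| ≤ S₂ * ‖scaleMap S₁ S₂ z‖ := by
    have := Complex.abs_im_le_norm (scaleMap S₁ S₂ z)
    rw [scaleMap_im, abs_div, abs_of_pos h2, div_le_iff₀ h2] at this
    linarith
  by_contra hlt
  nlinarith

theorem hasCompactSupport_profile {S₁ S₂ : ℝ} (h1 : 0 < S₁) (h2 : 0 < S₂) :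
    HasCompactSupport (profile S₁ S₂) := by
  have h := (hasCompactSupport_parab_comp_scaleMap h1 h2).comp_left
    (g := fun x : ℝ => ((√x : ℝ) : ℂ)) (by simp)
  exact h.mul_left

theorem norm_profile_sq (S₁ S₂ : ℝ) (z : ℂ) :
    ‖profile S₁ S₂ z‖ ^ 2 = ‖uTau hexTau z‖ ^ 2 * parab (scaleMap S₁ S₂ z) := by
  rw [profile, norm_mul, mul_pow, Complex.norm_real, Real.norm_of_nonneg (Real.sqrt_nonneg _),
    Real.sq_sqrt (parab_nonneg _)]

theorem norm_profile_le {B : ℝ} (hB : ∀ z, ‖uTau hexTau z‖ ≤ B) (S₁ S₂ : ℝ) (z : ℂ) :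
    ‖profile S₁ S₂ z‖ ≤ B := by
  have hB0 : 0 ≤ B := (norm_nonneg _).trans (hB 0)
  rw [profile, norm_mul, Complex.norm_real, Real.norm_of_nonneg (Real.sqrt_nonneg _)]
  calc _ ≤ B * 1 := mul_le_mul (hB z) (Real.sqrt_le_one.2 (parab_le_one _)) (Real.sqrt_nonneg _) hB0
    _ = B := mul_one B

theorem continuous_proj₀_profile {S₁ S₂ : ℝ} (h1 : 0 < S₁) (h2 : 0 < S₂) :
    Continuous (proj₀ (profile S₁ S₂)) := by
  obtain ⟨f, hf, he⟩ := exists_entire_proj₀ (continuous_profile S₁ S₂) (hasCompactSupport_profile h1 h2)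
  rw [funext he]
  have := hf.continuous
  fun_prop

/-- The mean of `|u_τ|²` for the hexagonal lattice. -/
noncomputable def meanSq : ℝ := ⨍ z in cell hexTau, ‖uTau hexTau z‖ ^ 2

theorem meanSq_pos : 0 < meanSq := by
  rw [meanSq, setAverage_norm_uTau_sq hexTau_im_pos]
  have := hexTau_im_pos
  positivity

theorem setAverage_pow_four : ⨍ z in cell hexTau, ‖uTau hexTau z‖ ^ 4 = b * meanSq ^ 2 := by
  have h := meanSq_pos
  rw [b, gammaTau]
  change _ = _ / meanSq ^ 2 * meanSq ^ 2
  rw [div_mul_cancel₀ _ (by positivity)]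

/-- The mass, the potential energy and the interaction energy of the trial function. -/
theorem exists_trial_estimates :
    ∃ C : ℝ, 0 ≤ C ∧ ∀ S₁ S₂ : ℝ, 1 ≤ S₂ → S₂ ≤ S₁ →
      (Integrable (fun z => ‖proj₀ (profile S₁ S₂) z‖ ^ 2) ∧
        |(∫ z, ‖proj₀ (profile S₁ S₂) z‖ ^ 2) - meanSq * (Real.pi / 2) * (S₁ * S₂)|
          ≤ C * (S₁ * S₂ / √S₂)) ∧
      (Integrable (fun z => ‖scaleMap S₁ S₂ z‖ ^ 2 * ‖proj₀ (profile S₁ S₂) z‖ ^ 2) ∧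
        |(∫ z, ‖scaleMap S₁ S₂ z‖ ^ 2 * ‖proj₀ (profile S₁ S₂) z‖ ^ 2)
          - meanSq * (Real.pi / 6) * (S₁ * S₂)| ≤ C * (S₁ * S₂ / √S₂)) ∧
      (Integrable (fun z => ‖proj₀ (profile S₁ S₂) z‖ ^ 4) ∧
        |(∫ z, ‖proj₀ (profile S₁ S₂) z‖ ^ 4) - b * meanSq ^ 2 * (Real.pi / 3) * (S₁ * S₂)|
          ≤ C * (S₁ * S₂ / √S₂)) := by
  have hτ := hexTau_im_pos
  obtain ⟨B, hB0, hB⟩ := exists_norm_uTau_le hτ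
  obtain ⟨C0, hC0, H0⟩ := exists_lintegral_proj₀_sub_le hτ isBump_sqrt_parab
  have hF2 := isCellPeriodic_norm_uTau_pow hτ hB 2
  have hF4 := isCellPeriodic_norm_uTau_pow hτ hB 4
  obtain ⟨C1, hC1, H1⟩ := exists_abs_integral_mul_sub_le hτ hF2 isBump_parab
  obtain ⟨C2, hC2, H2⟩ := exists_abs_integral_mul_sub_le hτ hF2 isBump_norm_sq_mul_parab
  obtain ⟨C3, hC3, H3⟩ := exists_abs_integral_mul_sub_le hτ hF4 isBump_parab_sq
  refine ⟨3 * B * C0 + 15 * B ^ 3 * C0 + C1 + C2 + C3, by positivity, fun S₁ S₂ h2 h12 => ?_⟩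
  have p2 : 0 < S₂ := by linarith
  have p1 : 0 < S₁ := by linarith
  have hX : 0 ≤ S₁ * S₂ / √S₂ := by positivity
  set X := S₁ * S₂ / √S₂ with hXdef
  set v := proj₀ (profile S₁ S₂) with hv
  set w := profile S₁ S₂ with hw
  set q : ℂ → ℝ := fun z => ‖scaleMap S₁ S₂ z‖ ^ 2 with hq
  have hqc : Continuous q := (continuous_scaleMap S₁ S₂).norm.pow 2
  have hvc : Continuous v := continuous_proj₀_profile p1 p2
  have hwc : Continuous w := continuous_profile S₁ S₂
  have hws : HasCompactSupport w := hasCompactSupport_profile p1 p2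
  have hvB : ∀ z, ‖v z‖ ≤ 2 * B := norm_proj₀_le (norm_profile_le hB S₁ S₂)
  have hwB : ∀ z, ‖w z‖ ≤ B := norm_profile_le hB S₁ S₂
  -- One weighted error controls all three quantities: with `|v| ≤ 2B` and `|w| ≤ B`, differences of
  -- squares cost `3B` and of fourth powers `5B² · 3B`; the part `q` of the weight is for the
  -- potential.
  set E : ℂ → ℝ := fun z => (1 + q z) * ‖v z - w z‖ with hE
  have hEc : Continuous E := by fun_prop
  have hE0 : ∀ z, 0 ≤ E z := fun z => by
    simp only [hE, hq]
    positivity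
  have hElin : ∫⁻ z, ENNReal.ofReal (E z) ≤ ENNReal.ofReal (C0 * X) := by
    refine le_trans (le_of_eq (lintegral_congr fun z => ?_)) (H0 S₁ S₂ h2 h12)
    simp only [hE, hq]
    rw [ENNReal.ofReal_mul (by positivity), ofReal_norm]
    rfl
  have hEi : Integrable E := by
    refine ⟨hEc.aestronglyMeasurable, ?_⟩
    rw [hasFiniteIntegral_iff_ofReal (Filter.Eventually.of_forall hE0)]
    exact hElin.trans_lt ENNReal.ofReal_lt_top
  have hEX : ∫ z, E z ≤ C0 * X := by
    rw [integral_eq_lintegral_of_nonneg_ae (Filter.Eventually.of_forall hE0) hEc.aestronglyMeasurable]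
    exact ENNReal.toReal_le_of_le_ofReal (by positivity) hElin
  have hd : ∀ z, |‖v z‖ - ‖w z‖| ≤ ‖v z - w z‖ := fun z => abs_norm_sub_norm_le _ _
  have hd2 : ∀ z, |‖v z‖ ^ 2 - ‖w z‖ ^ 2| ≤ 3 * B * ‖v z - w z‖ := fun z => by
    rw [sq_sub_sq, abs_mul, abs_of_nonneg (by positivity)]
    refine mul_le_mul ?_ (hd z) (abs_nonneg _) (by positivity)
    linarith [hvB z, hwB z]
  have hq0 : ∀ z, 0 ≤ q z := fun z => by positivity
  have hsub : ∀ z, ‖v z - w z‖ ≤ E z := fun z => by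
    have := mul_nonneg (hq0 z) (norm_nonneg (v z - w z))
    simp only [hE]
    linarith
  have hqsub : ∀ z, q z * ‖v z - w z‖ ≤ E z := fun z => by
    have := norm_nonneg (v z - w z)
    simp only [hE]
    linarith
  have cw2 : HasCompactSupport fun z => ‖w z‖ ^ 2 := by
    refine hws.norm.comp_left (g := fun x : ℝ => x ^ 2) (by norm_num)
  have cw4 : HasCompactSupport fun z => ‖w z‖ ^ 4 := by
    refine hws.norm.comp_left (g := fun x : ℝ => x ^ 4) (by norm_num)
  have w2 : ∀ z, ‖w z‖ ^ 2 = ‖uTau hexTau z‖ ^ 2 * parab (scaleMap S₁ S₂ z) := norm_profile_sq S₁ S₂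
  have w4 : ∀ z, ‖w z‖ ^ 4 = ‖uTau hexTau z‖ ^ 4 * parab (scaleMap S₁ S₂ z) ^ 2 := fun z => by
    have := congrArg (· ^ 2) (w2 z)
    simp only [mul_pow, ← pow_mul] at this
    exact this
  have wq : ∀ z, q z * ‖w z‖ ^ 2 = ‖uTau hexTau z‖ ^ 2
      * (‖scaleMap S₁ S₂ z‖ ^ 2 * parab (scaleMap S₁ S₂ z)) := fun z => by
    rw [w2]
    ring
  obtain ⟨I1, J1⟩ := abs_integral_sub_le_of_abs_sub_le (f := fun z => ‖v z‖ ^ 2)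
    (g := fun z => ‖w z‖ ^ 2) (by fun_prop) (by fun_prop)
    ((by fun_prop : Continuous fun z => ‖w z‖ ^ 2).integrable_of_hasCompactSupport cw2) hEi
    (c := 3 * B) (by positivity) hEX (fun z => (hd2 z).trans (by gcongr; exact hsub z))
  obtain ⟨I2, J2⟩ := abs_integral_sub_le_of_abs_sub_le (f := fun z => q z * ‖v z‖ ^ 2)
    (g := fun z => q z * ‖w z‖ ^ 2) (by fun_prop) (by fun_prop)
    ((by fun_prop : Continuous fun z => q z * ‖w z‖ ^ 2).integrable_of_hasCompactSupport cw2.mul_left) hEi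
    (c := 3 * B) (by positivity) hEX (fun z => by
      rw [← mul_sub, abs_mul, abs_of_nonneg (hq0 z)]
      calc _ ≤ q z * (3 * B * ‖v z - w z‖) := mul_le_mul_of_nonneg_left (hd2 z) (hq0 z)
        _ = 3 * B * (q z * ‖v z - w z‖) := by ring
        _ ≤ _ := by gcongr; exact hqsub z)
  obtain ⟨I3, J3⟩ := abs_integral_sub_le_of_abs_sub_le (f := fun z => ‖v z‖ ^ 4)
    (g := fun z => ‖w z‖ ^ 4) (by fun_prop) (by fun_prop)
    ((by fun_prop : Continuous fun z => ‖w z‖ ^ 4).integrable_of_hasCompactSupport cw4) hEi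
    (c := 15 * B ^ 3) (by positivity) hEX (fun z => by
      have e : ‖v z‖ ^ 4 - ‖w z‖ ^ 4 = (‖v z‖ ^ 2 + ‖w z‖ ^ 2) * (‖v z‖ ^ 2 - ‖w z‖ ^ 2) := by ring
      have h5 : ‖v z‖ ^ 2 ≤ (2 * B) ^ 2 := pow_le_pow_left₀ (norm_nonneg _) (hvB z) 2
      have h6 : ‖w z‖ ^ 2 ≤ B ^ 2 := pow_le_pow_left₀ (norm_nonneg _) (hwB z) 2
      rw [e, abs_mul, abs_of_nonneg (by positivity)]
      calc _ ≤ (5 * B ^ 2) * (3 * B * ‖v z - w z‖) :=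
            mul_le_mul (by linarith) (hd2 z) (abs_nonneg _) (by positivity)
        _ = 15 * B ^ 3 * ‖v z - w z‖ := by ring
        _ ≤ _ := by gcongr; exact hsub z)
  have K1 := H1 S₁ S₂ h2 h12
  have K2 := H2 S₁ S₂ h2 h12
  have K3 := H3 S₁ S₂ h2 h12
  simp only [← w2, ← w4, ← wq] at K1 K2 K3
  rw [integral_parab] at K1
  rw [integral_norm_sq_mul_parab] at K2
  rw [integral_parab_sq, setAverage_pow_four] at K3
  change |_ - meanSq * _| ≤ _ at K1
  change |_ - meanSq * _| ≤ _ at K2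
  have a1 : 0 ≤ B * (C0 * X) := by positivity
  have a2 : 0 ≤ B ^ 3 * (C0 * X) := by positivity
  have a3 : 0 ≤ C1 * X := by positivity
  have a4 : 0 ≤ C2 * X := by positivity
  have a5 : 0 ≤ C3 * X := by positivity
  rw [abs_le] at J1 J2 J3 K1 K2 K3
  refine ⟨⟨I1, abs_le.2 ⟨?_, ?_⟩⟩, ⟨I2, abs_le.2 ⟨?_, ?_⟩⟩, I3, abs_le.2 ⟨?_, ?_⟩⟩
  · linarith [J1.1, K1.1]
  · linarith [J1.2, K1.2]
  · linarith [J2.1, K2.1]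
  · linarith [J2.2, K2.2]
  · linarith [J3.1, K3.1]
  · linarith [J3.2, K3.2]


/-! ### The energy of the normalized trial function. -/

theorem b_pos : 0 < b := by
  have := abs_lt.1 abs_b_sub_lt
  norm_num at this
  linarith [this.1]

theorem one_le_b : 1 ≤ b := by
  have := abs_lt.1 abs_b_sub_lt
  norm_num at this
  linarith [this.1]

/-- Stability of the energy per particle with respect to the mass, the potential energy and the
interaction energy. -/
theorem abs_energy_ratio_sub_le {a c X n₂ nq n₄ : ℝ} (ha : 0 < a) (hc : 0 < c)
    (hXa : X ≤ a / 2) (h2 : |n₂ - a| ≤ X) (hq : |nq - a / 3| ≤ X)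
    (h4 : |n₄ - c * a ^ 2| ≤ X) :
    |1 / 2 * (nq / n₂) + 1 / (6 * c) * (n₄ / n₂ ^ 2) - 1 / 3|
      ≤ (2 / a + 2 / (3 * c * a ^ 2) + 2 / a) * X := by
  have hX : 0 ≤ X := (abs_nonneg _).trans h2
  have hn : a / 2 ≤ n₂ := by linarith [(abs_le.1 h2).1]
  have hn0 : 0 < n₂ := by linarith
  -- At the unperturbed values `a`, `a/3`, `c a²` both terms equal `1/6`; the identity isolates the
  -- deviations from these values.
  have e : 1 / 2 * (nq / n₂) + 1 / (6 * c) * (n₄ / n₂ ^ 2) - 1 / 3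
      = ((nq - a / 3) - (n₂ - a) / 3) / (2 * n₂)
        + ((n₄ - c * a ^ 2) - c * ((n₂ - a) * (n₂ + a))) / (6 * c * n₂ ^ 2) := by
    field_simp
    ring
  have A : |((nq - a / 3) - (n₂ - a) / 3) / (2 * n₂)| ≤ 2 / a * X := by
    rw [abs_div, abs_of_pos (by positivity : 0 < 2 * n₂), div_le_iff₀ (by positivity)]
    have h1 : |(nq - a / 3) - (n₂ - a) / 3| ≤ 2 * X := by
      rw [abs_le] at h2 hq ⊢
      constructor <;> linarith [h2.1, h2.2, hq.1, hq.2]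
    have h3 : 2 / a * X * (2 * n₂) = 4 * X * (n₂ / a) := by ring
    have h5 : 1 / 2 ≤ n₂ / a := by
      rw [le_div_iff₀ ha]
      linarith
    rw [h3]
    nlinarith
  have hr : 1 / 2 ≤ n₂ / a := by
    rw [le_div_iff₀ ha]
    linarith
  have B1 : |(n₄ - c * a ^ 2) / (6 * c * n₂ ^ 2)| ≤ 2 / (3 * c * a ^ 2) * X := by
    rw [abs_div, abs_of_pos (by positivity : 0 < 6 * c * n₂ ^ 2), div_le_iff₀ (by positivity)]
    have h3 : 2 / (3 * c * a ^ 2) * X * (6 * c * n₂ ^ 2) = 4 * X * (n₂ / a) ^ 2 := by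
      field_simp
      ring
    have h5 : 1 / 4 ≤ (n₂ / a) ^ 2 := by nlinarith
    rw [h3]
    have h6 := mul_le_mul_of_nonneg_left h5 hX
    linarith
  have B2 : |c * ((n₂ - a) * (n₂ + a)) / (6 * c * n₂ ^ 2)| ≤ 2 / a * X := by
    have e2 : c * ((n₂ - a) * (n₂ + a)) / (6 * c * n₂ ^ 2)
        = (n₂ - a) * ((n₂ + a) / (6 * n₂ ^ 2)) := by
      field_simp
    rw [e2, abs_mul, mul_comm (2 / a), abs_of_pos (by positivity : 0 < (n₂ + a) / (6 * n₂ ^ 2))]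
    refine mul_le_mul h2 ?_ (by positivity) hX
    rw [div_le_div_iff₀ (by positivity) ha]
    nlinarith
  have e3 : ((n₄ - c * a ^ 2) - c * ((n₂ - a) * (n₂ + a))) / (6 * c * n₂ ^ 2)
      = (n₄ - c * a ^ 2) / (6 * c * n₂ ^ 2) - c * ((n₂ - a) * (n₂ + a)) / (6 * c * n₂ ^ 2) :=
    sub_div _ _ _
  rw [e, e3]
  calc _ ≤ |((nq - a / 3) - (n₂ - a) / 3) / (2 * n₂)| + (|(n₄ - c * a ^ 2) / (6 * c * n₂ ^ 2)|
        + |c * ((n₂ - a) * (n₂ + a)) / (6 * c * n₂ ^ 2)|) :=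
        (abs_add_le _ _).trans (by gcongr; exact abs_sub _ _)
    _ ≤ _ := by linarith

/-- Divided by `S₁ S₂`, the three integrals are perturbations of `a`, `a/3` and `c a²` of size
`1/√S₂`. The ratio `n₄ / n₂²` carries the factor `S₁ S₂` because of the scaling of the interaction.
-/
theorem exists_trial_ratio_estimate :
    ∃ C δ : ℝ, 0 < C ∧ 0 < δ ∧ ∀ S₁ S₂ : ℝ, 1 ≤ S₂ → S₂ ≤ S₁ → 1 / √S₂ ≤ δ →
      0 < ∫ z, ‖proj₀ (profile S₁ S₂) z‖ ^ 2 ∧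
      |1 / 2 * ((∫ z, ‖scaleMap S₁ S₂ z‖ ^ 2 * ‖proj₀ (profile S₁ S₂) z‖ ^ 2)
          / ∫ z, ‖proj₀ (profile S₁ S₂) z‖ ^ 2)
        + Real.pi / (8 * b) * (S₁ * S₂ * (∫ z, ‖proj₀ (profile S₁ S₂) z‖ ^ 4)
          / (∫ z, ‖proj₀ (profile S₁ S₂) z‖ ^ 2) ^ 2) - 1 / 3| ≤ C * (1 / √S₂) := by
  obtain ⟨C, hC, H⟩ := exists_trial_estimates
  have hm := meanSq_pos
  have hb := b_pos
  have hpi := Real.pi_pos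
  set a := meanSq * (Real.pi / 2) with ha
  -- Chosen so that `c a²` is the interaction value `b · meanSq² · π/3`; then `1/(6c)` is the
  -- coefficient `π/(8b)`.
  set c := 4 * b / (3 * Real.pi) with hc
  have ha0 : 0 < a := by positivity
  have hc0 : 0 < c := by positivity
  refine ⟨(2 / a + 2 / (3 * c * a ^ 2) + 2 / a) * (C + 1), a / 2 / (C + 1), by positivity,
    by positivity, fun S₁ S₂ h2 h12 hδ => ?_⟩
  have p2 : 0 < S₂ := by linarith
  have p1 : 0 < S₁ := by linarith
  obtain ⟨⟨_, H2⟩, ⟨_, Hq⟩, ⟨_, H4⟩⟩ := H S₁ S₂ h2 h12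
  set N := ∫ z, ‖proj₀ (profile S₁ S₂) z‖ ^ 2
  set Q := ∫ z, ‖scaleMap S₁ S₂ z‖ ^ 2 * ‖proj₀ (profile S₁ S₂) z‖ ^ 2
  set F := ∫ z, ‖proj₀ (profile S₁ S₂) z‖ ^ 4
  set J := S₁ * S₂ with hJ
  have hJ0 : 0 < J := by positivity
  set X := (C + 1) * (1 / √S₂) with hX
  have hs : 0 < 1 / √S₂ := by positivity
  have scale : ∀ x y : ℝ, |x - y * J| ≤ C * (J / √S₂) → |x / J - y| ≤ X := by
    intro x y hxy
    have e : x / J - y = (x - y * J) / J := by field_simp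
    rw [e, abs_div, abs_of_pos hJ0, div_le_iff₀ hJ0]
    refine hxy.trans ?_
    have : C * (J / √S₂) = C * (1 / √S₂) * J := by ring
    rw [this, hX]
    gcongr
    linarith
  have k2 := scale _ _ H2
  have kq := scale _ _ Hq
  have k4 := scale _ _ H4
  have eq1 : meanSq * (Real.pi / 6) = a / 3 := by rw [ha]; ring
  have eq2 : b * meanSq ^ 2 * (Real.pi / 3) = c * a ^ 2 := by
    rw [hc, ha]
    field_simp
    ring
  rw [eq1] at kq
  rw [eq2] at k4
  have hXa : X ≤ a / 2 := by
    rw [le_div_iff₀ (by positivity)] at hδ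
    rw [hX]
    linarith
  have main := abs_energy_ratio_sub_le ha0 hc0 hXa k2 kq k4
  have hN : 0 < N := by
    have : 0 < N / J := by linarith [(abs_le.1 k2).1]
    rwa [div_pos_iff_of_pos_right hJ0] at this
  refine ⟨hN, ?_⟩
  have e1 : Q / J / (N / J) = Q / N := by field_simp
  have e2 : F / J / (N / J) ^ 2 = J * F / N ^ 2 := by field_simp
  have e3 : 1 / (6 * c) = Real.pi / (8 * b) := by
    rw [hc]
    field_simp
    norm_num
  rw [e1, e2, e3] at main
  rw [mul_assoc _ (C + 1)]
  exact main

theorem eLpNorm_two_eq {v : ℂ → ℂ} (hm : AEStronglyMeasurable v volume)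
    (hv : Integrable fun z => ‖v z‖ ^ 2) :
    MemLp v 2 volume ∧ eLpNorm v 2 volume = ENNReal.ofReal √(∫ z, ‖v z‖ ^ 2) := by
  have h : MemLp v 2 volume := (memLp_two_iff_integrable_sq_norm hm).2 hv
  refine ⟨h, ?_⟩
  rw [h.eLpNorm_eq_integral_rpow_norm (by norm_num) (by norm_num)]
  congr 1
  rw [Real.sqrt_eq_rpow]
  norm_num

/-- The energy of the normalization of a multiple of `v`. -/
theorem energy_normalize_eq {ε κ g0 Λ : ℝ} (hg : 0 ≤ g0) (hΛ : 0 ≤ Λ) {q : ℂ → ℝ}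
    (hq0 : ∀ z, 0 ≤ q z)
    (hq : ∀ z : ℂ, ε ^ 2 * z.re ^ 2 + κ ^ 2 * z.im ^ 2 = Λ * q z) {v : ℂ → ℂ}
    (hvc : Continuous v) (h2 : Integrable fun z => ‖v z‖ ^ 2)
    (hq2 : Integrable fun z => q z * ‖v z‖ ^ 2) (h4 : Integrable fun z => ‖v z‖ ^ 4)
    (hN : 0 < ∫ z, ‖v z‖ ^ 2) {A : ℝ} (hA : 0 < A) :
    energy ε κ g0 (normalize fun z => (A : ℂ) * v z) = ENNReal.ofReal
      (Λ / 2 * ((∫ z, q z * ‖v z‖ ^ 2) / ∫ z, ‖v z‖ ^ 2)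
        + g0 / 2 * ((∫ z, ‖v z‖ ^ 4) / (∫ z, ‖v z‖ ^ 2) ^ 2)) := by
  set N := ∫ z, ‖v z‖ ^ 2 with hNdef
  have hAv : ∀ z, ‖(A : ℂ) * v z‖ ^ 2 = A ^ 2 * ‖v z‖ ^ 2 := fun z => by
    rw [norm_mul, mul_pow, Complex.norm_real, Real.norm_of_nonneg hA.le]
  have hL := (eLpNorm_two_eq (v := fun z => (A : ℂ) * v z) (by fun_prop : Continuous fun z =>
    (A : ℂ) * v z).aestronglyMeasurable (by simp only [hAv]; exact h2.const_mul _)).2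
  simp only [hAv] at hL
  rw [integral_const_mul, ← hNdef, Real.sqrt_mul (by positivity), Real.sqrt_sq hA.le] at hL
  have hnorm : ∀ z, ‖normalize (fun z => (A : ℂ) * v z) z‖ = ‖v z‖ / √N := fun z => by
    have hN' := Real.sqrt_pos.2 hN
    rw [normalize, hL, ENNReal.toReal_ofReal (by positivity), norm_div, norm_mul, Complex.norm_real,
      Complex.norm_real, Real.norm_of_nonneg hA.le, Real.norm_of_nonneg (by positivity)]
    field_simp
  have hint : ∀ z, (ENNReal.ofReal (1 / 2 * (ε ^ 2 * z.re ^ 2 + κ ^ 2 * z.im ^ 2))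
      * ‖normalize (fun z => (A : ℂ) * v z) z‖ₑ ^ 2
      + ENNReal.ofReal (g0 / 2) * ‖normalize (fun z => (A : ℂ) * v z) z‖ₑ ^ 4)
      = ENNReal.ofReal (Λ / 2 / N * (q z * ‖v z‖ ^ 2) + g0 / 2 / N ^ 2 * ‖v z‖ ^ 4) := by
    intro z
    have h0 := hq0 z
    rw [hq, ← ofReal_norm, hnorm, ← ENNReal.ofReal_pow (by positivity),
      ← ENNReal.ofReal_pow (by positivity), ← ENNReal.ofReal_mul (by positivity),
      ← ENNReal.ofReal_mul (by positivity), ← ENNReal.ofReal_add (by positivity) (by positivity)]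
    congr 1
    have e1 : √N ^ 2 = N := Real.sq_sqrt hN.le
    have e2 : √N ^ 4 = N ^ 2 := by
      rw [show 4 = 2 * 2 by norm_num, pow_mul, e1]
    rw [div_pow, div_pow, e1, e2]
    ring
  rw [energy]
  simp only [hint]
  have hI : Integrable fun z => Λ / 2 / N * (q z * ‖v z‖ ^ 2) + g0 / 2 / N ^ 2 * ‖v z‖ ^ 4 :=
    (hq2.const_mul _).add (h4.const_mul _)
  rw [← ofReal_integral_eq_lintegral_ofReal hI
    (Filter.Eventually.of_forall fun z => by
      have := hq0 z
      positivity), integral_add (hq2.const_mul _) (h4.const_mul _),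
    integral_const_mul, integral_const_mul]
  congr 1
  ring

theorem eLpNorm_normalize {u : ℂ → ℂ} (h0 : eLpNorm u 2 volume ≠ 0) (ht : eLpNorm u 2 volume ≠ ⊤) :
    eLpNorm (normalize u) 2 volume = 1 := by
  have e : normalize u = ((((eLpNorm u 2 volume).toReal)⁻¹ : ℝ) : ℂ) • u := by
    ext z
    simp [normalize, div_eq_inv_mul]
  rw [e, eLpNorm_const_smul, ← ofReal_norm, Complex.norm_real, Real.norm_of_nonneg (by positivity),
    ENNReal.ofReal_inv_of_pos (ENNReal.toReal_pos h0 ht), ENNReal.ofReal_toReal ht,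
    ENNReal.inv_mul_cancel h0 ht]

theorem normalize_mem_Lambda₀ {u : ℂ → ℂ} (hu : u ∈ Lambda₀) : normalize u ∈ Lambda₀ := by
  obtain ⟨hm, f, hf, hfu⟩ := hu
  have e : normalize u = (((eLpNorm u 2 volume).toReal : ℂ)⁻¹) • u := by
    ext z
    simp [normalize, div_eq_inv_mul]
  refine ⟨by rw [e]; exact hm.const_smul _, fun z => f z / ((eLpNorm u 2 volume).toReal : ℂ),
    hf.div_const _, fun z => ?_⟩
  rw [normalize, hfu]
  ring


/-! ### A uniform gap between lowest Landau level densities and compactly supported ones. -/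

/-- The pointwise bound `|x| ≤ θ + x²/θ` converts `L²` smallness into `L¹` smallness, linear in `θ`,
on sets of finite measure. -/
theorem setIntegral_abs_le {x : ℂ → ℝ} {s : Set ℂ} (hsv : volume s ≠ ⊤)
    (hx : Continuous x) (hxi : Integrable fun z => x z ^ 2) {θ : ℝ} (hθ : 0 < θ)
    (hX : ∫ z, x z ^ 2 ≤ θ ^ 2) : ∫ z in s, |x z| ≤ θ * (volume.real s + 1) := by
  have hi : IntegrableOn (fun z => θ + x z ^ 2 / θ) s :=
    (integrableOn_const hsv).add (hxi.div_const θ).integrableOn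
  have hpt : ∀ z, |x z| ≤ θ + x z ^ 2 / θ := fun z => by
    rw [← sub_le_iff_le_add', le_div_iff₀ hθ, ← sq_abs (x z)]
    nlinarith [sq_nonneg (|x z| - θ), abs_nonneg (x z), sq_nonneg (|x z|)]
  have hi2 : IntegrableOn (fun z => |x z|) s :=
    hi.mono' hx.abs.aestronglyMeasurable (Filter.Eventually.of_forall fun z => by
      rw [Real.norm_eq_abs, abs_abs]
      exact hpt z)
  calc _ ≤ ∫ z in s, (θ + x z ^ 2 / θ) := integral_mono hi2 hi hpt
    _ = θ * volume.real s + (∫ z in s, x z ^ 2) / θ := by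
      have hc : Integrable (fun _ : ℂ => θ) (volume.restrict s) := integrableOn_const hsv
      rw [integral_add hc (hxi.div_const θ).integrableOn, setIntegral_const,
        integral_div, smul_eq_mul, mul_comm]
    _ ≤ θ * volume.real s + θ ^ 2 / θ := by
      gcongr
      exact (setIntegral_le_integral hxi (Filter.Eventually.of_forall fun z => sq_nonneg _)).trans hX
    _ = _ := by
      field_simp

/-- Mean value inequality for the square of an entire function over an annulus. -/
theorem norm_sq_mul_volume_annulus_le {f : ℂ → ℂ} (hf : Differentiable ℂ f) (z : ℂ) {r R : ℝ} :
    ‖f z‖ ^ 2 * volume.real {t : ℂ | ‖t‖ ∈ Set.Ioo r R}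
      ≤ ∫ t in {t : ℂ | ‖t‖ ∈ Set.Ioo r R}, ‖f (z + t)‖ ^ 2 := by
  set s : Set ℂ := {t : ℂ | ‖t‖ ∈ Set.Ioo r R} with hs
  have hso : IsOpen s := isOpen_Ioo.preimage continuous_norm
  have hsub : s ⊆ Metric.closedBall 0 R := fun t ht => by simpa using ht.2.le
  set χ : ℝ → ℝ := (Set.Ioo r R).indicator 1 with hχ
  have hind : ∀ (g : ℂ → ℂ), (fun t => (χ ‖t‖ : ℂ) * g t) = s.indicator g := fun g => by
    ext t
    by_cases h : ‖t‖ ∈ Set.Ioo r R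
    · rw [Set.indicator_of_mem (show t ∈ s from h), hχ, Set.indicator_of_mem h]
      simp
    · rw [Set.indicator_of_notMem (show t ∉ s from h), hχ, Set.indicator_of_notMem h]
      simp
  have hF : Differentiable ℂ fun t => f (z + t) ^ 2 := by
    have : Differentiable ℂ fun t => f (z + t) := hf.comp (by fun_prop)
    fun_prop
  have hint : IntegrableOn (fun t => f (z + t) ^ 2) s :=
    (hF.continuous.continuousOn.integrableOn_compact (isCompact_closedBall 0 R)).mono_set hsub
  have key := integral_radial_mul_entire (χ := χ) (measurable_one.indicator measurableSet_Ioo) hF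
    (by rw [hind]; exact hint.integrable_indicator hso.measurableSet)
  have h1 : (fun t : ℂ => (χ ‖t‖ : ℂ)) = s.indicator 1 := by
    have := hind 1
    simpa using this
  have h3 : ∫ t, s.indicator (1 : ℂ → ℂ) t = (volume.real s : ℂ) := by
    rw [integral_indicator hso.measurableSet]
    simp
  rw [hind, h1, integral_indicator hso.measurableSet, h3] at key
  have h2 := congrArg norm key
  rw [add_zero, norm_mul, norm_pow, Complex.norm_real, Real.norm_of_nonneg measureReal_nonneg] at h2
  rw [← h2]
  refine (norm_integral_le_integral_norm _).trans (le_of_eq ?_)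
  simp only [norm_pow]

/-- The density of a lowest Landau level function is bounded away from any compactly supported
density. -/
theorem exists_le_integral_sub_sq {p : ℂ → ℝ} (hp : Continuous p) (hps : HasCompactSupport p)
    (hp0 : 0 < p 0) :
    ∃ η : ℝ, 0 < η ∧ ∀ f : ℂ → ℂ, Differentiable ℂ f →
      Integrable (fun z => (‖f z‖ ^ 2 * Real.exp (-(Real.pi * ‖z‖ ^ 2)) - p z) ^ 2) →
      η ≤ ∫ z, (‖f z‖ ^ 2 * Real.exp (-(Real.pi * ‖z‖ ^ 2)) - p z) ^ 2 := by
  obtain ⟨R, hR0, hR⟩ : ∃ R : ℝ, 0 < R ∧ ∀ z : ℂ, R ≤ ‖z‖ → p z = 0 := by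
    obtain ⟨R, hR⟩ := hps.isCompact.isBounded.subset_closedBall 0
    refine ⟨|R| + 1, by positivity, fun z hz => ?_⟩
    by_contra hne
    have := hR (subset_tsupport p hne)
    simp only [Metric.mem_closedBall, dist_zero_right] at this
    linarith [le_abs_self R]
  obtain ⟨r, hr0, hr⟩ : ∃ r : ℝ, 0 < r ∧ ∀ z ∈ Metric.ball (0 : ℂ) r, p 0 / 2 < p z := by
    have : ∀ᶠ z in nhds (0 : ℂ), p 0 / 2 < p z :=
      hp.continuousAt.eventually (lt_mem_nhds (by linarith))
    obtain ⟨r, h1, h2⟩ := Metric.eventually_nhds_iff_ball.1 this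
    exact ⟨r, h1, h2⟩
  set ρ := min r 1 with hρ
  have hρ0 : 0 < ρ := by positivity
  -- The inner radius `R + 1` keeps `z + t` outside the support of `p` for every `|z| < 1`.
  set s : Set ℂ := {t : ℂ | ‖t‖ ∈ Set.Ioo (R + 1) (R + 2)} with hs
  have hso : IsOpen s := isOpen_Ioo.preimage continuous_norm
  have hsub : s ⊆ Metric.closedBall 0 (R + 2) := fun t ht => by simpa using ht.2.le
  have hsfin : volume s ≠ ⊤ :=
    ((measure_mono hsub).trans_lt (isCompact_closedBall 0 (R + 2)).measure_lt_top).ne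
  set V := volume.real s with hV
  have hV0 : 0 < V := by
    refine ENNReal.toReal_pos (hso.measure_pos volume ⟨((R + 3 / 2 : ℝ) : ℂ), ?_⟩).ne' hsfin
    change ‖((R + 3 / 2 : ℝ) : ℂ)‖ ∈ Set.Ioo (R + 1) (R + 2)
    rw [Complex.norm_real, Real.norm_of_nonneg (by positivity)]
    constructor <;> linarith
  set T : Set ℂ := Metric.ball 0 ρ with hT
  have hTfin : volume T ≠ ⊤ := measure_ball_lt_top.ne
  set W := volume.real T with hW
  have hW0 : 0 < W := ENNReal.toReal_pos (Metric.measure_ball_pos volume 0 hρ0).ne' hTfin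
  set G := Real.exp (Real.pi * (R + 3) ^ 2) with hG
  set K := G * (V + 1) / V with hK
  have hK0 : 0 < K := by positivity
  -- Small enough that the final inequality `p 0 / 2 * W ≤ θ (K W + W + 1)` would bound a positive
  -- number by its half.
  set θ := p 0 / 2 * W / (2 * (K * W + W + 1)) with hθ
  have hθ0 : 0 < θ := by positivity
  refine ⟨θ ^ 2, by positivity, fun f hf hint => ?_⟩
  by_contra hlt
  rw [not_le] at hlt
  set n : ℂ → ℝ := fun z => ‖f z‖ ^ 2 * Real.exp (-(Real.pi * ‖z‖ ^ 2)) with hn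
  have hfc := hf.continuous
  have hnc : Continuous n := by fun_prop
  have hn0 : ∀ z, 0 ≤ n z := fun z => by positivity
  -- On the translated annulus the density is its own distance to `p`, hence small in mean; the mean
  -- value inequality carries this to the centre `z`, with `G` compensating the Gaussian weight.
  have hsmall : ∀ z ∈ T, n z ≤ K * θ := by
    intro z hz
    have hz1 : ‖z‖ < 1 := by
      have : ‖z‖ < ρ := by simpa [hT] using hz
      exact this.trans_le (min_le_right _ _)
    have hmv := norm_sq_mul_volume_annulus_le hf z (r := R + 1) (R := R + 2)
    have hx : Continuous fun t => n (z + t) - p (z + t) := by fun_prop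
    have hb := setIntegral_abs_le (x := fun t => n (z + t) - p (z + t)) hsfin hx
      (hint.comp_add_left z) hθ0 (by
        rw [integral_add_left_eq_self (fun z => (n z - p z) ^ 2) z]
        exact hlt.le)
    have hcmp : ∫ t in s, ‖f (z + t)‖ ^ 2 ≤ ∫ t in s, G * |n (z + t) - p (z + t)| := by
      have c1 : Continuous fun t => ‖f (z + t)‖ ^ 2 := by fun_prop
      have c2 : Continuous fun t => G * |n (z + t) - p (z + t)| := by fun_prop
      refine setIntegral_mono_on
        ((c1.continuousOn.integrableOn_compact (isCompact_closedBall 0 (R + 2))).mono_set hsub)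
        ((c2.continuousOn.integrableOn_compact (isCompact_closedBall 0 (R + 2))).mono_set hsub)
        hso.measurableSet fun t ht => ?_
      have ht1 : R + 1 < ‖t‖ := ht.1
      have ht2 : ‖t‖ < R + 2 := ht.2
      have l1 : R ≤ ‖z + t‖ := by
        have := norm_sub_le (z + t) z
        rw [add_sub_cancel_left] at this
        linarith
      have l2 : ‖z + t‖ ≤ R + 3 := (norm_add_le z t).trans (by linarith)
      rw [hR _ l1, sub_zero, abs_of_nonneg (hn0 _)]
      have e : ‖f (z + t)‖ ^ 2 = Real.exp (Real.pi * ‖z + t‖ ^ 2) * n (z + t) := by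
        simp only [hn]
        rw [mul_left_comm, ← Real.exp_add, add_neg_cancel, Real.exp_zero, mul_one]
      rw [e]
      refine mul_le_mul_of_nonneg_right (Real.exp_le_exp.2 ?_) (hn0 _)
      gcongr
    rw [integral_const_mul] at hcmp
    have h1 : ‖f z‖ ^ 2 * V ≤ G * (θ * (V + 1)) :=
      hmv.trans (hcmp.trans (mul_le_mul_of_nonneg_left hb (Real.exp_pos _).le))
    have h2 : ‖f z‖ ^ 2 ≤ K * θ := by
      rw [hK, div_mul_eq_mul_div, le_div_iff₀ hV0]
      linarith
    refine le_trans ?_ h2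
    refine mul_le_of_le_one_right (by positivity) (Real.exp_le_one_iff.2 ?_)
    have : 0 ≤ Real.pi * ‖z‖ ^ 2 := by positivity
    linarith
  have hTm : MeasurableSet T := Metric.isOpen_ball.measurableSet
  -- On `T`, however, `p` exceeds `p 0 / 2`, so a small `n` forces `n - p` to have a definite `L¹`
  -- size.
  have hb := setIntegral_abs_le (x := fun t => n t - p t) hTfin (by fun_prop) hint hθ0 hlt.le
  have hlow : p 0 / 2 * W ≤ ∫ z in T, (K * θ + |n z - p z|) := by
    have c2 : Continuous fun z => K * θ + |n z - p z| := by fun_prop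
    have hi : IntegrableOn (fun z => K * θ + |n z - p z|) T :=
      (c2.continuousOn.integrableOn_compact (isCompact_closedBall 0 ρ)).mono_set
        Metric.ball_subset_closedBall
    have := setIntegral_mono_on (f := fun _ : ℂ => p 0 / 2) (integrableOn_const hTfin) hi hTm
      fun z hz => by
        have h1 := hr z (Metric.ball_subset_ball (min_le_left _ _) hz)
        have h2 := hsmall z hz
        have h3 := neg_abs_le (n z - p z)
        linarith
    rwa [setIntegral_const, smul_eq_mul, mul_comm] at this
  have habs : IntegrableOn (fun z => |n z - p z|) T := by
    have c2 : Continuous fun z => |n z - p z| := by fun_prop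
    exact (c2.continuousOn.integrableOn_compact (isCompact_closedBall 0 ρ)).mono_set
      Metric.ball_subset_closedBall
  have hc : Integrable (fun _ : ℂ => K * θ) (volume.restrict T) := integrableOn_const hTfin
  rw [integral_add hc habs, setIntegral_const, smul_eq_mul] at hlow
  have h1 : p 0 / 2 * W ≤ θ * (K * W + W + 1) := by
    change _ ≤ W * (K * θ) + _ at hlow
    change _ ≤ θ * (W + 1) at hb
    linarith
  have h2 : θ * (K * W + W + 1) = p 0 / 2 * W / 2 := by
    rw [hθ]
    field_simp
  have h3 : 0 < p 0 / 2 * W := by positivity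
  linarith


/-! ### Thomas-Fermi radii and the strict lower bound. -/

theorem R₁_pos {ε κ g0 : ℝ} (hε : 0 < ε) (hκ : 0 < κ) (hg : 0 < g0) : 0 < R₁ ε κ g0 := by
  unfold R₁
  positivity

theorem R₂_pos {ε κ g0 : ℝ} (hε : 0 < ε) (hκ : 0 < κ) (hg : 0 < g0) : 0 < R₂ ε κ g0 := by
  unfold R₂
  positivity

theorem R₁_pow_four {ε κ g0 : ℝ} (hε : 0 < ε) (hκ : 0 < κ) (hg : 0 < g0) :
    R₁ ε κ g0 ^ 4 = 4 * g0 * κ / (Real.pi * ε ^ 3) := by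
  rw [R₁, ← Real.rpow_natCast, ← Real.rpow_mul (by positivity)]
  norm_num

theorem R₂_pow_four {ε κ g0 : ℝ} (hε : 0 < ε) (hκ : 0 < κ) (hg : 0 < g0) :
    R₂ ε κ g0 ^ 4 = 4 * g0 * ε / (Real.pi * κ ^ 3) := by
  rw [R₂, ← Real.rpow_natCast, ← Real.rpow_mul (by positivity)]
  norm_num

theorem mul_R₁_pow_four {ε κ g0 : ℝ} (hε : 0 < ε) (hκ : 0 < κ) (hg : 0 < g0) :
    (ε * R₁ ε κ g0) ^ 4 = 4 * g0 * ε * κ / Real.pi := by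
  rw [mul_pow, R₁_pow_four hε hκ hg]
  field_simp

/-- This equality makes the potential isotropic in the variable scaled by `R₁` and `R₂`. -/
theorem mul_R₁_eq {ε κ g0 : ℝ} (hε : 0 < ε) (hκ : 0 < κ) (hg : 0 < g0) :
    ε * R₁ ε κ g0 = κ * R₂ ε κ g0 := by
  have h1 := R₁_pos hε hκ hg
  have h2 := R₂_pos hε hκ hg
  refine (pow_left_inj₀ (by positivity) (by positivity) (four_ne_zero)).1 ?_
  rw [mul_R₁_pow_four hε hκ hg, mul_pow, R₂_pow_four hε hκ hg]
  field_simp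

theorem mul_R₁_sq {ε κ g0 : ℝ} (hε : 0 < ε) (hκ : 0 < κ) (hg : 0 < g0) :
    (ε * R₁ ε κ g0) ^ 2 = 2 * √(g0 * ε * κ / Real.pi) := by
  have h1 := R₁_pos hε hκ hg
  refine (pow_left_inj₀ (by positivity) (by positivity) (two_ne_zero)).1 ?_
  rw [← pow_mul, mul_R₁_pow_four hε hκ hg, mul_pow, Real.sq_sqrt (by positivity)]
  ring

/-- The product of the radii of the ellipse. -/
theorem R₁_mul_R₂ {ε κ g0 : ℝ} (hε : 0 < ε) (hκ : 0 < κ) (hg : 0 < g0) :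
    (ε * R₁ ε κ g0) ^ 2 * (R₁ ε κ g0 * R₂ ε κ g0) = 4 * g0 / Real.pi := by
  have h1 := R₁_pos hε hκ hg
  have h2 := R₂_pos hε hκ hg
  have h3 := mul_R₁_pow_four hε hκ hg
  have h4 := mul_R₁_eq hε hκ hg
  have e : ε * κ * ((ε * R₁ ε κ g0) ^ 2 * (R₁ ε κ g0 * R₂ ε κ g0)) = (ε * R₁ ε κ g0) ^ 4 := by
    calc _ = (ε * R₁ ε κ g0) ^ 3 * (κ * R₂ ε κ g0) := by ring
      _ = _ := by rw [← h4]; ring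
  rw [h3] at e
  have h5 : 0 < ε * κ := by positivity
  refine mul_left_cancel₀ h5.ne' (e.trans ?_)
  ring

theorem energy_eq_lintegral_ofReal {ε κ g0 : ℝ} (hg : 0 ≤ g0) (u : ℂ → ℂ) :
    energy ε κ g0 u = ∫⁻ z : ℂ, ENNReal.ofReal
      (1 / 2 * (ε ^ 2 * z.re ^ 2 + κ ^ 2 * z.im ^ 2) * ‖u z‖ ^ 2 + g0 / 2 * (‖u z‖ ^ 2) ^ 2) := by
  rw [energy]
  refine lintegral_congr fun z => ?_
  rw [← ofReal_norm, ← ENNReal.ofReal_pow (by positivity), ← ENNReal.ofReal_pow (by positivity),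
    ← ENNReal.ofReal_mul (by positivity), ← ENNReal.ofReal_mul (by positivity),
    ← ENNReal.ofReal_add (by positivity) (by positivity), ← pow_mul]

theorem continuous_of_mem_Lambda₀ {u : ℂ → ℂ} (hu : u ∈ Lambda₀) : Continuous u := by
  obtain ⟨_, f, hf, hfu⟩ := hu
  have := hf.continuous
  rw [funext hfu]
  fun_prop

/-- Lower bound of the energy by the Thomas-Fermi energy plus the distance of the density to the
Thomas-Fermi density. -/
theorem thomasFermi_add_le_energy {ε κ g0 : ℝ} (hε : 0 < ε) (hκ : 0 < κ) (hg : 0 < g0) {u : ℂ → ℂ}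
    (hu : u ∈ Lambda₀) (h1 : eLpNorm u 2 volume = 1) (hfin : energy ε κ g0 u ≠ ⊤) {p : ℂ → ℝ}
    (hp : p = fun z => 2 / (Real.pi * (R₁ ε κ g0 * R₂ ε κ g0))
      * parab (scaleMap (R₁ ε κ g0) (R₂ ε κ g0) z)) :
    Integrable (fun z => (‖u z‖ ^ 2 - p z) ^ 2) ∧
      ENNReal.ofReal (2 / 3 * √(g0 * ε * κ / Real.pi) + g0 / 2 * ∫ z, (‖u z‖ ^ 2 - p z) ^ 2)
        ≤ energy ε κ g0 u := by
  have hR1 := R₁_pos hε hκ hg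
  have hR2 := R₂_pos hε hκ hg
  have hΛ := mul_R₁_sq hε hκ hg
  have hprod := R₁_mul_R₂ hε hκ hg
  have heq := mul_R₁_eq hε hκ hg
  have hpi := Real.pi_pos
  set r₁ := R₁ ε κ g0
  set r₂ := R₂ ε κ g0
  set A := 2 / (Real.pi * (r₁ * r₂)) with hA
  set Λ := (ε * r₁) ^ 2 with hΛdef
  have hA0 : 0 < A := by positivity
  have hΛ0 : 0 < Λ := by positivity
  -- The Euler-Lagrange relation: `g₀ p` equals `Λ/2` times the parabola, so `Λ/2` is the chemical
  -- potential.
  have hgA : g0 * A = Λ / 2 := by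
    have : g0 = Real.pi * (Λ * (r₁ * r₂)) / 4 := by
      rw [hprod]
      field_simp
    rw [this, hA]
    field_simp
    norm_num
  have huc := continuous_of_mem_Lambda₀ hu
  have hpc : Continuous p := by
    have := continuous_parab
    have := continuous_scaleMap r₁ r₂
    rw [hp]
    fun_prop
  have hq : ∀ z : ℂ, ε ^ 2 * z.re ^ 2 + κ ^ 2 * z.im ^ 2 = Λ * ‖scaleMap r₁ r₂ z‖ ^ 2 := fun z => by
    rw [norm_scaleMap_sq, mul_add]
    congr 1
    · rw [hΛdef]
      field_simp
    · rw [hΛdef, heq]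
      field_simp
  set n : ℂ → ℝ := fun z => ‖u z‖ ^ 2 with hn
  have hnc : Continuous n := by fun_prop
  have hn0 : ∀ z, 0 ≤ n z := fun z => by positivity
  have hni : Integrable n := (memLp_two_iff_integrable_sq_norm huc.aestronglyMeasurable).1 hu.1
  have hn1 : ∫ z, n z = 1 := by
    have := (eLpNorm_two_eq huc.aestronglyMeasurable hni).2
    rw [h1, eq_comm, ENNReal.ofReal_eq_one, Real.sqrt_eq_one] at this
    exact this
  set H : ℂ → ℝ := fun z => 1 / 2 * (ε ^ 2 * z.re ^ 2 + κ ^ 2 * z.im ^ 2) * n z + g0 / 2 * n z ^ 2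
    with hH
  have hHc : Continuous H := by
    have := Complex.continuous_re
    have := Complex.continuous_im
    fun_prop
  have hH0 : ∀ z, 0 ≤ H z := fun z => by
    have := hn0 z
    positivity
  have hEn : energy ε κ g0 u = ∫⁻ z, ENNReal.ofReal (H z) := energy_eq_lintegral_ofReal hg.le u
  have hHi : Integrable H := by
    refine ⟨hHc.aestronglyMeasurable, ?_⟩
    rw [hasFiniteIntegral_iff_ofReal (Filter.Eventually.of_forall hH0), ← hEn]
    exact hfin.lt_top
  have hpp : ∀ z, p z = A * parab (scaleMap r₁ r₂ z) := fun z => by rw [hp]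
  have hp2i : Integrable fun z => p z ^ 2 := by
    have := (isBump_parab_sq.integrable_comp_scaleMap hR1 hR2).const_mul (A ^ 2)
    simpa only [hpp, mul_pow] using this
  have hp2 : ∫ z, p z ^ 2 = 2 * A / 3 := by
    simp only [hpp, mul_pow]
    rw [integral_const_mul, integral_comp_scaleMap hR1 hR2 (f := fun ζ => parab ζ ^ 2)
      isBump_parab_sq.continuous, integral_parab_sq, hA]
    field_simp
  -- Uses `(n - p)² ≤ 2n² + 2p²`; finiteness of the energy makes `n²` integrable.
  have hdi : Integrable fun z => (n z - p z) ^ 2 := by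
    refine ((hHi.const_mul (4 / g0)).add (hp2i.const_mul 2)).mono' (by fun_prop)
      (Filter.Eventually.of_forall fun z => ?_)
    rw [Real.norm_of_nonneg (sq_nonneg _)]
    have hz := hn0 z
    have e : 2 * n z ^ 2 ≤ 4 / g0 * H z := by
      have : 4 / g0 * (g0 / 2 * n z ^ 2) = 2 * n z ^ 2 := by
        field_simp
        norm_num
      rw [← this]
      gcongr
      simp only [hH]
      have : 0 ≤ 1 / 2 * (ε ^ 2 * z.re ^ 2 + κ ^ 2 * z.im ^ 2) * n z := by positivity
      linarith
    simp only [Pi.add_apply]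
    nlinarith [sq_nonneg (n z + p z)]
  refine ⟨hdi, ?_⟩
  rw [hEn, ← ofReal_integral_eq_lintegral_ofReal hHi (Filter.Eventually.of_forall hH0)]
  apply ENNReal.ofReal_le_ofReal
  -- Completing the square, with `1 - |Dz|²` bounded by its positive part; equality can fail only
  -- outside the ellipse. Integration gives `Λ/2 - Λ/6 = Λ/3` plus the squared distance.
  have hpt : ∀ z, Λ / 2 * n z + g0 / 2 * (n z - p z) ^ 2 - g0 / 2 * p z ^ 2 ≤ H z := fun z => by
    simp only [hH]
    rw [hq]
    have h3 : 1 - ‖scaleMap r₁ r₂ z‖ ^ 2 ≤ parab (scaleMap r₁ r₂ z) := le_max_left _ _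
    have h4 : g0 * p z = Λ / 2 * parab (scaleMap r₁ r₂ z) := by
      rw [hpp, ← mul_assoc, hgA]
    have h5 : Λ / 2 * n z * (1 - ‖scaleMap r₁ r₂ z‖ ^ 2)
        ≤ Λ / 2 * n z * parab (scaleMap r₁ r₂ z) :=
      mul_le_mul_of_nonneg_left h3 (mul_nonneg (by positivity) (hn0 z))
    have h6 : g0 / 2 * (n z - p z) ^ 2 - g0 / 2 * p z ^ 2
        = g0 / 2 * n z ^ 2 - n z * (g0 * p z) := by ring
    rw [h4] at h6
    linarith
  have hi1 : Integrable fun z => Λ / 2 * n z + g0 / 2 * (n z - p z) ^ 2 :=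
    (hni.const_mul _).add (hdi.const_mul _)
  have := integral_mono (hi1.sub (hp2i.const_mul (g0 / 2))) hHi hpt
  have e : ∫ z, (Λ / 2 * n z + g0 / 2 * (n z - p z) ^ 2 - g0 / 2 * p z ^ 2)
      = Λ / 2 + g0 / 2 * (∫ z, (n z - p z) ^ 2) - g0 / 2 * (2 * A / 3) := by
    rw [integral_sub hi1 (hp2i.const_mul (g0 / 2)), integral_add (hni.const_mul _) (hdi.const_mul _),
      integral_const_mul, integral_const_mul, integral_const_mul, hn1, hp2, mul_one]
  have e2 : g0 / 2 * (2 * A / 3) = Λ / 6 := by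
    calc _ = g0 * A / 3 := by ring
      _ = _ := by rw [hgA]; ring
  have h7 : ∫ z, (Λ / 2 * n z + g0 / 2 * (n z - p z) ^ 2 - g0 / 2 * p z ^ 2) ≤ ∫ z, H z := this
  rw [e, e2] at h7
  linarith

/-- Strict inequality for each `u` would not be enough for the infimum; the gap `η` depends only on
`p`. -/
theorem thomasFermi_lt_minEnergy {ε κ g0 : ℝ} (hε : 0 < ε) (hκ : 0 < κ) (hg : 0 < g0) :
    ENNReal.ofReal (2 / 3 * √(g0 * ε * κ / Real.pi)) < minEnergy ε κ g0 := by
  have hR1 := R₁_pos hε hκ hg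
  have hR2 := R₂_pos hε hκ hg
  set p : ℂ → ℝ := fun z => 2 / (Real.pi * (R₁ ε κ g0 * R₂ ε κ g0))
      * parab (scaleMap (R₁ ε κ g0) (R₂ ε κ g0) z) with hp
  have hpc : Continuous p := by
    have := continuous_parab
    have := continuous_scaleMap (R₁ ε κ g0) (R₂ ε κ g0)
    fun_prop
  have hps : HasCompactSupport p := by
    have h := hasCompactSupport_parab_comp_scaleMap hR1 hR2
    exact h.mul_left
  have hp0 : 0 < p 0 := by
    simp only [hp, map_zero, parab, norm_zero]
    norm_num
    positivity
  obtain ⟨η, hη, H⟩ := exists_le_integral_sub_sq hpc hps hp0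
  refine lt_of_lt_of_le (b := ENNReal.ofReal (2 / 3 * √(g0 * ε * κ / Real.pi) + g0 / 2 * η)) ?_
    (le_iInf₂ fun u hu => ?_)
  · have : 0 < g0 / 2 * η := by positivity
    exact (ENNReal.ofReal_lt_ofReal_iff (by positivity)).2 (by linarith)
  · by_cases hfin : energy ε κ g0 u = ⊤
    · rw [hfin]
      exact le_top
    · obtain ⟨hi, hle⟩ := thomasFermi_add_le_energy hε hκ hg hu.1 hu.2 hfin hp
      obtain ⟨f, hf, hfu⟩ := hu.1.2
      have e : ∀ z, ‖u z‖ ^ 2 = ‖f z‖ ^ 2 * Real.exp (-(Real.pi * ‖z‖ ^ 2)) := fun z => by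
        rw [hfu, norm_mul, mul_pow, Complex.norm_exp, ← Real.exp_nat_mul, ← Complex.ofReal_neg,
          Complex.ofReal_re]
        congr 2
        push_cast
        ring
      simp only [e] at hi hle
      refine le_trans (ENNReal.ofReal_le_ofReal ?_) hle
      gcongr
      exact H f hf hi


/-! ### Bounds on the physical parameters. -/

theorem alpha_sq (ω ν : ℝ) : alpha ω ν ^ 2 = ν ^ 4 + 4 * ω ^ 2 := by
  rw [alpha, Real.sq_sqrt (by positivity)]

theorem two_mul_le_alpha {ω : ℝ} (ν : ℝ) : 2 * ω ≤ alpha ω ν := by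
  apply Real.le_sqrt_of_sq_le
  nlinarith [sq_nonneg (ν ^ 2)]

theorem sq_le_alpha (ω ν : ℝ) : ν ^ 2 ≤ alpha ω ν := by
  apply Real.le_sqrt_of_sq_le
  nlinarith [sq_nonneg ω]

theorem beta₂_pos {ω : ℝ} (ν : ℝ) (hω : 0 < ω) : 0 < beta₂ ω ν := by
  have h1 := two_mul_le_alpha (ω := ω) ν
  have h2 : 0 < alpha ω ν := by linarith
  have h3 : 0 < mu₂ ω ν := by
    unfold mu₂
    positivity
  unfold beta₂
  positivity

theorem beta₂_le_one {ω : ℝ} (ν : ℝ) (hω : 0 < ω) : beta₂ ω ν ≤ 1 := by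
  have h1 := two_mul_le_alpha (ω := ω) ν
  have h2 : 0 < alpha ω ν := by linarith
  have hsq := alpha_sq ω ν
  rw [beta₂, div_le_one (by positivity)]
  refine le_of_sq_le_sq ?_ (by positivity)
  rw [mul_pow, mu₂, Real.sq_sqrt (by positivity)]
  -- Once `α²` is eliminated, the squared denominator exceeds the squared numerator by visibly
  -- nonnegative terms.
  have : (alpha ω ν + 2 * ω ^ 2 + ν ^ 2) ^ 2 = (2 * ω) ^ 2 * (1 + ω ^ 2 + alpha ω ν)
      + (2 * ν ^ 4 + 2 * alpha ω ν * ν ^ 2 + 4 * ω ^ 2 * ν ^ 2) := by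
    linear_combination hsq
  rw [this]
  have : 0 ≤ 2 * ν ^ 4 + 2 * alpha ω ν * ν ^ 2 + 4 * ω ^ 2 * ν ^ 2 := by positivity
  linarith

/-- Gives `ε ≤ κ`, and shows that a small `κ` forces `ν` and `ε` to be small. -/
theorem le_kappa_sq {ω ν ε : ℝ} (hω : 0 < ω) : 2 * ν ^ 2 + ε ^ 2 ≤ kappa ω ν ε ^ 2 := by
  have hb0 := beta₂_pos ν hω
  have hb1 := beta₂_le_one ν hω
  have h1 := sq_le_alpha ω ν
  have h2 : 0 < alpha ω ν - ν ^ 2 + 2 * ω ^ 2 := by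
    have : 0 < ω ^ 2 := by positivity
    linarith
  have h3 : 0 ≤ 2 * ν ^ 2 / (alpha ω ν - ν ^ 2 + 2 * ω ^ 2) := by positivity
  rw [kappa, div_pow, kappa₁, Real.sq_sqrt (by positivity), le_div_iff₀ (by positivity)]
  have h4 : beta₂ ω ν ^ 2 ≤ 1 := pow_le_one₀ hb0.le hb1
  have h5 : 0 ≤ 2 * ν ^ 2 + ε ^ 2 := by positivity
  nlinarith [mul_le_mul_of_nonneg_left h4 h5, mul_nonneg h5 h3]

theorem kappa_nonneg {ω : ℝ} (ν ε : ℝ) (hω : 0 < ω) : 0 ≤ kappa ω ν ε :=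
  div_nonneg (Real.sqrt_nonneg _) (beta₂_pos ν hω).le

theorem le_kappa {ω ν ε : ℝ} (hω : 0 < ω) : ε ≤ kappa ω ν ε := by
  refine le_of_sq_le_sq ?_ (kappa_nonneg ν ε hω)
  have := le_kappa_sq (ν := ν) (ε := ε) hω
  nlinarith [sq_nonneg ν]

/-- The factor is `(1/2) · 4² / 4`, from `g₁ ≥ g/2`, `2α/ω ≥ 4` and `β₂ ≤ 1`. -/
theorem two_mul_le_g₀ {ω ν g : ℝ} (hω : 0 < ω) (hg : 0 < g) : 2 * g ≤ g₀ ω ν g := by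
  have hb0 := beta₂_pos ν hω
  have hb1 := beta₂_le_one ν hω
  have h1 := two_mul_le_alpha (ω := ω) ν
  have h2 : 0 < alpha ω ν := by linarith
  have h3 : g / 2 ≤ g₁ ω ν g := by
    rw [g₁, div_eq_mul_one_div]
    refine mul_le_mul_of_nonneg_left ?_ hg.le
    rw [div_le_div_iff₀ (by positivity) (by positivity)]
    nlinarith [sq_nonneg ω, sq_nonneg ν]
  have h4 : 4 ≤ gammaPar ω ν := by
    rw [gammaPar, le_div_iff₀ hω]
    linarith
  have h5 : 16 ≤ gammaPar ω ν ^ 2 := by nlinarith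
  rw [g₀, le_div_iff₀ (by positivity)]
  have h7 : 0 ≤ g₁ ω ν g := by linarith
  have h6 : g / 2 * 16 ≤ g₁ ω ν g * gammaPar ω ν ^ 2 := by gcongr
  nlinarith

/-- The factor is `(3/2) · 12² / (4 · 1/6) = 324`; the lower bound on `ω` keeps `β₂` away from zero
and `2α/ω` bounded. -/
theorem g₀_le {ω ν g : ℝ} (hω : 1 / 2 ≤ ω) (hω1 : ω ≤ 1) (hν : ν ^ 2 ≤ 1) (hg : 0 < g) :
    g₀ ω ν g ≤ 324 * g := by
  have p : 0 < ω := by linarith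
  have h1 := two_mul_le_alpha (ω := ω) ν
  have h2 : 0 < alpha ω ν := by linarith
  have hsq := alpha_sq ω ν
  have h3 := sq_le_alpha ω ν
  have h4 : alpha ω ν ≤ 3 := by nlinarith [sq_nonneg ν]
  have hb : 1 / 6 ≤ beta₂ ω ν := by
    have hmu : 1 ≤ mu₂ ω ν := by
      apply Real.le_sqrt_of_sq_le
      nlinarith
    rw [beta₂, div_le_div_iff₀ (by positivity) (by positivity)]
    nlinarith
  have hg1 : g₁ ω ν g ≤ 3 / 2 * g := by
    rw [g₁, mul_comm]
    refine mul_le_mul_of_nonneg_right ?_ hg.le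
    rw [div_le_div_iff₀ (by positivity) (by positivity)]
    nlinarith
  have hg10 : 0 ≤ g₁ ω ν g := by
    unfold g₁
    positivity
  have hga : gammaPar ω ν ≤ 12 := by
    rw [gammaPar, div_le_iff₀ p]
    linarith
  have hga0 : 0 ≤ gammaPar ω ν := by
    unfold gammaPar
    positivity
  rw [g₀, div_le_iff₀ (by linarith)]
  calc _ ≤ 3 / 2 * g * 12 ^ 2 := by gcongr
    _ ≤ _ := by nlinarith

/-! ### The trial energy in the original parameters, and the theorem. -/

theorem scaleMap_trial {ε κ g0 : ℝ} (z : ℂ) :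
    ‖scaleMap (√√b * R₁ ε κ g0) (√√b * R₂ ε κ g0) z‖ ^ 2
      = z.re ^ 2 / (√b * R₁ ε κ g0 ^ 2) + z.im ^ 2 / (√b * R₂ ε κ g0 ^ 2) := by
  rw [norm_scaleMap_sq, mul_pow, mul_pow, Real.sq_sqrt (Real.sqrt_nonneg _)]

/-- The ellipse supporting `ρ` has semi-axes `b^{1/4} R₁` and `b^{1/4} R₂`. The amplitude `A` is
immaterial after normalization. -/
theorem trial_eq {ε κ g0 : ℝ} (hε : 0 < ε) (hκ : 0 < κ) (hg : 0 < g0) :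
    ∃ A : ℝ, 0 < A ∧ trial ε κ g0 = fun z =>
      (A : ℂ) * proj₀ (profile (√√b * R₁ ε κ g0) (√√b * R₂ ε κ g0)) z := by
  have hR1 := R₁_pos hε hκ hg
  have hR2 := R₂_pos hε hκ hg
  have hb := b_pos
  refine ⟨√(2 / (Real.pi * √b * R₁ ε κ g0 * R₂ ε κ g0)), by positivity, ?_⟩
  ext x
  rw [trial, proj₀_eq, proj₀_eq, ← integral_const_mul]
  congr 1
  ext y
  have : rho ε κ g0 y = √(2 / (Real.pi * √b * R₁ ε κ g0 * R₂ ε κ g0))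
      * √(parab (scaleMap (√√b * R₁ ε κ g0) (√√b * R₂ ε κ g0) y)) := by
    rw [rho, ← Real.sqrt_mul (by positivity), parab, scaleMap_trial, sub_sub]
  rw [profile, this]
  push_cast
  ring

/-- With `Λ = (ε S₁)²` one has `Λ = 2√b √(g₀εκ/π)` and `g₀/2 = Λ · π/(8b) · S₁S₂`. The energy is
therefore `Λ` times the ratio already estimated by `1/3`. -/
theorem exists_trial_energy_estimate :
    ∃ C δ : ℝ, 0 < C ∧ 0 < δ ∧ ∀ ε κ g0 : ℝ, 0 < ε → ε ≤ κ → 0 < g0 →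
      1 ≤ √√b * R₂ ε κ g0 → 1 / √(√√b * R₂ ε κ g0) ≤ δ →
      trial ε κ g0 ∈ Lambda₀ ∧ eLpNorm (trial ε κ g0) 2 volume ≠ 0 ∧
      ∃ e : ℝ, energy ε κ g0 (normalize (trial ε κ g0)) = ENNReal.ofReal e ∧
        |e - 2 / 3 * √(g0 * b * ε * κ / Real.pi)|
          ≤ C * (√(g0 * ε * κ / Real.pi) * (1 / √(√√b * R₂ ε κ g0))) := by
  obtain ⟨C, δ, hC, hδ, H⟩ := exists_trial_ratio_estimate
  obtain ⟨C2, hC2, H2⟩ := exists_trial_estimates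
  have hb := b_pos
  refine ⟨C * (2 * √b), δ, by positivity, hδ, fun ε κ g0 hε hεκ hg hS hSδ => ?_⟩
  have hκ : 0 < κ := hε.trans_le hεκ
  have hR1 := R₁_pos hε hκ hg
  have hR2 := R₂_pos hε hκ hg
  have heq := mul_R₁_eq hε hκ hg
  have hpi := Real.pi_pos
  obtain ⟨A, hA, htr⟩ := trial_eq hε hκ hg
  have hΛR := mul_R₁_sq hε hκ hg
  have hprod := R₁_mul_R₂ hε hκ hg
  have hbb : √√b ^ 2 = √b := Real.sq_sqrt (Real.sqrt_nonneg _)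
  have hbb2 : √b ^ 2 = b := Real.sq_sqrt hb.le
  set S₁ := √√b * R₁ ε κ g0 with hS1
  set S₂ := √√b * R₂ ε κ g0 with hS2
  have p1 : 0 < S₁ := by positivity
  have p2 : 0 < S₂ := by positivity
  have hSS : ε * S₁ = κ * S₂ := by
    calc _ = √√b * (ε * R₁ ε κ g0) := by ring
      _ = _ := by rw [heq]; ring
  have h12 : S₂ ≤ S₁ := by
    have : ε * S₂ ≤ ε * S₁ := by
      rw [hSS]
      gcongr
    exact le_of_mul_le_mul_left this hε
  obtain ⟨hN, hmain⟩ := H S₁ S₂ hS h12 hSδ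
  obtain ⟨⟨I1, _⟩, ⟨I2, _⟩, ⟨I3, _⟩⟩ := H2 S₁ S₂ hS h12
  have hvc := continuous_proj₀_profile p1 p2
  obtain ⟨f, hf, hfe⟩ := exists_entire_proj₀ (continuous_profile S₁ S₂) (hasCompactSupport_profile p1 p2)
  set v := proj₀ (profile S₁ S₂) with hv
  have hAv : ∀ z, ‖(A : ℂ) * v z‖ ^ 2 = A ^ 2 * ‖v z‖ ^ 2 := fun z => by
    rw [norm_mul, mul_pow, Complex.norm_real, Real.norm_of_nonneg hA.le]
  have hL := eLpNorm_two_eq (v := fun z => (A : ℂ) * v z) (by fun_prop : Continuous fun z =>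
    (A : ℂ) * v z).aestronglyMeasurable (by simp only [hAv]; exact I1.const_mul _)
  simp only [hAv] at hL
  rw [integral_const_mul] at hL
  set Λ := (ε * S₁) ^ 2 with hΛ
  have hΛ0 : 0 < Λ := by positivity
  have hΛeq : Λ = 2 * √b * √(g0 * ε * κ / Real.pi) := by
    calc Λ = √√b ^ 2 * (ε * R₁ ε κ g0) ^ 2 := by rw [hΛ, hS1]; ring
      _ = _ := by rw [hbb, hΛR]; ring
  have hΛJ : Λ * (S₁ * S₂) = 4 * b * g0 / Real.pi := by
    calc Λ * (S₁ * S₂) = (√√b ^ 2) ^ 2 * ((ε * R₁ ε κ g0) ^ 2 * (R₁ ε κ g0 * R₂ ε κ g0)) := by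
          rw [hΛ, hS1, hS2]; ring
      _ = _ := by rw [hbb, hbb2, hprod]; ring
  have hq : ∀ z : ℂ, ε ^ 2 * z.re ^ 2 + κ ^ 2 * z.im ^ 2 = Λ * ‖scaleMap S₁ S₂ z‖ ^ 2 := fun z => by
    rw [norm_scaleMap_sq, mul_add]
    congr 1
    · rw [hΛ]
      field_simp
    · rw [hΛ, hSS]
      field_simp
  rw [htr]
  refine ⟨⟨hL.1, fun z => (A : ℂ) * f z, hf.const_mul _, fun z => ?_⟩, ?_, _,
    energy_normalize_eq hg.le hΛ0.le (q := fun z => ‖scaleMap S₁ S₂ z‖ ^ 2)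
      (fun z => by positivity) hq hvc I1 I2 I3 hN hA, ?_⟩
  · change (A : ℂ) * v z = (A : ℂ) * f z * _
    rw [hfe, mul_assoc]
  · rw [hL.2]
    simp only [ne_eq, ENNReal.ofReal_eq_zero, not_le]
    positivity
  · set N := ∫ z, ‖v z‖ ^ 2
    set Q := ∫ z, ‖scaleMap S₁ S₂ z‖ ^ 2 * ‖v z‖ ^ 2
    set F := ∫ z, ‖v z‖ ^ 4
    have e1 : 2 / 3 * √(g0 * b * ε * κ / Real.pi) = Λ * (1 / 3) := by
      have : g0 * b * ε * κ / Real.pi = b * (g0 * ε * κ / Real.pi) := by ring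
      rw [this, Real.sqrt_mul hb.le, hΛeq]
      ring
    have e2 : g0 / 2 = Λ * (Real.pi / (8 * b) * (S₁ * S₂)) := by
      calc g0 / 2 = Real.pi / (8 * b) * (4 * b * g0 / Real.pi) := by
            field_simp
            norm_num
        _ = _ := by rw [← hΛJ]; ring
    have e3 : Λ / 2 * (Q / N) + g0 / 2 * (F / N ^ 2) - 2 / 3 * √(g0 * b * ε * κ / Real.pi)
        = Λ * (1 / 2 * (Q / N) + Real.pi / (8 * b) * (S₁ * S₂ * F / N ^ 2) - 1 / 3) := by
      rw [e1, e2]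
      ring
    rw [e3, abs_mul, abs_of_pos hΛ0]
    calc _ ≤ Λ * (C * (1 / √S₂)) := by gcongr
      _ = _ := by rw [hΛeq]; ring

/-- Since `S₂⁴ = 4 b g₀ ε / (π κ³)`, the relative error `S₂^{-1/2}` is of order `(κ³/ε)^{1/8}`,
uniformly because `b ≥ 1` and `g₀ ≥ 2m`. -/
theorem one_div_sqrt_pow_eight_le {ε κ g0 m : ℝ} (hε : 0 < ε) (hκ : 0 < κ) (hm : 0 < m)
    (hg : 2 * m ≤ g0) :
    (1 / √(√√b * R₂ ε κ g0)) ^ 8 ≤ Real.pi / (8 * m) * (κ ^ 3 / ε) := by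
  have hg0 : 0 < g0 := by linarith
  have hR2 := R₂_pos hε hκ hg0
  have hb := b_pos
  have hb1 := one_le_b
  have hpi := Real.pi_pos
  have e : √(√√b * R₂ ε κ g0) ^ 8 = b * (4 * g0 * ε / (Real.pi * κ ^ 3)) := by
    calc _ = (√(√√b * R₂ ε κ g0) ^ 2) ^ 4 := by ring
      _ = (√√b * R₂ ε κ g0) ^ 4 := by rw [Real.sq_sqrt (by positivity)]
      _ = ((√√b ^ 2) ^ 2) * R₂ ε κ g0 ^ 4 := by ring
      _ = _ := by
        rw [Real.sq_sqrt (Real.sqrt_nonneg _), Real.sq_sqrt hb.le, R₂_pow_four hε hκ hg0]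
  rw [div_pow, one_pow, e]
  have e2 : 1 / (b * (4 * g0 * ε / (Real.pi * κ ^ 3))) = Real.pi / (4 * (b * g0)) * (κ ^ 3 / ε) := by
    field_simp
  rw [e2]
  have : 8 * m ≤ 4 * (b * g0) := by nlinarith
  gcongr

end LLL

theorem theorem1p1 :
    |LLL.b - 1.1596| < 0.00005 ∧
    ∀ m M : ℝ, 0 < m → m ≤ M →
      ∃ C δ : ℝ, 0 < C ∧ 0 < δ ∧
        ∀ ω ν ε g κ g₀ : ℝ, 0 < ω → 0 ≤ ν → 0 < ε → ω ^ 2 + ν ^ 2 + ε ^ 2 = 1 →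
          m ≤ g → g ≤ M → κ = LLL.kappa ω ν ε → g₀ = LLL.g₀ ω ν g →
          ε < δ → κ * ε ^ (-(1 / 3) : ℝ) < δ →
          -- lower and upper bound for the infimum
          ENNReal.ofReal (2 / 3 * √(g₀ * ε * κ / Real.pi)) < LLL.minEnergy ε κ g₀ ∧
          LLL.minEnergy ε κ g₀ ≤
            ENNReal.ofReal (2 / 3 * √(g₀ * LLL.b * ε * κ / Real.pi)
              + C * (√(ε * κ) * (κ ^ 3 / ε) ^ (1 / 8 : ℝ))) ∧
          -- the trial function is admissible and its normalization realizes the upper bound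
          LLL.trial ε κ g₀ ∈ LLL.Lambda₀ ∧
          eLpNorm (LLL.trial ε κ g₀) 2 MeasureTheory.volume ≠ 0 ∧
          LLL.energy ε κ g₀ (LLL.normalize (LLL.trial ε κ g₀)) ≤
            ENNReal.ofReal (2 / 3 * √(g₀ * LLL.b * ε * κ / Real.pi)
              + C * (√(ε * κ) * (κ ^ 3 / ε) ^ (1 / 8 : ℝ))) ∧
          ENNReal.ofReal (2 / 3 * √(g₀ * LLL.b * ε * κ / Real.pi)
              - C * (√(ε * κ) * (κ ^ 3 / ε) ^ (1 / 8 : ℝ))) ≤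
            LLL.energy ε κ g₀ (LLL.normalize (LLL.trial ε κ g₀)) := by
  refine ⟨LLL.abs_b_sub_lt, fun m M hm hmM => ?_⟩
  obtain ⟨C, δ₀, hC, hδ₀, H⟩ := LLL.exists_trial_energy_estimate
  have hpi := Real.pi_pos
  have hM : 0 < M := hm.trans_le hmM
  set c := Real.pi / (8 * m) with hc
  have hc0 : 0 < c := by positivity
  set s := min δ₀ 1 with hs
  have hs0 : 0 < s := by positivity
  -- The bound `δ ≤ 1/2` ensures `κ ≤ 1/2`, hence `ω ≥ 1/2`. The bound `δ ≤ s⁸/c` makes `1/√S` at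
  -- most `s`, as the trial estimate requires.
  refine ⟨C * (√(324 * M / Real.pi) * c ^ (1 / 8 : ℝ)), min (1 / 2) (s ^ 8 / c), by positivity,
    by positivity, ?_⟩
  intro ω ν ε g κ g₀ hω hν hε hsum hmg hgM hκ hg₀ hεδ hκδ
  have hg : 0 < g := hm.trans_le hmg
  have hεκ : ε ≤ κ := hκ ▸ LLL.le_kappa hω
  have hκ0 : 0 < κ := hε.trans_le hεκ
  set δ := min (1 / 2) (s ^ 8 / c) with hδ
  have hδ0 : 0 < δ := by positivity
  have hδ1 : δ ≤ 1 / 2 := min_le_left _ _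
  have hκ3 : κ ^ 3 / ε < δ ^ 3 := by
    have h1 : (κ * ε ^ (-(1 / 3) : ℝ)) ^ 3 < δ ^ 3 := by gcongr
    have h2 : (ε ^ (-(1 / 3) : ℝ)) ^ 3 = ε⁻¹ := by
      rw [← Real.rpow_natCast, ← Real.rpow_mul hε.le, ← Real.rpow_neg_one]
      norm_num
    rwa [mul_pow, h2, ← div_eq_mul_inv] at h1
  have hε1 : ε ≤ 1 := by linarith
  have hκ1 : κ ≤ 1 / 2 := by
    have h1 : κ ^ 3 < δ ^ 3 * ε := (div_lt_iff₀ hε).1 hκ3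
    have h2 : κ ^ 3 ≤ (1 / 2) ^ 3 := by
      calc κ ^ 3 ≤ δ ^ 3 * ε := h1.le
        _ ≤ δ ^ 3 * 1 := by gcongr
        _ ≤ (1 / 2) ^ 3 := by rw [mul_one]; gcongr
    exact le_of_pow_le_pow_left₀ (by norm_num) (by norm_num) h2
  have hκsq : 2 * ν ^ 2 + ε ^ 2 ≤ κ ^ 2 := hκ ▸ LLL.le_kappa_sq hω
  -- Then `2ν² + ε² ≤ 1/4`, and the relation `ω² + ν² + ε² = 1` keeps `ω` away from zero.
  have hκ4 : κ ^ 2 ≤ 1 / 4 := by nlinarith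
  have hω2 : 1 / 2 ≤ ω := by nlinarith [sq_nonneg ν, sq_nonneg ε]
  have hω1 : ω ≤ 1 := by nlinarith [sq_nonneg ν, sq_nonneg ε]
  have hν1 : ν ^ 2 ≤ 1 := by nlinarith [sq_nonneg ω, sq_nonneg ε]
  have hgl : 2 * m ≤ g₀ := by
    have := LLL.two_mul_le_g₀ (ν := ν) hω hg
    rw [hg₀]
    linarith
  have hgu : g₀ ≤ 324 * M := by
    have := LLL.g₀_le hω2 hω1 hν1 hg
    rw [hg₀]
    linarith
  have hg0 : 0 < g₀ := by linarith
  have hR2 := LLL.R₂_pos hε hκ0 hg0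
  have hb := LLL.b_pos
  have h8 := LLL.one_div_sqrt_pow_eight_le hε hκ0 hm hgl
  set S := √√LLL.b * LLL.R₂ ε κ g₀ with hS
  have hS0 : 0 < S := by positivity
  have hXs : 1 / √S ≤ s := by
    refine le_of_pow_le_pow_left₀ (n := 8) (by norm_num) hs0.le (h8.trans ?_)
    calc c * (κ ^ 3 / ε) ≤ c * δ ^ 3 := by gcongr
      _ ≤ c * δ := by
        gcongr
        exact pow_le_of_le_one hδ0.le (by linarith) (by norm_num)
      _ ≤ c * (s ^ 8 / c) := by
        gcongr
        exact min_le_right _ _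
      _ = s ^ 8 := by field_simp
  have hS1 : 1 ≤ S := by
    have h1 : 1 / √S ≤ 1 := hXs.trans (min_le_right _ _)
    rw [div_le_one (by positivity), Real.one_le_sqrt] at h1
    exact h1
  have hX : 1 / √S ≤ c ^ (1 / 8 : ℝ) * (κ ^ 3 / ε) ^ (1 / 8 : ℝ) := by
    rw [← Real.mul_rpow hc0.le (by positivity)]
    have h1 : 1 / √S = ((1 / √S) ^ 8) ^ (1 / 8 : ℝ) := by
      rw [← Real.rpow_natCast, ← Real.rpow_mul (by positivity)]
      norm_num
    rw [h1]
    gcongr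
  obtain ⟨hmem, hne, e, he, hee⟩ := H ε κ g₀ hε hεκ hg0 hS1 (hXs.trans (min_le_left _ _))
  have herr : |e - 2 / 3 * √(g₀ * LLL.b * ε * κ / Real.pi)|
      ≤ C * (√(324 * M / Real.pi) * c ^ (1 / 8 : ℝ)) * (√(ε * κ) * (κ ^ 3 / ε) ^ (1 / 8 : ℝ)) := by
    refine hee.trans ?_
    have h1 : √(g₀ * ε * κ / Real.pi) ≤ √(324 * M / Real.pi) * √(ε * κ) := by
      rw [← Real.sqrt_mul (by positivity)]
      apply Real.sqrt_le_sqrt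
      calc g₀ * ε * κ / Real.pi = g₀ / Real.pi * (ε * κ) := by ring
        _ ≤ _ := by gcongr
    calc _ ≤ C * (√(324 * M / Real.pi) * √(ε * κ)
          * (c ^ (1 / 8 : ℝ) * (κ ^ 3 / ε) ^ (1 / 8 : ℝ))) := by gcongr
      _ = _ := by ring
  rw [abs_le] at herr
  have hup : LLL.energy ε κ g₀ (LLL.normalize (LLL.trial ε κ g₀)) ≤
      ENNReal.ofReal (2 / 3 * √(g₀ * LLL.b * ε * κ / Real.pi)
        + C * (√(324 * M / Real.pi) * c ^ (1 / 8 : ℝ))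
          * (√(ε * κ) * (κ ^ 3 / ε) ^ (1 / 8 : ℝ))) := by
    rw [he]
    apply ENNReal.ofReal_le_ofReal
    linarith [herr.2]
  refine ⟨LLL.thomasFermi_lt_minEnergy hε hκ0 hg0, ?_, hmem, hne, hup, ?_⟩
  · exact (iInf₂_le _ ⟨LLL.normalize_mem_Lambda₀ hmem,
      LLL.eLpNorm_normalize hne hmem.1.eLpNorm_ne_top⟩).trans hup
  · rw [he]
    apply ENNReal.ofReal_le_ofReal
    linarith [herr.1]
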